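/- Let $(a_k)_{k\ge 1}$ and $(b_k)_{k\ge 1}$ be two independent stationary Gaussian processes on a probability space $(\Omega,\mathcal F,\mathbb P)$, centered, with unit variance and common covariance function $\rho$, i.e. $\mathbb E[a_ka_\ell]=\mathbb E[b_kb_\ell]=\rho(|k-\ell|)$ for $k,\ell\ge 1$ and $\rho(0)=1$. Let $\mu_\rho$ be the associated spectral measure, i.e. the symmetric probability measure on $[-\pi,\pi]$ with $\rho(|k|)=\int_{-\pi}^{\pi}e^{-ikx}\,\mu_\rho(dx)$ for all $k\in\mathbb Z$, and let $\psi_\rho$ be the density of its absolutely continuous part with respect to the Lebesgue measure, extended $2\pi$-periodically to $\mathbb R$. No assumption is made on $\mu_\rho$; in particular it may be purely singular, in which case $\psi_\rho=0$. For $n\ge 1$ set \[ f_n(x)=\frac1{\sqrt n}\sum_{k=1}^n \bigl(a_k\cos(kx)+b_k\sin(kx)\bigr),\qquad x\in\mathbb R . \] There exists a centered Gaussian process $N=(N_t)_{t\in[0,2\pi]}$ with paths in $\mathcal C^1([0,2\pi])$ and covariance $\mathbb E[N_sN_t]=\mathrm{sinc}(s-t)$, where $\mathrm{sinc}(u)=\sin(u)/u$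 for $u\neq 0$ and $\mathrm{sinc}(0)=1$. Let $X$ be a random variable uniformly distributed on $[0,2\pi]$ and $N$ such a process independent of $X$, both defined on a second probability space with probability $\mathbb P_X$ (so that they are independent of the coefficients). Then, for $\mathbb P$-almost every realization of the coefficients $(a_k)_{k\ge1},(b_k)_{k\ge1}$, the localized process \[ g_n(t)=f_n\Bigl(X+\frac tn\Bigr),\qquad t\in[0,2\pi], \] converges in distribution under $\mathbb P_X$ as $n\to\infty$, as a random element of $\mathcal C^1([0,2\pi])$ endowed with the $\mathcal C^1$ topology, to \[ g_\infty(t)=\sqrt{2\pi\,\psi_\rho(X)}\;N_t,\qquad t\in[0,2\pi]. \] -/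

import Mathlib

open MeasureTheory ProbabilityTheory Filter Topology

noncomputable section

/-- The compact time interval `[0, 2π]`. -/
abbrev timeInterval : Set ℝ := Set.Icc (0 : ℝ) (2 * Real.pi)

lemma two_pi_nonneg : (0 : ℝ) ≤ 2 * Real.pi := by positivity

/-- The space `C¹([0, 2π])`. A `C¹` function `f` is recorded as the pair `(f, f')` of continuous
functions on `[0, 2π]`, where `f'` is the derivative of `f` (one-sided at the two endpoints). The
topology inherited from `C([0, 2π]) × C([0, 2π])` is the `C¹` topology, i.e. the one of the norm
`max ‖f‖_∞ ‖f'‖_∞`. -/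
def c1Submodule : Submodule ℝ (C(timeInterval, ℝ) × C(timeInterval, ℝ)) where
  carrier := {p | ∀ t : timeInterval,
    HasDerivWithinAt (Set.IccExtend two_pi_nonneg p.1) (p.2 t) timeInterval t}
  add_mem' := fun hp hq t => (hp t).add (hq t)
  zero_mem' := fun t => hasDerivWithinAt_const (t : ℝ) timeInterval (0 : ℝ)
  smul_mem' := fun c _ hp t => (hp t).const_smul c

/-- `C¹([0, 2π])` with the `C¹` topology. -/
abbrev C1Path : Type := c1Submodule

/-- The Borel `σ`-algebra of the `C¹` topology. -/
instance : MeasurableSpace C1Path := borel C1Path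

instance : BorelSpace C1Path := ⟨rfl⟩

/-- An element of `C¹([0, 2π])` is used as a function on `[0, 2π]`. -/
instance : CoeFun C1Path (fun _ => timeInterval → ℝ) := ⟨fun g => g.1.1⟩

/-- The restriction to `[0, 2π]` of a `C¹` function on `ℝ`. -/
def C1Path.ofContDiff (f : ℝ → ℝ) (hf : ContDiff ℝ 1 f) : C1Path :=
  ⟨(⟨fun t => f t, hf.continuous.comp continuous_subtype_val⟩,
    ⟨fun t => deriv f t, (hf.continuous_deriv le_rfl).comp continuous_subtype_val⟩), fun t =>
      ((hf.differentiable one_ne_zero (t : ℝ)).hasDerivAt.hasDerivWithinAt).congr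
        (fun x hx => by simp [Set.IccExtend_of_mem _ _ hx])
        (by simp [Set.IccExtend_of_mem _ _ t.2])⟩

/-- The trigonometric polynomial `f_n(x) = n^{-1/2} ∑_{k=1}^n (a_k cos(kx) + b_k sin(kx))`. -/
def trigPoly (a b : ℕ → ℝ) (n : ℕ) (x : ℝ) : ℝ :=
  (Real.sqrt n)⁻¹ * ∑ k ∈ Finset.Icc 1 n, (a k * Real.cos (k * x) + b k * Real.sin (k * x))

lemma contDiff_trigPoly_local (a b : ℕ → ℝ) (n : ℕ) (x : ℝ) :
    ContDiff ℝ 1 (fun t : ℝ => trigPoly a b n (x + t / n)) := by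
  unfold trigPoly
  fun_prop

/-- The path `t ↦ f_n(x + t/n)`, `t ∈ [0, 2π]`, as an element of `C¹([0, 2π])`. -/
def localizedPath (a b : ℕ → ℝ) (n : ℕ) (x : ℝ) : C1Path :=
  C1Path.ofContDiff (fun t => trigPoly a b n (x + t / n)) (contDiff_trigPoly_local a b n x)

/-- `(a_k)_{k ≥ 1}` is a centered stationary Gaussian process with unit variance and covariance
`E[a_k a_l] = ρ(|k - l|)`. (The value `a 0` plays no role.) -/
structure IsStationaryGaussianSeq {Ω : Type*} [MeasurableSpace Ω] (a : ℕ → Ω → ℝ) (ρ : ℕ → ℝ)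
    (P : Measure Ω) : Prop where
  gaussian : IsGaussianProcess (fun k : ℕ => a (k + 1)) P
  centered : ∀ k, 1 ≤ k → ∫ ω, a k ω ∂P = 0
  cov : ∀ k l : ℕ, 1 ≤ k → 1 ≤ l → ∫ ω, a k ω * a l ω ∂P = ρ ((k : ℤ) - l).natAbs
  unit_variance : ρ 0 = 1

/-- `μ` is the spectral measure of the correlation function `ρ`: the symmetric probability measure
on `[-π, π]` such that `ρ(|k|) = ∫ e^{-ikx} μ(dx)` for all integers `k`. -/
structure IsSpectralMeasure (ρ : ℕ → ℝ) (μ : Measure ℝ) : Prop where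
  prob : IsProbabilityMeasure μ
  carried : μ (Set.Icc (-Real.pi) Real.pi)ᶜ = 0
  symm : μ.map (fun x => -x) = μ
  fourier : ∀ k : ℤ, ((ρ k.natAbs : ℝ) : ℂ) = ∫ x : ℝ, Complex.exp (-Complex.I * k * x) ∂μ

/-- The density `ψ` of the absolutely continuous part (with respect to the Lebesgue measure) of a
measure `μ` on `[-π, π]`, extended to a `2π`-periodic function on `ℝ`. -/
def spectralDensity (μ : Measure ℝ) (x : ℝ) : ℝ :=
  (μ.rnDeriv volume (toIocMod Real.two_pi_pos (-Real.pi) x)).toReal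

/-- `N` is a random element of `C¹([0, 2π])` which is a centered Gaussian process with covariance
`E[N_s N_t] = sinc(s - t)`. -/
structure IsSincGaussian {Ω : Type*} [MeasurableSpace Ω] (N : Ω → C1Path) (Q : Measure Ω) :
    Prop where
  aemeasurable : AEMeasurable N Q
  gaussian : IsGaussianProcess (fun (t : timeInterval) ω => N ω t) Q
  centered : ∀ t : timeInterval, ∫ ω, N ω t ∂Q = 0
  cov : ∀ s t : timeInterval, ∫ ω, N ω s * N ω t ∂Q = Real.sinc ((s : ℝ) - t)

end

noncomputable section

/-! ### The space of `C¹` paths -/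

namespace C1Path

/-- The primitive `t ↦ c + ∫₀ᵗ h`, as an element of `C¹([0, 2π])`. -/
def ofPrimitive (c : ℝ) (h : C(timeInterval, ℝ)) : C1Path :=
  ⟨(⟨fun t => c + ∫ s in (0 : ℝ)..t, Set.IccExtend two_pi_nonneg h s, by
      refine continuous_const.add ?_
      exact intervalIntegral.continuous_parametric_intervalIntegral_of_continuous
        (f := fun (_ : timeInterval) s => Set.IccExtend two_pi_nonneg h s)
        ((Continuous.Icc_extend' h.continuous).comp continuous_snd) continuous_subtype_val⟩, h), by
    intro t
    have hc : Continuous (Set.IccExtend two_pi_nonneg h) := h.continuous.Icc_extend'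
    have h1 : HasDerivAt (fun x : ℝ => c + ∫ s in (0 : ℝ)..x, Set.IccExtend two_pi_nonneg h s)
        (Set.IccExtend two_pi_nonneg h t) t :=
      (intervalIntegral.integral_hasDerivAt_right (hc.intervalIntegrable _ _)
        (hc.stronglyMeasurableAtFilter _ _) hc.continuousAt).const_add c
    rw [Set.IccExtend_val] at h1
    exact h1.hasDerivWithinAt.congr (fun x hx => by simp [Set.IccExtend_of_mem _ _ hx])
      (by simp [Set.IccExtend_of_mem _ _ t.2])⟩

lemma continuous_ofPrimitive :
    Continuous fun p : ℝ × C(timeInterval, ℝ) => ofPrimitive p.1 p.2 := by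
  refine Continuous.subtype_mk (Continuous.prodMk ?_ continuous_snd) _
  refine ContinuousMap.continuous_of_continuous_uncurry _ ?_
  change Continuous fun q : (ℝ × C(timeInterval, ℝ)) × timeInterval =>
    q.1.1 + ∫ s in (0 : ℝ)..q.2, Set.IccExtend two_pi_nonneg q.1.2 s
  refine (continuous_fst.fst).add ?_
  refine intervalIntegral.continuous_parametric_intervalIntegral_of_continuous
    (f := fun (q : (ℝ × C(timeInterval, ℝ)) × timeInterval) s =>
      Set.IccExtend two_pi_nonneg q.1.2 s) ?_ (continuous_subtype_val.comp continuous_snd)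
  change Continuous fun r : ((ℝ × C(timeInterval, ℝ)) × timeInterval) × ℝ =>
    r.1.1.2 (Set.projIcc 0 (2 * Real.pi) two_pi_nonneg r.2)
  have : Continuous fun r : ((ℝ × C(timeInterval, ℝ)) × timeInterval) × ℝ =>
    Set.projIcc 0 (2 * Real.pi) two_pi_nonneg r.2 := continuous_projIcc.comp continuous_snd
  fun_prop

/-- The left endpoint of `[0, 2π]`. -/
def start : timeInterval := ⟨0, le_rfl, two_pi_nonneg⟩

lemma eq_ofPrimitive (g : C1Path) : ofPrimitive (g start) g.1.2 = g := by
  have key : ∀ t : timeInterval,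
      g start + ∫ s in (0 : ℝ)..t, Set.IccExtend two_pi_nonneg g.1.2 s = g t := by
    intro t
    have hc : Continuous (Set.IccExtend two_pi_nonneg g.1.2) := g.1.2.continuous.Icc_extend'
    have h := intervalIntegral.integral_eq_sub_of_hasDerivAt_of_le (a := (0 : ℝ)) (b := t)
      (f := Set.IccExtend two_pi_nonneg g.1.1) (f' := Set.IccExtend two_pi_nonneg g.1.2) t.2.1
      g.1.1.continuous.Icc_extend'.continuousOn (fun x hx => ?_) (hc.intervalIntegrable _ _)
    · have h0 : Set.IccExtend two_pi_nonneg (⇑g.1.1) 0 = g start :=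
        Set.IccExtend_of_mem two_pi_nonneg _ start.2
      rw [h, Set.IccExtend_val, h0]
      ring
    · have hx' : x ∈ timeInterval := ⟨hx.1.le, hx.2.le.trans t.2.2⟩
      have := g.2 ⟨x, hx'⟩
      rw [Set.IccExtend_of_mem _ _ hx']
      exact this.hasDerivAt (Icc_mem_nhds hx.1 (hx.2.trans_le t.2.2))
  refine Subtype.ext (Prod.ext (ContinuousMap.ext key) rfl)

/-- A `C¹` path is determined by its initial value and its derivative. -/
def homeoProd : C1Path ≃ₜ ℝ × C(timeInterval, ℝ) where
  toFun g := (g start, g.1.2)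
  invFun p := ofPrimitive p.1 p.2
  left_inv := eq_ofPrimitive
  right_inv p := by simp [ofPrimitive, start]
  continuous_toFun := by
    have h1 : Continuous fun g : C1Path => g.1.1 start :=
      (continuous_eval_const start).comp (continuous_fst.comp continuous_subtype_val)
    exact h1.prodMk (continuous_snd.comp continuous_subtype_val)
  continuous_invFun := continuous_ofPrimitive

instance : PolishSpace C1Path := homeoProd.isClosedEmbedding.polishSpace

lemma continuous_eval (t : timeInterval) : Continuous fun g : C1Path => g t :=
  (continuous_eval_const t).comp (continuous_fst.comp continuous_subtype_val)

/-- Continuous functions on `[0, 2π]` bounded by `M` and `M`-Lipschitz. -/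
def boundedLipschitz (M : ℝ) : Set C(timeInterval, ℝ) :=
  {h | (∀ t, |h t| ≤ M) ∧ ∀ s t, |h s - h t| ≤ M * |(s : ℝ) - t|}

lemma isCompact_boundedLipschitz (M : ℝ) : IsCompact (boundedLipschitz M) := by
  refine ArzelaAscoli.isCompact_of_equicontinuous _ ?_ ?_
  · have himage : ContinuousMap.toFun '' boundedLipschitz M =
        {f : timeInterval → ℝ | (∀ t, |f t| ≤ M) ∧ ∀ s t, |f s - f t| ≤ M * |(s : ℝ) - t|} := by
      ext f
      constructor
      · rintro ⟨h, hh, rfl⟩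
        exact hh
      · intro hf
        refine ⟨⟨f, ?_⟩, hf, rfl⟩
        have : LipschitzWith M.toNNReal f := LipschitzWith.of_dist_le_mul fun s t => by
          have h0 : 0 ≤ M := (abs_nonneg _).trans (hf.1 s)
          rw [Real.coe_toNNReal _ h0]
          exact hf.2 s t
        exact this.continuous
    rw [himage]
    refine IsCompact.of_isClosed_subset (isCompact_univ_pi fun _ => isCompact_Icc (a := -M) (b := M))
      ?_ ?_
    · simp only [Set.ofPred_and, Set.ofPred_forall]
      refine IsClosed.inter (isClosed_iInter fun t => ?_)
        (isClosed_iInter fun s => isClosed_iInter fun t => ?_)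
      · exact isClosed_le (by fun_prop) (by fun_prop)
      · exact isClosed_le (by fun_prop) (by fun_prop)
    · intro f hf t _
      exact abs_le.1 (hf.1 t)
  · rcases lt_or_ge M 0 with hM | hM
    · have : IsEmpty (boundedLipschitz M) :=
        ⟨fun h => absurd (h.2.1 start) (not_le.2 (hM.trans_le (abs_nonneg _)))⟩
      intro x U _
      exact Eventually.of_forall fun _ h => (this.false h).elim
    · refine Metric.equicontinuous_of_continuity_modulus (fun r => M * r) ?_ _ ?_
      · have : Continuous fun r : ℝ => M * r := by fun_prop
        simpa using this.tendsto 0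
      · intro s t h
        exact h.2.2 s t

/-- Compact sets exhausting the smooth paths. -/
def compactSet (M : ℝ) : Set C1Path :=
  (fun p : ℝ × C(timeInterval, ℝ) => ofPrimitive p.1 p.2) '' (Set.Icc (-M) M ×ˢ boundedLipschitz M)

lemma isCompact_compactSet (M : ℝ) : IsCompact (compactSet M) :=
  (isCompact_Icc.prod (isCompact_boundedLipschitz M)).image continuous_ofPrimitive

lemma mem_compactSet_iff {M : ℝ} {g : C1Path} :
    g ∈ compactSet M ↔ |g start| ≤ M ∧ g.1.2 ∈ boundedLipschitz M := by
  constructor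
  · rintro ⟨p, hp, rfl⟩
    have : (ofPrimitive p.1 p.2) start = p.1 := by simp [ofPrimitive, start]
    exact ⟨by rw [this]; exact abs_le.2 hp.1, hp.2⟩
  · intro h
    exact ⟨(g start, g.1.2), ⟨abs_le.1 h.1, h.2⟩, eq_ofPrimitive g⟩

lemma compactSet_mono {M M' : ℝ} (h : M ≤ M') : compactSet M ⊆ compactSet M' := by
  intro g hg
  rw [mem_compactSet_iff] at hg ⊢
  exact ⟨hg.1.trans h, fun t => (hg.2.1 t).trans h,
    fun s t => (hg.2.2 s t).trans (mul_le_mul_of_nonneg_right h (abs_nonneg _))⟩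

/-- Random paths lying in `compactSet` of a radius bounded in expectation have tight laws. -/
lemma isTightMeasureSet_of_lintegral_le {ι : Type*} {Ω : ι → Type*} [∀ i, MeasurableSpace (Ω i)]
    (P : ∀ i, Measure (Ω i)) (Y : ∀ i, Ω i → C1Path) (hY : ∀ i, AEMeasurable (Y i) (P i))
    (R : ∀ i, Ω i → ℝ) (hR : ∀ i, AEMeasurable (R i) (P i))
    (hmem : ∀ i ω, Y i ω ∈ compactSet (R i ω))
    (C : ℝ) (hC : ∀ i, ∫⁻ ω, ENNReal.ofReal (R i ω) ∂(P i) ≤ ENNReal.ofReal C) :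
    IsTightMeasureSet {μ | ∃ i, (P i).map (Y i) = μ} := by
  rw [isTightMeasureSet_iff_exists_isCompact_measure_compl_le]
  intro ε hε
  obtain ⟨δ, hδ0, hδ⟩ : ∃ δ : ℝ, 0 < δ ∧ ENNReal.ofReal δ ≤ ε := by
    by_cases h : ε = ⊤
    · exact ⟨1, one_pos, by simp [h]⟩
    · exact ⟨ε.toReal, ENNReal.toReal_pos hε.ne' h, (ENNReal.ofReal_toReal h).le⟩
  set M : ℝ := (|C| + 1) / δ with hM
  have hM0 : 0 < M := by positivity
  refine ⟨compactSet M, isCompact_compactSet M, ?_⟩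
  rintro _ ⟨i, rfl⟩
  rw [Measure.map_apply_of_aemeasurable (hY i) (isCompact_compactSet M).isClosed.measurableSet.compl]
  refine le_trans ?_ hδ
  calc P i (Y i ⁻¹' (compactSet M)ᶜ)
      ≤ P i {ω | ENNReal.ofReal M ≤ ENNReal.ofReal (R i ω)} := by
        refine measure_mono fun ω hω => ?_
        by_contra hcon
        simp only [Set.mem_ofPred_eq, not_le] at hcon
        have := (ENNReal.ofReal_lt_ofReal_iff hM0).1 hcon
        exact hω (compactSet_mono this.le (hmem i ω))
    _ ≤ (∫⁻ ω, ENNReal.ofReal (R i ω) ∂(P i)) / ENNReal.ofReal M :=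
        meas_ge_le_lintegral_div (hR i).ennreal_ofReal (by simpa using hM0) ENNReal.ofReal_ne_top
    _ ≤ ENNReal.ofReal C / ENNReal.ofReal M := by gcongr; exact hC i
    _ = ENNReal.ofReal (C / M) := (ENNReal.ofReal_div_of_pos hM0).symm
    _ ≤ ENNReal.ofReal δ := by
        refine ENNReal.ofReal_le_ofReal ?_
        rw [div_le_iff₀ hM0, hM, mul_div_cancel₀ _ hδ0.ne']
        linarith [le_abs_self C]

/-- The restriction of a smooth function lies in an explicit compact set. -/
lemma ofContDiff_mem_compactSet (f : ℝ → ℝ) (hf : ContDiff ℝ 1 f) {f₁ f₂ f₃ : ℝ → ℝ}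
    (h₁ : ∀ t, HasDerivAt f (f₁ t) t) (h₂ : ∀ t, HasDerivAt f₁ (f₂ t) t)
    (h₃ : ∀ t, HasDerivAt f₂ (f₃ t) t) (hcont : Continuous f₃) :
    ofContDiff f hf ∈ compactSet
      (|f 0| + |f₁ 0| + 8 * (|f₂ 0| + ∫ s in (0 : ℝ)..(2 * Real.pi), |f₃ s|)) := by
  set J : ℝ := ∫ s in (0 : ℝ)..(2 * Real.pi), |f₃ s| with hJ
  have hJ0 : 0 ≤ J := intervalIntegral.integral_nonneg two_pi_nonneg fun _ _ => abs_nonneg _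
  have hf₂ : ∀ t ∈ timeInterval, |f₂ t| ≤ |f₂ 0| + J := by
    intro t ht
    have h := intervalIntegral.integral_eq_sub_of_hasDerivAt (a := 0) (b := t) (fun x _ => h₃ x)
      (hcont.intervalIntegrable _ _)
    have h' : |∫ s in (0 : ℝ)..t, f₃ s| ≤ J := by
      refine (intervalIntegral.abs_integral_le_integral_abs ht.1).trans ?_
      exact intervalIntegral.integral_mono_interval le_rfl ht.1 ht.2
        (Eventually.of_forall fun _ => abs_nonneg _) (hcont.abs.intervalIntegrable _ _)
    have : f₂ t = f₂ 0 + ∫ s in (0 : ℝ)..t, f₃ s := by rw [h]; ring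
    rw [this]
    exact (abs_add_le _ _).trans (by gcongr)
  have hlip : ∀ s ∈ timeInterval, ∀ t ∈ timeInterval, |f₁ s - f₁ t| ≤ (|f₂ 0| + J) * |s - t| := by
    intro s hs t ht
    have := (convex_Icc (0 : ℝ) (2 * Real.pi)).norm_image_sub_le_of_norm_hasDerivWithin_le
      (fun x _ => (h₂ x).hasDerivWithinAt) (fun x hx => by simpa using hf₂ x hx) ht hs
    simpa using this
  have hd : ∀ t, deriv f t = f₁ t := fun t => (h₁ t).deriv
  have hpi : 2 * Real.pi ≤ 8 := by linarith [Real.pi_le_four]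
  have ha : 0 ≤ |f₂ 0| + J := by positivity
  rw [mem_compactSet_iff]
  refine ⟨?_, fun t => ?_, fun s t => ?_⟩
  · change |f 0| ≤ _
    nlinarith [abs_nonneg (f₁ 0)]
  · change |deriv f t| ≤ _
    rw [hd]
    have h0 := hlip t t.2 0 ⟨le_rfl, two_pi_nonneg⟩
    have h1 : |(t : ℝ) - 0| ≤ 8 := by
      rw [sub_zero, abs_of_nonneg t.2.1]
      exact t.2.2.trans hpi
    have h2 : |f₁ t| ≤ |f₁ 0| + |f₁ t - f₁ 0| := by
      have := abs_add_le (f₁ 0) (f₁ t - f₁ 0)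
      simpa using this
    nlinarith [abs_nonneg (f 0)]
  · change |deriv f s - deriv f t| ≤ _
    rw [hd, hd]
    refine (hlip s s.2 t t.2).trans (mul_le_mul_of_nonneg_right ?_ (abs_nonneg _))
    nlinarith [abs_nonneg (f 0), abs_nonneg (f₁ 0)]

end C1Path

namespace C1Path

open BoundedContinuousFunction

instance : Nonempty timeInterval := ⟨start⟩

/-- A countable dense family of times. -/
def denseTime (j : ℕ) : timeInterval := TopologicalSpace.denseSeq timeInterval j

/-- A finite combination of the values of a path at the times `denseTime j`. -/
def testFunctional (w : ℕ →₀ ℚ) (g : C1Path) : ℝ := w.sum fun j q => (q : ℝ) * g (denseTime j)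

lemma continuous_testFunctional (w : ℕ →₀ ℚ) : Continuous (testFunctional w) :=
  continuous_finsetSum _ fun j _ => continuous_const.mul (continuous_eval (denseTime j))

lemma testFunctional_add (w w' : ℕ →₀ ℚ) (g : C1Path) :
    testFunctional (w + w') g = testFunctional w g + testFunctional w' g := by
  unfold testFunctional
  exact Finsupp.sum_add_index (by simp) (by intros; push_cast; ring)

lemma testFunctional_neg (w : ℕ →₀ ℚ) (g : C1Path) :
    testFunctional (-w) g = -testFunctional w g := by
  have := testFunctional_add w (-w) g
  rw [add_neg_cancel] at this
  have h0 : testFunctional 0 g = 0 := by simp [testFunctional]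
  linarith

/-- The character `g ↦ exp(i ∑ w_j g(t_j))` as a bounded continuous function. -/
def testChar (w : ℕ →₀ ℚ) : C1Path →ᵇ ℂ :=
  BoundedContinuousFunction.ofNormedAddCommGroup
    (fun g => Complex.exp (testFunctional w g * Complex.I))
    (by have := continuous_testFunctional w; fun_prop) 1
    (fun g => (Complex.norm_exp_ofReal_mul_I _).le)

lemma testChar_apply (w : ℕ →₀ ℚ) (g : C1Path) :
    testChar w g = Complex.exp (testFunctional w g * Complex.I) := rfl

lemma testChar_mul (w w' : ℕ →₀ ℚ) : testChar w * testChar w' = testChar (w + w') := by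
  ext g
  simp only [BoundedContinuousFunction.mul_apply, testChar_apply, testFunctional_add]
  rw [← Complex.exp_add]
  push_cast
  ring_nf

lemma testChar_star (w : ℕ →₀ ℚ) : star (testChar w) = testChar (-w) := by
  ext g
  simp only [BoundedContinuousFunction.star_apply, testChar_apply, testFunctional_neg]
  rw [Complex.star_def, ← Complex.exp_conj]
  simp

lemma eq_of_eval_denseTime {g h : C1Path} (H : ∀ j, g (denseTime j) = h (denseTime j)) : g = h := by
  have h1 : g.1.1 = h.1.1 := by
    refine ContinuousMap.ext fun t => ?_
    have := (TopologicalSpace.denseRange_denseSeq timeInterval).equalizer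
      g.1.1.continuous h.1.1.continuous (funext H)
    exact congrFun this t
  have h2 : g.1.2 = h.1.2 := by
    refine ContinuousMap.ext fun t => ?_
    have hg := g.2 t
    rw [h1] at hg
    exact (uniqueDiffOn_Icc (by positivity : (0 : ℝ) < 2 * Real.pi) t t.2).eq_deriv _ hg (h.2 t)
  exact Subtype.ext (Prod.ext h1 h2)

/-- The star algebra spanned by the characters `testChar w`. -/
def testAlgebra : StarSubalgebra ℂ (C1Path →ᵇ ℂ) := StarAlgebra.adjoin ℂ (Set.range testChar)

lemma mem_testAlgebra {f : C1Path →ᵇ ℂ} (hf : f ∈ testAlgebra) :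
    f ∈ Submodule.span ℂ (Set.range testChar) := by
  have hstar : star (Set.range testChar) ⊆ Set.range testChar := by
    rintro f ⟨w, hw⟩
    exact ⟨-w, by rw [← testChar_star, hw, star_star]⟩
  let S : Submonoid (C1Path →ᵇ ℂ) :=
    { carrier := Set.range testChar
      mul_mem' := by
        rintro _ _ ⟨w, rfl⟩ ⟨w', rfl⟩
        exact ⟨w + w', (testChar_mul w w').symm⟩
      one_mem' := ⟨0, by ext g; simp [testChar_apply, testFunctional]⟩ }
  have h1 : f ∈ Algebra.adjoin ℂ (Set.range testChar ∪ star (Set.range testChar)) := hf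
  rw [Set.union_eq_self_of_subset_right hstar] at h1
  have h2 : f ∈ Subalgebra.toSubmodule (Algebra.adjoin ℂ (Set.range testChar)) := h1
  rw [Algebra.adjoin_eq_span] at h2
  have h3 : (Submonoid.closure (Set.range testChar) : Set (C1Path →ᵇ ℂ)) ⊆ Set.range testChar :=
    Submonoid.closure_le.2 (le_refl (S : Set (C1Path →ᵇ ℂ)))
  exact Submodule.span_mono h3 h2

lemma testAlgebra_separatesPoints :
    (testAlgebra.map (toContinuousMapStarₐ ℂ)).SeparatesPoints := by
  intro g h hgh
  obtain ⟨j, hj⟩ : ∃ j, g (denseTime j) ≠ h (denseTime j) := by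
    by_contra! hcon
    exact hgh (eq_of_eval_denseTime hcon)
  set δ : ℝ := g (denseTime j) - h (denseTime j) with hδ
  have hδ0 : 0 < |δ| := abs_pos.2 (sub_ne_zero.2 hj)
  obtain ⟨q, hq0, hq1⟩ := exists_rat_btwn (div_pos (by positivity : (0 : ℝ) < 2 * Real.pi) hδ0)
  have hq2 : (q : ℝ) * |δ| < 2 * Real.pi := (lt_div_iff₀ hδ0).1 hq1
  refine ⟨_, ⟨testChar (Finsupp.single j q), ⟨testChar (Finsupp.single j q),
    StarAlgebra.subset_adjoin ℂ _ ⟨_, rfl⟩, rfl⟩, rfl⟩, ?_⟩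
  intro heq
  have heq' : Complex.exp (testFunctional (Finsupp.single j q) g * Complex.I) =
    Complex.exp (testFunctional (Finsupp.single j q) h * Complex.I) := heq
  rw [Complex.exp_eq_exp_iff_exists_int] at heq'
  obtain ⟨n, hn⟩ := heq'
  have hn' : (q : ℝ) * δ = n * (2 * Real.pi) := by
    have h1 : ((q * δ : ℝ) : ℂ) * Complex.I = ((n * (2 * Real.pi) : ℝ) : ℂ) * Complex.I := by
      simp only [testFunctional, Finsupp.sum_single_index, Rat.cast_zero, zero_mul] at hn
      rw [hδ]
      push_cast at hn ⊢
      linear_combination hn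
    exact_mod_cast mul_right_cancel₀ Complex.I_ne_zero h1
  have hlt : |(n : ℝ)| * (2 * Real.pi) < 1 * (2 * Real.pi) := by
    rw [one_mul, ← abs_of_pos (by positivity : (0 : ℝ) < 2 * Real.pi), ← abs_mul, ← hn', abs_mul,
      abs_of_pos (by exact_mod_cast hq0 : (0 : ℝ) < q)]
    rwa [abs_of_pos (by positivity : (0 : ℝ) < 2 * Real.pi)]
  have hn0 : n = 0 := by
    have : |(n : ℝ)| < 1 := lt_of_mul_lt_mul_right hlt (by positivity)
    exact Int.abs_lt_one_iff.1 (by exact_mod_cast this)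
  rw [hn0] at hn'
  have hq' : (0 : ℝ) < q := by exact_mod_cast hq0
  simp only [Int.cast_zero, zero_mul, mul_eq_zero, hq'.ne', false_or] at hn'
  exact hδ0.ne' (by rw [hn', abs_zero])

/-- Tightness and convergence of the finite-dimensional characteristic functions at rational
frequencies and dense times imply weak convergence on `C¹([0, 2π])`. -/
lemma tendsto_of_tight_of_testChar {μ : ℕ → ProbabilityMeasure C1Path}
    (h_tight : IsTightMeasureSet {(μ n : Measure C1Path) | n}) {μ₀ : ProbabilityMeasure C1Path}
    (h : ∀ w : ℕ →₀ ℚ, Tendsto (fun n => ∫ g, Complex.exp (testFunctional w g * Complex.I) ∂(μ n))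
      atTop (𝓝 (∫ g, Complex.exp (testFunctional w g * Complex.I) ∂μ₀))) :
    Tendsto μ atTop (𝓝 μ₀) := by
  refine ProbabilityMeasure.tendsto_of_tight_of_separatesPoints ℂ h_tight
    testAlgebra_separatesPoints fun f hf => ?_
  have hint : ∀ (f : C1Path →ᵇ ℂ) (ν : ProbabilityMeasure C1Path),
      Integrable f (ν : Measure C1Path) := fun f ν => f.integrable _
  have hspan := mem_testAlgebra hf
  clear hf
  induction hspan using Submodule.span_induction with
  | mem f hf =>
    obtain ⟨w, rfl⟩ := hf
    exact h w
  | zero => simp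
  | add f f' _ _ hf hf' =>
    simp only [BoundedContinuousFunction.add_apply]
    rw [integral_add (hint f _) (hint f' _)]
    refine (hf.add hf').congr fun n => ?_
    rw [integral_add (hint f _) (hint f' _)]
  | smul c f _ hf =>
    simp only [BoundedContinuousFunction.smul_apply, smul_eq_mul]
    simp_rw [integral_const_mul]
    exact hf.const_mul c

end C1Path

/-! ### Trigonometric sums -/

/-- The linear combination `∑_{k=1}^n (a_k Re w_k + b_k Im w_k)`. -/
def trigSum (a b : ℕ → ℝ) (n : ℕ) (w : ℕ → ℂ) : ℝ :=
  ∑ k ∈ Finset.Icc 1 n, (a k * (w k).re + b k * (w k).im)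

/-- The weights `n^{-1/2} m(k/n) e^{ikx}`. -/
def trigWeight (m : ℝ → ℂ) (n : ℕ) (x : ℝ) (k : ℕ) : ℂ :=
  ((Real.sqrt n)⁻¹ : ℝ) * m (k / n) * Complex.exp (Complex.I * (k * x : ℝ))

/-- The `j`-th derivative in `t` of the path `t ↦ f_n(x + t/n)`. -/
def localDeriv (a b : ℕ → ℝ) (n : ℕ) (j : ℕ) (x t : ℝ) : ℝ :=
  trigSum a b n (trigWeight (fun v => (Complex.I * v) ^ j * Complex.exp (Complex.I * (v * t : ℝ))) n x)

lemma trigSum_sub (a b : ℕ → ℝ) (n : ℕ) (w w' : ℕ → ℂ) :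
    trigSum a b n w - trigSum a b n w' = trigSum a b n (fun k => w k - w' k) := by
  unfold trigSum
  rw [← Finset.sum_sub_distrib]
  refine Finset.sum_congr rfl fun k _ => ?_
  simp only [Complex.sub_re, Complex.sub_im]
  ring

lemma trigSum_eq_re (a b : ℕ → ℝ) (n : ℕ) (w : ℕ → ℂ) :
    trigSum a b n w = (∑ k ∈ Finset.Icc 1 n, ((a k : ℂ) - Complex.I * b k) * w k).re := by
  unfold trigSum
  rw [Complex.re_sum]
  refine Finset.sum_congr rfl fun k _ => ?_
  simp

lemma trigWeight_re (n : ℕ) (x t : ℝ) (k : ℕ) :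
    (trigWeight (fun v => Complex.exp (Complex.I * (v * t : ℝ))) n x k).re
      = (Real.sqrt n)⁻¹ * Real.cos (k * (x + t / n)) ∧
    (trigWeight (fun v => Complex.exp (Complex.I * (v * t : ℝ))) n x k).im
      = (Real.sqrt n)⁻¹ * Real.sin (k * (x + t / n)) := by
  have h : trigWeight (fun v => Complex.exp (Complex.I * (v * t : ℝ))) n x k =
      ((Real.sqrt n)⁻¹ : ℝ) * Complex.exp ((k * (x + t / n) : ℝ) * Complex.I) := by
    unfold trigWeight
    rw [mul_assoc, ← Complex.exp_add]
    congr 2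
    push_cast
    ring
  rw [h, Complex.re_ofReal_mul, Complex.im_ofReal_mul, Complex.exp_ofReal_mul_I_re,
    Complex.exp_ofReal_mul_I_im]
  exact ⟨rfl, rfl⟩

lemma localDeriv_zero (a b : ℕ → ℝ) (n : ℕ) (x t : ℝ) :
    localDeriv a b n 0 x t = trigPoly a b n (x + t / n) := by
  unfold localDeriv trigSum trigPoly
  rw [Finset.mul_sum]
  refine Finset.sum_congr rfl fun k _ => ?_
  simp only [pow_zero, one_mul]
  rw [(trigWeight_re n x t k).1, (trigWeight_re n x t k).2]
  ring

lemma hasDerivAt_localDeriv (a b : ℕ → ℝ) (n j : ℕ) (x t : ℝ) :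
    HasDerivAt (localDeriv a b n j x) (localDeriv a b n (j + 1) x t) t := by
  have hw : ∀ k : ℕ, HasDerivAt (fun t : ℝ => trigWeight
      (fun v => (Complex.I * v) ^ j * Complex.exp (Complex.I * (v * t : ℝ))) n x k)
      (trigWeight (fun v => (Complex.I * v) ^ (j + 1) * Complex.exp (Complex.I * (v * t : ℝ))) n x k)
      t := by
    intro k
    unfold trigWeight
    refine HasDerivAt.mul_const ?_ _
    refine HasDerivAt.const_mul _ ?_
    have h1 : HasDerivAt (fun t : ℝ => Complex.I * (((k / n : ℝ) * t : ℝ) : ℂ))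
        (Complex.I * ((k / n : ℝ) : ℂ)) t := by
      have : HasDerivAt (fun t : ℝ => (k / n : ℝ) * t) (k / n : ℝ) t := by
        simpa using (hasDerivAt_id t).const_mul (k / n : ℝ)
      exact this.ofReal_comp.const_mul _
    convert! (h1.cexp).const_mul ((Complex.I * ((k / n : ℝ) : ℂ)) ^ j) using 1
    ring
  unfold localDeriv trigSum
  refine HasDerivAt.fun_sum fun k _ => ?_
  refine HasDerivAt.add ?_ ?_
  · exact (Complex.reCLM.hasFDerivAt.comp_hasDerivAt t (hw k)).const_mul _
  · exact (Complex.imCLM.hasFDerivAt.comp_hasDerivAt t (hw k)).const_mul _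

lemma continuous_localDeriv {X : Type*} [TopologicalSpace X] {a b : X → ℕ → ℝ} {x t : X → ℝ}
    (ha : ∀ k, Continuous fun p => a p k) (hb : ∀ k, Continuous fun p => b p k)
    (hx : Continuous x) (ht : Continuous t) (n j : ℕ) :
    Continuous fun p => localDeriv (a p) (b p) n j (x p) (t p) := by
  unfold localDeriv trigSum trigWeight
  refine continuous_finsetSum _ fun k _ => ?_
  refine ((ha k).mul (Complex.continuous_re.comp ?_)).add
    ((hb k).mul (Complex.continuous_im.comp ?_)) <;> fun_prop

lemma continuous_localDeriv_time (a b : ℕ → ℝ) (n j : ℕ) (x : ℝ) :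
    Continuous (localDeriv a b n j x) :=
  continuous_localDeriv (X := ℝ) (a := fun _ => a) (b := fun _ => b) (x := fun _ => x)
    (fun _ => continuous_const) (fun _ => continuous_const) continuous_const continuous_id n j

lemma localizedPath_mem_compactSet (a b : ℕ → ℝ) (n : ℕ) (x : ℝ) :
    localizedPath a b n x ∈ C1Path.compactSet
      (|localDeriv a b n 0 x 0| + |localDeriv a b n 1 x 0| + 8 * (|localDeriv a b n 2 x 0| +
        ∫ s in (0 : ℝ)..(2 * Real.pi), |localDeriv a b n 3 x s|)) := by
  have h0 : localDeriv a b n 0 x = fun t => trigPoly a b n (x + t / n) :=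
    funext fun t => localDeriv_zero a b n x t
  have := C1Path.ofContDiff_mem_compactSet (fun t => trigPoly a b n (x + t / n))
    (contDiff_trigPoly_local a b n x) (f₁ := localDeriv a b n 1 x) (f₂ := localDeriv a b n 2 x)
    (f₃ := localDeriv a b n 3 x) (fun t => by rw [← h0]; exact hasDerivAt_localDeriv a b n 0 x t)
    (hasDerivAt_localDeriv a b n 1 x) (hasDerivAt_localDeriv a b n 2 x)
    (continuous_localDeriv_time a b n 3 x)
  rw [localDeriv_zero]
  exact this

lemma continuous_localizedPath {X : Type*} [TopologicalSpace X] {a b : X → ℕ → ℝ} {x : X → ℝ}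
    (ha : ∀ k, Continuous fun p => a p k) (hb : ∀ k, Continuous fun p => b p k)
    (hx : Continuous x) (n : ℕ) : Continuous fun p => localizedPath (a p) (b p) n (x p) := by
  have key : ∀ j, Continuous fun q : X × timeInterval =>
      localDeriv (a q.1) (b q.1) n j (x q.1) q.2 := fun j =>
    continuous_localDeriv (fun k => (ha k).comp continuous_fst) (fun k => (hb k).comp continuous_fst)
      (hx.comp continuous_fst) (continuous_subtype_val.comp continuous_snd) n j
  refine Continuous.subtype_mk (Continuous.prodMk ?_ ?_) _
  · refine ContinuousMap.continuous_of_continuous_uncurry _ ?_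
    refine (key 0).congr fun q => ?_
    exact localDeriv_zero _ _ n _ _
  · refine ContinuousMap.continuous_of_continuous_uncurry _ ?_
    refine (key 1).congr fun q => ?_
    have h0 : localDeriv (a q.1) (b q.1) n 0 (x q.1) =
        fun t => trigPoly (a q.1) (b q.1) n (x q.1 + t / n) :=
      funext fun t => localDeriv_zero _ _ n _ t
    have := (hasDerivAt_localDeriv (a q.1) (b q.1) n 0 (x q.1) q.2).deriv
    rw [h0] at this
    exact this.symm

/-- Tightness of the localized paths from bounds on the derivatives in expectation. -/
lemma isTightMeasureSet_localizedPath {ι : Type*} {Ω : ι → Type*} [∀ i, TopologicalSpace (Ω i)]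
    [∀ i, MeasurableSpace (Ω i)] [∀ i, OpensMeasurableSpace (Ω i)]
    (P : ∀ i, Measure (Ω i)) [∀ i, IsProbabilityMeasure (P i)] (a b : ∀ i, Ω i → ℕ → ℝ)
    (x : ∀ i, Ω i → ℝ) (n : ι → ℕ) (ha : ∀ i k, Continuous fun p => a i p k)
    (hb : ∀ i k, Continuous fun p => b i p k) (hx : ∀ i, Continuous (x i)) (C : ℝ) (hC0 : 0 ≤ C)
    (hC : ∀ i j s, ∫⁻ p, ENNReal.ofReal |localDeriv (a i p) (b i p) (n i) j (x i p) s| ∂(P i)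
      ≤ ENNReal.ofReal C) :
    IsTightMeasureSet {μ | ∃ i, (P i).map (fun p => localizedPath (a i p) (b i p) (n i) (x i p)) = μ} := by
  have hcont : ∀ i j s, Continuous fun p => localDeriv (a i p) (b i p) (n i) j (x i p) s :=
    fun i j s => continuous_localDeriv (ha i) (hb i) (hx i) continuous_const (n i) j
  have hcont2 : ∀ i j, Continuous fun q : Ω i × ℝ =>
      localDeriv (a i q.1) (b i q.1) (n i) j (x i q.1) q.2 :=
    fun i j => continuous_localDeriv (fun k => (ha i k).comp continuous_fst)
      (fun k => (hb i k).comp continuous_fst) ((hx i).comp continuous_fst) continuous_snd (n i) j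
  have hint : ∀ i, Continuous fun p =>
      ∫ s in (0 : ℝ)..(2 * Real.pi), |localDeriv (a i p) (b i p) (n i) 3 (x i p) s| := by
    intro i
    refine intervalIntegral.continuous_parametric_intervalIntegral_of_continuous' ?_ _ _
    exact (hcont2 i 3).abs
  refine C1Path.isTightMeasureSet_of_lintegral_le P
    (fun i p => localizedPath (a i p) (b i p) (n i) (x i p))
    (fun i => (continuous_localizedPath (ha i) (hb i) (hx i) (n i)).measurable.aemeasurable)
    (fun i p => |localDeriv (a i p) (b i p) (n i) 0 (x i p) 0|
      + |localDeriv (a i p) (b i p) (n i) 1 (x i p) 0|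
      + 8 * (|localDeriv (a i p) (b i p) (n i) 2 (x i p) 0| +
        ∫ s in (0 : ℝ)..(2 * Real.pi), |localDeriv (a i p) (b i p) (n i) 3 (x i p) s|))
    (fun i => Measurable.aemeasurable (Continuous.measurable
      (((hcont i 0 0).abs.add (hcont i 1 0).abs).add
        (((hcont i 2 0).abs.add (hint i)).const_mul 8))))
    (fun i p => localizedPath_mem_compactSet _ _ _ _) (C + C + 8 * (C + 2 * Real.pi * C)) fun i => ?_
  have hm : ∀ j s, Measurable fun p =>
      ENNReal.ofReal |localDeriv (a i p) (b i p) (n i) j (x i p) s| :=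
    fun j s => (hcont i j s).abs.measurable.ennreal_ofReal
  have hJ0 : ∀ p, 0 ≤ ∫ s in (0 : ℝ)..(2 * Real.pi),
      |localDeriv (a i p) (b i p) (n i) 3 (x i p) s| :=
    fun p => intervalIntegral.integral_nonneg two_pi_nonneg fun _ _ => abs_nonneg _
  have hJ : ∀ p, ENNReal.ofReal (∫ s in (0 : ℝ)..(2 * Real.pi),
      |localDeriv (a i p) (b i p) (n i) 3 (x i p) s|) =
      ∫⁻ s in Set.Ioc 0 (2 * Real.pi),
        ENNReal.ofReal |localDeriv (a i p) (b i p) (n i) 3 (x i p) s| := by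
    intro p
    rw [intervalIntegral.integral_of_le two_pi_nonneg]
    refine ofReal_integral_eq_lintegral_ofReal ?_ (Eventually.of_forall fun _ => abs_nonneg _)
    have : Continuous fun s => |localDeriv (a i p) (b i p) (n i) 3 (x i p) s| :=
      (continuous_localDeriv_time _ _ _ 3 _).abs
    exact (intervalIntegrable_iff_integrableOn_Ioc_of_le two_pi_nonneg).1
      (this.intervalIntegrable _ _)
  have hJint : ∫⁻ p, ENNReal.ofReal (∫ s in (0 : ℝ)..(2 * Real.pi),
      |localDeriv (a i p) (b i p) (n i) 3 (x i p) s|) ∂(P i) ≤ ENNReal.ofReal (2 * Real.pi * C) := by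
    simp_rw [hJ]
    rw [lintegral_lintegral_swap]
    · refine (lintegral_mono fun s => hC i 3 s).trans ?_
      rw [lintegral_const, Measure.restrict_apply_univ, Real.volume_Ioc, sub_zero, mul_comm,
        ← ENNReal.ofReal_mul two_pi_nonneg]
    · exact (hcont2 i 3).abs.measurable.ennreal_ofReal.aemeasurable
  have hpt : ∀ p, ENNReal.ofReal (|localDeriv (a i p) (b i p) (n i) 0 (x i p) 0|
      + |localDeriv (a i p) (b i p) (n i) 1 (x i p) 0|
      + 8 * (|localDeriv (a i p) (b i p) (n i) 2 (x i p) 0| +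
        ∫ s in (0 : ℝ)..(2 * Real.pi), |localDeriv (a i p) (b i p) (n i) 3 (x i p) s|)) =
      ENNReal.ofReal |localDeriv (a i p) (b i p) (n i) 0 (x i p) 0|
      + ENNReal.ofReal |localDeriv (a i p) (b i p) (n i) 1 (x i p) 0|
      + ENNReal.ofReal 8 * (ENNReal.ofReal |localDeriv (a i p) (b i p) (n i) 2 (x i p) 0| +
        ENNReal.ofReal (∫ s in (0 : ℝ)..(2 * Real.pi),
          |localDeriv (a i p) (b i p) (n i) 3 (x i p) s|)) := by
    intro p
    have := hJ0 p
    rw [ENNReal.ofReal_add (by positivity) (by positivity),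
      ENNReal.ofReal_add (by positivity) (by positivity), ENNReal.ofReal_mul (by norm_num),
      ENNReal.ofReal_add (by positivity) this]
  have hm01 : Measurable fun p => ENNReal.ofReal |localDeriv (a i p) (b i p) (n i) 0 (x i p) 0|
      + ENNReal.ofReal |localDeriv (a i p) (b i p) (n i) 1 (x i p) 0| := (hm 0 0).add (hm 1 0)
  simp_rw [hpt]
  rw [lintegral_add_left hm01, lintegral_add_left (hm 0 0),
    lintegral_const_mul' _ _ ENNReal.ofReal_ne_top, lintegral_add_left (hm 2 0),
    ENNReal.ofReal_add (by positivity) (by positivity), ENNReal.ofReal_add hC0 hC0,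
    ENNReal.ofReal_mul (by norm_num), ENNReal.ofReal_add hC0 (by positivity)]
  gcongr
  · exact hC i 0 0
  · exact hC i 1 0
  · exact hC i 2 0

/-! ### The uniform distribution on `[0, 2π]` -/

/-- The uniform distribution on `[0, 2π]`. -/
def uniformMeasure : Measure ℝ := ProbabilityTheory.cond volume (Set.Icc 0 (2 * Real.pi))

lemma uniformMeasure_eq : uniformMeasure =
    ENNReal.ofReal (2 * Real.pi)⁻¹ • volume.restrict (Set.Ioc 0 (2 * Real.pi)) := by
  rw [uniformMeasure, ProbabilityTheory.cond, Real.volume_Icc, sub_zero,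
    ENNReal.ofReal_inv_of_pos (by positivity), restrict_Ioc_eq_restrict_Icc]

instance : IsProbabilityMeasure uniformMeasure :=
  cond_isProbabilityMeasure_of_finite (by simp [Real.volume_Icc, Real.pi_pos])
    (by rw [Real.volume_Icc]; exact ENNReal.ofReal_ne_top)

lemma integral_uniformMeasure {E : Type*} [NormedAddCommGroup E] [NormedSpace ℝ E] (f : ℝ → E) :
    ∫ x, f x ∂uniformMeasure = (2 * Real.pi)⁻¹ • ∫ x in (0 : ℝ)..(2 * Real.pi), f x := by
  rw [uniformMeasure_eq, integral_smul_measure, intervalIntegral.integral_of_le two_pi_nonneg,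
    ENNReal.toReal_ofReal (by positivity)]

lemma uniformMeasure_absolutelyContinuous : uniformMeasure ≪ volume := by
  rw [uniformMeasure_eq]
  exact (Measure.smul_absolutelyContinuous).trans Measure.restrict_le_self.absolutelyContinuous

lemma integral_exp_mul_conj (k l : ℕ) :
    ∫ x in (0 : ℝ)..(2 * Real.pi), Complex.exp (Complex.I * (k * x : ℝ)) *
      (starRingEnd ℂ) (Complex.exp (Complex.I * (l * x : ℝ))) = if k = l then 2 * Real.pi else 0 := by
  have h : ∀ x : ℝ, Complex.exp (Complex.I * (k * x : ℝ)) *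
      (starRingEnd ℂ) (Complex.exp (Complex.I * (l * x : ℝ)))
      = Complex.exp ((Complex.I * ((k : ℂ) - l)) * x) := by
    intro x
    rw [← Complex.exp_conj, ← Complex.exp_add]
    congr 1
    simp only [map_mul, Complex.conj_I, Complex.conj_ofReal]
    push_cast
    ring
  simp_rw [h]
  split_ifs with hkl
  · subst hkl
    simp
  · have hne : Complex.I * ((k : ℂ) - l) ≠ 0 :=
      mul_ne_zero Complex.I_ne_zero (sub_ne_zero.2 (by exact_mod_cast hkl))
    rw [integral_exp_mul_complex hne]
    have : Complex.exp (Complex.I * ((k : ℂ) - l) * ((2 * Real.pi : ℝ) : ℂ)) = 1 := by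
      rw [Complex.exp_eq_one_iff]
      exact ⟨(k : ℤ) - l, by push_cast; ring⟩
    rw [this]
    simp

/-- Parseval's identity for trigonometric polynomials. -/
lemma integral_normSq_trig (s : Finset ℕ) (c : ℕ → ℂ) :
    ∫ x in (0 : ℝ)..(2 * Real.pi), ‖∑ k ∈ s, c k * Complex.exp (Complex.I * (k * x : ℝ))‖ ^ 2 =
      2 * Real.pi * ∑ k ∈ s, ‖c k‖ ^ 2 := by
  have h : ∀ x : ℝ, ((‖∑ k ∈ s, c k * Complex.exp (Complex.I * (k * x : ℝ))‖ ^ 2 : ℝ) : ℂ) =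
      ∑ k ∈ s, ∑ l ∈ s, (c k * (starRingEnd ℂ) (c l)) * (Complex.exp (Complex.I * (k * x : ℝ)) *
      (starRingEnd ℂ) (Complex.exp (Complex.I * (l * x : ℝ)))) := by
    intro x
    rw [← Complex.normSq_eq_norm_sq, Complex.normSq_eq_conj_mul_self, mul_comm, map_sum,
      Finset.sum_mul_sum]
    refine Finset.sum_congr rfl fun k _ => Finset.sum_congr rfl fun l _ => ?_
    rw [map_mul]
    ring
  have hc : ∀ k l : ℕ, Continuous fun x : ℝ => (c k * (starRingEnd ℂ) (c l)) *
      (Complex.exp (Complex.I * (k * x : ℝ)) *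
      (starRingEnd ℂ) (Complex.exp (Complex.I * (l * x : ℝ)))) := by
    intro k l
    have : Continuous fun x : ℝ => (starRingEnd ℂ) (Complex.exp (Complex.I * (l * x : ℝ))) :=
      Complex.continuous_conj.comp (by fun_prop)
    fun_prop
  have hC : ((∫ x in (0 : ℝ)..(2 * Real.pi),
      ‖∑ k ∈ s, c k * Complex.exp (Complex.I * (k * x : ℝ))‖ ^ 2 : ℝ) : ℂ) =
      ((2 * Real.pi * ∑ k ∈ s, ‖c k‖ ^ 2 : ℝ) : ℂ) := by
    rw [← intervalIntegral.integral_ofReal]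
    simp_rw [h]
    rw [intervalIntegral.integral_finsetSum fun k _ =>
      (continuous_finsetSum _ fun l _ => hc k l).intervalIntegrable _ _]
    have h2 : ∀ k ∈ s, ∫ x in (0 : ℝ)..(2 * Real.pi), ∑ l ∈ s, (c k * (starRingEnd ℂ) (c l)) *
        (Complex.exp (Complex.I * (k * x : ℝ)) *
        (starRingEnd ℂ) (Complex.exp (Complex.I * (l * x : ℝ)))) =
        ((2 * Real.pi * ‖c k‖ ^ 2 : ℝ) : ℂ) := by
      intro k hk
      rw [intervalIntegral.integral_finsetSum fun l _ => (hc k l).intervalIntegrable _ _]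
      simp_rw [intervalIntegral.integral_const_mul, integral_exp_mul_conj]
      rw [Finset.sum_eq_single_of_mem k hk fun l _ hl => by rw [if_neg hl.symm, Complex.ofReal_zero, mul_zero],
        if_pos rfl, ← Complex.normSq_eq_norm_sq, Complex.ofReal_mul (2 * Real.pi) (Complex.normSq (c k)),
        Complex.normSq_eq_conj_mul_self]
      push_cast
      ring
    rw [Finset.sum_congr rfl h2, Finset.mul_sum]
    push_cast
    rfl
  exact_mod_cast hC

/-- Mean square of a trigonometric sum under the uniform distribution. -/
lemma integral_sq_trigSum_le (a b : ℕ → ℝ) (n : ℕ) (c : ℕ → ℂ) :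
    ∫ x, (trigSum a b n fun k => c k * Complex.exp (Complex.I * (k * x : ℝ))) ^ 2 ∂uniformMeasure
      ≤ ∑ k ∈ Finset.Icc 1 n, (a k ^ 2 + b k ^ 2) * ‖c k‖ ^ 2 := by
  have hn : ∀ k, ‖((a k : ℂ) - Complex.I * b k) * c k‖ ^ 2 = (a k ^ 2 + b k ^ 2) * ‖c k‖ ^ 2 := by
    intro k
    rw [norm_mul, mul_pow, ← Complex.normSq_eq_norm_sq, Complex.normSq_apply]
    congr 1
    simp
    ring
  have hP := integral_normSq_trig (Finset.Icc 1 n) fun k => ((a k : ℂ) - Complex.I * b k) * c k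
  simp_rw [hn] at hP
  rw [integral_uniformMeasure, smul_eq_mul, inv_mul_le_iff₀ (by positivity), ← hP]
  refine intervalIntegral.integral_mono_on two_pi_nonneg ?_ ?_ fun x _ => ?_
  · refine Continuous.intervalIntegrable ?_ _ _
    unfold trigSum
    refine (continuous_finsetSum _ fun k _ => ?_).pow 2
    refine (continuous_const.mul (Complex.continuous_re.comp ?_)).add
      (continuous_const.mul (Complex.continuous_im.comp ?_)) <;> fun_prop
  · exact Continuous.intervalIntegrable (by fun_prop) _ _
  · rw [trigSum_eq_re, ← sq_abs]
    refine pow_le_pow_left₀ (abs_nonneg _) ?_ 2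
    refine (Complex.abs_re_le_norm _).trans (le_of_eq ?_)
    congr 1
    refine Finset.sum_congr rfl fun k _ => ?_
    ring

/-! ### Weighted Dirichlet kernels -/

/-- The weighted Dirichlet kernel `∑_{k=1}^n m(k/n) e^{ikθ}`. -/
def trigKernel (m : ℝ → ℂ) (n : ℕ) (θ : ℝ) : ℂ :=
  ∑ k ∈ Finset.Icc 1 n, m (k / n) * Complex.exp (Complex.I * (k * θ : ℝ))

lemma continuous_trigKernel (m : ℝ → ℂ) (n : ℕ) : Continuous (trigKernel m n) := by
  unfold trigKernel
  fun_prop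

lemma periodic_trigKernel (m : ℝ → ℂ) (n : ℕ) : Function.Periodic (trigKernel m n) (2 * Real.pi) := by
  intro θ
  unfold trigKernel
  refine Finset.sum_congr rfl fun k _ => ?_
  congr 1
  rw [Complex.exp_eq_exp_iff_exists_int]
  exact ⟨k, by push_cast; ring⟩

/-- Bounded Lipschitz symbols. -/
structure IsBoundedLipschitz (m : ℝ → ℂ) (K : ℝ) : Prop where
  bound : ∀ v, ‖m v‖ ≤ K
  lipschitz : ∀ u v, ‖m u - m v‖ ≤ K * |u - v|

namespace IsBoundedLipschitz

variable {m : ℝ → ℂ} {K : ℝ}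

lemma nonneg (hm : IsBoundedLipschitz m K) : 0 ≤ K := (norm_nonneg _).trans (hm.bound 0)

lemma norm_trigKernel_le (hm : IsBoundedLipschitz m K) (n : ℕ) (θ : ℝ) :
    ‖trigKernel m n θ‖ ≤ K * n := by
  unfold trigKernel
  refine (norm_sum_le _ _).trans ?_
  have : ∀ k ∈ Finset.Icc 1 n, ‖m (k / n) * Complex.exp (Complex.I * (k * θ : ℝ))‖ ≤ K := by
    intro k _
    rw [norm_mul, Complex.norm_exp_I_mul_ofReal, mul_one]
    exact hm.bound _
  refine (Finset.sum_le_card_nsmul _ _ _ this).trans (le_of_eq ?_)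
  rw [Nat.card_Icc, nsmul_eq_mul]
  simp [mul_comm]

/-- Abel summation bound. -/
lemma norm_trigKernel_mul_le (hm : IsBoundedLipschitz m K) (n : ℕ) (θ : ℝ) :
    ‖trigKernel m n θ‖ * ‖Complex.exp (Complex.I * θ) - 1‖ ≤ 3 * K := by
  have hK := hm.nonneg
  rcases Nat.eq_zero_or_pos n with rfl | hn
  · simp only [trigKernel, Finset.Icc_eq_empty_of_lt zero_lt_one, Finset.sum_empty, norm_zero,
      zero_mul]
    positivity
  have hn' : (0 : ℝ) < n := by exact_mod_cast hn
  set z := Complex.exp (Complex.I * θ) with hz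
  have hz1 : ‖z‖ = 1 := Complex.norm_exp_I_mul_ofReal θ
  have hpow : ∀ k : ℕ, Complex.exp (Complex.I * (k * θ : ℝ)) = z ^ k := by
    intro k
    rw [hz, ← Complex.exp_nat_mul]
    congr 1
    push_cast
    ring
  have key : ∀ N : ℕ, ‖(z - 1) * ∑ k ∈ Finset.Icc 1 N, m (k / n) * z ^ k - m (N / n) * z ^ (N + 1)‖
      ≤ K + N * (K / n) := by
    intro N
    induction N with
    | zero =>
      simp only [Finset.Icc_eq_empty_of_lt zero_lt_one, Finset.sum_empty, mul_zero, zero_sub,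
        norm_neg, norm_mul, norm_pow, hz1, one_pow, mul_one, CharP.cast_eq_zero, zero_mul, add_zero]
      exact hm.bound _
    | succ N ih =>
      rw [Finset.sum_Icc_succ_top (by omega)]
      have e : (z - 1) * (∑ k ∈ Finset.Icc 1 N, m (k / n) * z ^ k + m ((N + 1 : ℕ) / n) * z ^ (N + 1))
          - m ((N + 1 : ℕ) / n) * z ^ (N + 1 + 1) =
          ((z - 1) * ∑ k ∈ Finset.Icc 1 N, m (k / n) * z ^ k - m (N / n) * z ^ (N + 1))
          + (m (N / n) - m ((N + 1 : ℕ) / n)) * z ^ (N + 1) := by ring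
      rw [e]
      refine (norm_add_le _ _).trans ?_
      have h2 : ‖(m (N / n) - m ((N + 1 : ℕ) / n)) * z ^ (N + 1)‖ ≤ K / n := by
        rw [norm_mul, norm_pow, hz1, one_pow, mul_one]
        refine (hm.lipschitz _ _).trans (le_of_eq ?_)
        have : (N / n - (N + 1 : ℕ) / n : ℝ) = -(1 / n) := by push_cast; ring
        rw [this, abs_neg, abs_of_pos (by positivity)]
        ring
      have h3 : K + ((N + 1 : ℕ) : ℝ) * (K / n) = K + N * (K / n) + K / n := by push_cast; ring
      rw [h3]
      exact add_le_add ih h2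
  have h := key n
  have h2 : ‖m (n / n) * z ^ (n + 1)‖ ≤ K := by
    rw [norm_mul, norm_pow, hz1, one_pow, mul_one]
    exact hm.bound _
  have h3 : (n : ℝ) * (K / n) = K := by field_simp
  have h4 : trigKernel m n θ = ∑ k ∈ Finset.Icc 1 n, m (k / n) * z ^ k := by
    unfold trigKernel
    exact Finset.sum_congr rfl fun k _ => by rw [hpow]
  rw [h4, ← norm_mul, mul_comm]
  have h5 := norm_add_le ((z - 1) * ∑ k ∈ Finset.Icc 1 n, m (k / n) * z ^ k - m (n / n) * z ^ (n + 1))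
    (m (n / n) * z ^ (n + 1))
  rw [sub_add_cancel] at h5
  linarith

end IsBoundedLipschitz

lemma abs_mul_two_div_pi_le {θ : ℝ} (h : |θ| ≤ Real.pi) :
    2 / Real.pi * |θ| ≤ ‖Complex.exp (Complex.I * θ) - 1‖ := by
  rw [Complex.norm_exp_I_mul_ofReal_sub_one, norm_mul, Real.norm_eq_abs, Real.norm_eq_abs,
    abs_of_pos (by norm_num : (0 : ℝ) < 2)]
  have h2 : |θ / 2| ≤ Real.pi / 2 := by
    rw [abs_div, abs_of_pos (by norm_num : (0 : ℝ) < 2)]; linarith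
  have := Real.mul_abs_le_abs_sin h2
  rw [abs_div, abs_of_pos (by norm_num : (0 : ℝ) < 2)] at this
  linarith

lemma exists_mul_abs_le_norm_exp_sub_one {x : ℝ} (hx : |x| < Real.pi) :
    ∃ c > 0, ∀ u ∈ Set.Icc (-Real.pi) Real.pi,
      c * |x - u| ≤ ‖Complex.exp (Complex.I * ((x - u : ℝ) : ℂ)) - 1‖ := by
  set y₀ : ℝ := (Real.pi + |x|) / 2 with hy₀
  have hpos : 0 < y₀ := by have := Real.pi_pos; positivity
  have hlt : y₀ < Real.pi := by rw [hy₀]; linarith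
  have hs : 0 < Real.sin y₀ := Real.sin_pos_of_pos_of_lt_pi hpos hlt
  refine ⟨Real.sin y₀ / y₀, by positivity, fun u hu => ?_⟩
  rw [Complex.norm_exp_I_mul_ofReal_sub_one, norm_mul, Real.norm_eq_abs, Real.norm_eq_abs,
    abs_of_pos (by norm_num : (0 : ℝ) < 2)]
  set y : ℝ := |x - u| / 2 with hy
  have hy0 : 0 ≤ y := by positivity
  have hyle : y ≤ y₀ := by
    have h1 : |x - u| ≤ |x| + |u| := abs_sub x u
    have h2 : |u| ≤ Real.pi := abs_le.2 hu
    rw [hy, hy₀]; linarith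
  have hsin : |Real.sin ((x - u) / 2)| = Real.sin y := by
    have h0 : 0 ≤ Real.sin y := Real.sin_nonneg_of_nonneg_of_le_pi hy0 (hyle.trans hlt.le)
    rcases abs_cases (x - u) with h | h
    · rw [hy, h.1]; rw [hy, h.1] at h0; exact abs_of_nonneg h0
    · have : (x - u) / 2 = -y := by rw [hy, h.1]; ring
      rw [this, Real.sin_neg, abs_neg, abs_of_nonneg h0]
  have hconc := strictConcaveOn_sin_Icc.concaveOn.2
    (⟨le_rfl, Real.pi_pos.le⟩ : (0 : ℝ) ∈ Set.Icc 0 Real.pi)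
    (⟨hpos.le, hlt.le⟩ : y₀ ∈ Set.Icc 0 Real.pi)
    (sub_nonneg.2 ((div_le_one hpos).2 hyle)) (by positivity : 0 ≤ y / y₀) (by ring)
  simp only [Real.sin_zero, smul_eq_mul, mul_zero, zero_add, div_mul_cancel₀ _ hpos.ne'] at hconc
  rw [hsin]
  have : Real.sin y₀ / y₀ * |x - u| = 2 * (y / y₀ * Real.sin y₀) := by rw [hy]; ring
  rw [this]
  linarith

/-- The `L¹` norm of the weighted Dirichlet kernel is `O(n^{1/4})`. -/
lemma exists_integral_norm_trigKernel_le {m : ℝ → ℂ} {K : ℝ} (hm : IsBoundedLipschitz m K) :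
    ∃ C, 0 ≤ C ∧ ∀ (n : ℕ) (u : ℝ),
      ∫ x, ‖trigKernel m n (x - u)‖ ∂uniformMeasure ≤ C * (n : ℝ) ^ (1 / 4 : ℝ) := by
  have hK := hm.nonneg
  have hpi := Real.pi_pos
  have hint : IntervalIntegrable (fun θ : ℝ => |θ| ^ (-(3 / 4) : ℝ)) volume (-Real.pi) Real.pi := by
    have h0 : IntervalIntegrable (fun θ : ℝ => |θ| ^ (-(3 / 4) : ℝ)) volume 0 Real.pi := by
      refine (intervalIntegral.intervalIntegrable_rpow' (by norm_num : (-1 : ℝ) < -(3 / 4))).congr ?_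
      intro θ hθ
      rw [Set.uIoc_of_le hpi.le] at hθ
      simp only [abs_of_pos hθ.1]
    have h1 : IntervalIntegrable (fun θ : ℝ => |θ| ^ (-(3 / 4) : ℝ)) volume (-Real.pi) 0 := by
      have := h0.comp_sub_left 0
      simpa using this.symm
    exact h1.trans h0
  set J := ∫ θ in (-Real.pi)..Real.pi, |θ| ^ (-(3 / 4) : ℝ) with hJ
  have hJ0 : 0 ≤ J := intervalIntegral.integral_nonneg (by linarith) fun _ _ => by positivity
  refine ⟨(2 * Real.pi)⁻¹ * (K ^ (1 / 4 : ℝ) * (3 * K * (Real.pi / 2)) ^ (3 / 4 : ℝ) * J),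
    by positivity, fun n u => ?_⟩
  have hpt : ∀ θ ∈ Set.Icc (-Real.pi) Real.pi, θ ≠ 0 → ‖trigKernel m n θ‖ ≤
      (K ^ (1 / 4 : ℝ) * (n : ℝ) ^ (1 / 4 : ℝ) * (3 * K * (Real.pi / 2)) ^ (3 / 4 : ℝ))
        * |θ| ^ (-(3 / 4) : ℝ) := by
    intro θ hθ hθ0
    have hθ' : 0 < |θ| := abs_pos.2 hθ0
    have h1 := hm.norm_trigKernel_le n θ
    have h2 : ‖trigKernel m n θ‖ ≤ 3 * K * (Real.pi / 2) * |θ|⁻¹ := by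
      have h3 := hm.norm_trigKernel_mul_le n θ
      have h4 := abs_mul_two_div_pi_le (abs_le.2 hθ)
      have h5 : ‖trigKernel m n θ‖ * (2 / Real.pi * |θ|) ≤ 3 * K :=
        (mul_le_mul_of_nonneg_left h4 (norm_nonneg _)).trans h3
      have h6 : ‖trigKernel m n θ‖ =
          ‖trigKernel m n θ‖ * (2 / Real.pi * |θ|) * (Real.pi / 2) * |θ|⁻¹ := by
        field_simp
      rw [h6]
      gcongr
    have e : ‖trigKernel m n θ‖ = ‖trigKernel m n θ‖ ^ (1 / 4 : ℝ) * ‖trigKernel m n θ‖ ^ (3 / 4 : ℝ) := by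
      rw [← Real.rpow_add_of_nonneg (norm_nonneg _) (by norm_num) (by norm_num)]
      norm_num
    rw [e]
    calc _ ≤ (K * n) ^ (1 / 4 : ℝ) * (3 * K * (Real.pi / 2) * |θ|⁻¹) ^ (3 / 4 : ℝ) := by gcongr
      _ = _ := by
        rw [Real.mul_rpow hK (by positivity), Real.mul_rpow (by positivity) (by positivity),
          Real.inv_rpow hθ'.le, Real.rpow_neg hθ'.le]
        ring
  have hper : ∫ x in (0 : ℝ)..(2 * Real.pi), ‖trigKernel m n (x - u)‖ =
      ∫ θ in (-Real.pi)..Real.pi, ‖trigKernel m n θ‖ := by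
    rw [intervalIntegral.integral_comp_sub_right (fun θ => ‖trigKernel m n θ‖) u]
    have hp : Function.Periodic (fun θ => ‖trigKernel m n θ‖) (2 * Real.pi) := fun θ => by
      simp only [periodic_trigKernel m n θ]
    have := hp.intervalIntegral_add_eq (0 - u) (-Real.pi)
    convert! this using 2 <;> ring
  rw [integral_uniformMeasure, hper, smul_eq_mul]
  have hbound : ∫ θ in (-Real.pi)..Real.pi, ‖trigKernel m n θ‖ ≤
      ∫ θ in (-Real.pi)..Real.pi,
        (K ^ (1 / 4 : ℝ) * (n : ℝ) ^ (1 / 4 : ℝ) * (3 * K * (Real.pi / 2)) ^ (3 / 4 : ℝ))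
        * |θ| ^ (-(3 / 4) : ℝ) := by
    refine intervalIntegral.integral_mono_ae_restrict (by linarith)
      ((continuous_trigKernel m n).norm.intervalIntegrable _ _) (hint.const_mul _) ?_
    have hne : ∀ᵐ θ : ℝ, θ ≠ 0 := Measure.ae_ne volume 0
    filter_upwards [ae_restrict_mem measurableSet_Icc, ae_restrict_of_ae hne] with θ h1 h2
    exact hpt θ h1 h2
  rw [intervalIntegral.integral_const_mul] at hbound
  calc _ ≤ (2 * Real.pi)⁻¹ * (K ^ (1 / 4 : ℝ) * (n : ℝ) ^ (1 / 4 : ℝ) *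
      (3 * K * (Real.pi / 2)) ^ (3 / 4 : ℝ) * J) := by gcongr
    _ = _ := by ring

/-! ### A Fejér–Lebesgue theorem for weighted kernels -/

lemma IsBoundedLipschitz.tendsto_integral_of_tendsto_ball {m : ℝ → ℂ} {K : ℝ}
    (hm : IsBoundedLipschitz m K) (ν : Measure ℝ) [IsFiniteMeasure ν]
    (hν : ν (Set.Icc (-Real.pi) Real.pi)ᶜ = 0) {x : ℝ} (hx : |x| < Real.pi)
    (hball : Tendsto (fun r => ν (Metric.closedBall x r) / volume (Metric.closedBall x r))
      (𝓝[>] 0) (𝓝 0)) :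
    Tendsto (fun n : ℕ => ∫ u, ‖trigKernel m n (x - u)‖ ^ 2 / n ∂ν) atTop (𝓝 0) := by
  have hK := hm.nonneg
  obtain ⟨c, hc0, hc⟩ := exists_mul_abs_le_norm_exp_sub_one hx
  set A : ℝ := K ^ 2 + 9 * K ^ 2 / c ^ 2 with hA
  have hA0 : 0 ≤ A := by positivity
  set φ : ℝ → ℝ := fun r => ν.real (Metric.closedBall x r) / r with hφ
  have hφ0 : ∀ r, 0 < r → 0 ≤ φ r := fun r hr => by positivity
  have hφt : Tendsto φ (𝓝[>] 0) (𝓝 0) := by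
    have h1 := (ENNReal.tendsto_toReal ENNReal.zero_ne_top).comp hball
    have h2 := h1.const_mul 2
    simp only [ENNReal.toReal_zero, mul_zero] at h2
    refine h2.congr' ?_
    filter_upwards [self_mem_nhdsWithin] with r hr
    have hr' : (0 : ℝ) < r := hr
    simp only [Function.comp_apply, ENNReal.toReal_div, Real.volume_closedBall, hφ]
    rw [ENNReal.toReal_ofReal (by positivity), Measure.real]
    field_simp
  obtain ⟨M, hM0, hM⟩ : ∃ M, 0 ≤ M ∧ ∀ r, 0 < r → φ r ≤ M := by
    obtain ⟨δ, hδ0, hδ⟩ := (mem_nhdsGT_iff_exists_Ioo_subset).1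
      (hφt.eventually (gt_mem_nhds one_pos : ∀ᶠ y in 𝓝 (0 : ℝ), y < 1))
    have hδ0' : (0 : ℝ) < δ := hδ0
    refine ⟨1 + ν.real Set.univ / δ, by positivity, fun r hr => ?_⟩
    rcases lt_or_ge r δ with h | h
    · have : φ r < 1 := hδ ⟨hr, h⟩
      have : 0 ≤ ν.real Set.univ / δ := by positivity
      linarith
    · have : φ r ≤ ν.real Set.univ / δ := by
        simp only [hφ]
        gcongr
        · exact measure_ne_top ν _
        · exact Set.subset_univ _
      linarith
  have hkernel : ∀ n : ℕ, 0 < n → ∀ u ∈ Set.Icc (-Real.pi) Real.pi, ∃ j : ℕ,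
      |x - u| ≤ 2 ^ j / n ∧ ‖trigKernel m n (x - u)‖ ^ 2 / n ≤ 4 * A * n * (1 / 4) ^ j := by
    intro n hn u hu
    have hn' : (0 : ℝ) < n := by exact_mod_cast hn
    have hex : ∃ j : ℕ, |x - u| ≤ 2 ^ j / n := by
      obtain ⟨j, hj⟩ := pow_unbounded_of_one_lt (|x - u| * n) (one_lt_two : (1 : ℝ) < 2)
      exact ⟨j, (le_div_iff₀ hn').2 hj.le⟩
    classical
    refine ⟨Nat.find hex, Nat.find_spec hex, ?_⟩
    have h1 := hm.norm_trigKernel_le n (x - u)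
    rcases Nat.eq_zero_or_pos (Nat.find hex) with h0 | h0
    · rw [h0, pow_zero, mul_one, div_le_iff₀ hn']
      calc ‖trigKernel m n (x - u)‖ ^ 2 ≤ (K * n) ^ 2 := by gcongr
        _ = K ^ 2 * n * n := by ring
        _ ≤ 4 * A * n * n := by
          gcongr
          have : 0 ≤ 9 * K ^ 2 / c ^ 2 := by positivity
          nlinarith [sq_nonneg K]
    · obtain ⟨i, hi⟩ : ∃ i, Nat.find hex = i + 1 := ⟨Nat.find hex - 1, by omega⟩
      have h2 : 2 ^ i / n < |x - u| := not_le.1 (Nat.find_min hex (by omega : i < Nat.find hex))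
      rw [hi]
      have hpos : (0 : ℝ) < 2 ^ i / n := by positivity
      have h3 := hm.norm_trigKernel_mul_le n (x - u)
      have h4 : ‖trigKernel m n (x - u)‖ * (c * (2 ^ i / n)) ≤ 3 * K := by
        refine le_trans ?_ h3
        gcongr
        exact (by gcongr : c * (2 ^ i / n) ≤ c * |x - u|).trans (hc u hu)
      have h5 : ‖trigKernel m n (x - u)‖ ≤ 3 * K / c * (n / 2 ^ i) := by
        have e : ‖trigKernel m n (x - u)‖ =
          (‖trigKernel m n (x - u)‖ * (c * (2 ^ i / n))) / c * (n / 2 ^ i) := by field_simp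
        rw [e]
        gcongr
      rw [div_le_iff₀ hn']
      calc ‖trigKernel m n (x - u)‖ ^ 2 ≤ (3 * K / c * (n / 2 ^ i)) ^ 2 := by gcongr
        _ = 4 * (9 * K ^ 2 / c ^ 2) * n * (1 / 4) ^ (i + 1) * n := by
          have : ((1 : ℝ) / 4) ^ (i + 1) = 1 / (4 * (2 ^ i) ^ 2) := by
            rw [← pow_mul, mul_comm i 2, pow_mul, pow_succ, one_div_pow]; norm_num
          rw [this]; field_simp; ring
        _ ≤ 4 * A * n * (1 / 4) ^ (i + 1) * n := by
          gcongr
          rw [hA]; nlinarith [sq_nonneg K]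
  set T : ℕ → ℕ → ℝ := fun n j => 4 * A * (1 / 2) ^ j * φ (2 ^ j / n) with hT
  have hTendsto : Tendsto (fun n => ∑' j, T n j) atTop (𝓝 (∑' _ : ℕ, (0 : ℝ))) := by
    refine tendsto_tsum_of_dominated_convergence (bound := fun j => 4 * A * (1 / 2) ^ j * M)
      ((summable_geometric_two.mul_left (4 * A)).mul_right M) (fun j => ?_) ?_
    · have h1 : Tendsto (fun n : ℕ => (2 : ℝ) ^ j / n) atTop (𝓝[>] 0) := by
        refine tendsto_nhdsWithin_iff.2 ⟨tendsto_const_div_atTop_nhds_zero_nat _, ?_⟩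
        filter_upwards [eventually_gt_atTop 0] with n hn
        have : (0 : ℝ) < n := by exact_mod_cast hn
        exact Set.mem_Ioi.2 (by positivity)
      have h2 := (hφt.comp h1).const_mul (4 * A * (1 / 2) ^ j)
      rw [mul_zero] at h2
      exact h2
    · filter_upwards [eventually_gt_atTop 0] with n hn j
      have hn' : (0 : ℝ) < n := by exact_mod_cast hn
      have hr : (0 : ℝ) < 2 ^ j / n := by positivity
      rw [Real.norm_of_nonneg (mul_nonneg (by positivity) (hφ0 _ hr))]
      exact mul_le_mul_of_nonneg_left (hM _ hr) (by positivity)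
  rw [tsum_zero] at hTendsto
  refine squeeze_zero' (Eventually.of_forall fun n => integral_nonneg fun u => by positivity) ?_
    hTendsto
  filter_upwards [eventually_gt_atTop 0] with n hn
  have hn' : (0 : ℝ) < n := by exact_mod_cast hn
  have hT0 : ∀ j, 0 ≤ T n j := fun j => mul_nonneg (by positivity) (hφ0 _ (by positivity))
  have hTs : Summable (T n) := by
    refine Summable.of_nonneg_of_le hT0 (fun j => ?_)
      ((summable_geometric_two.mul_left (4 * A)).mul_right M)
    exact mul_le_mul_of_nonneg_left (hM _ (by positivity)) (by positivity)
  have hcont : Continuous fun u => ‖trigKernel m n (x - u)‖ ^ 2 / n := by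
    have := (continuous_trigKernel m n).comp (continuous_const.sub continuous_id : Continuous fun u => x - u)
    exact (this.norm.pow 2).div_const _
  rw [integral_eq_lintegral_of_nonneg_ae (Eventually.of_forall fun u => by positivity)
    hcont.aestronglyMeasurable]
  refine ENNReal.toReal_le_of_le_ofReal (tsum_nonneg hT0) ?_
  calc ∫⁻ u, ENNReal.ofReal (‖trigKernel m n (x - u)‖ ^ 2 / n) ∂ν
      ≤ ∫⁻ u, ∑' j : ℕ, (Metric.closedBall x (2 ^ j / n)).indicator
          (fun _ => ENNReal.ofReal (4 * A * n * (1 / 4) ^ j)) u ∂ν := by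
        refine lintegral_mono_ae ?_
        have : ∀ᵐ u ∂ν, u ∈ Set.Icc (-Real.pi) Real.pi := hν
        filter_upwards [this] with u hu
        obtain ⟨j, hj1, hj2⟩ := hkernel n hn u hu
        refine le_trans ?_ (ENNReal.le_tsum j)
        rw [Set.indicator_of_mem (by rw [Metric.mem_closedBall, Real.dist_eq, abs_sub_comm]; exact hj1)]
        exact ENNReal.ofReal_le_ofReal hj2
    _ = ∑' j : ℕ, ENNReal.ofReal (4 * A * n * (1 / 4) ^ j) * ν (Metric.closedBall x (2 ^ j / n)) := by
        rw [lintegral_tsum fun j =>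
          (measurable_const.indicator Metric.isClosed_closedBall.measurableSet).aemeasurable]
        refine tsum_congr fun j => ?_
        rw [lintegral_indicator Metric.isClosed_closedBall.measurableSet, setLIntegral_const]
    _ = ∑' j : ℕ, ENNReal.ofReal (T n j) := by
        refine tsum_congr fun j => ?_
        rw [← ofReal_measureReal, ← ENNReal.ofReal_mul (by positivity)]
        congr 1
        simp only [hT, hφ]
        have : ((1 : ℝ) / 4) ^ j = (1 / 2) ^ j * (1 / 2) ^ j := by rw [← mul_pow]; norm_num
        rw [this, one_div_pow]
        field_simp
    _ = ENNReal.ofReal (∑' j, T n j) := (ENNReal.ofReal_tsum_of_nonneg hT0 hTs).symm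

lemma integral_trigKernel_sq (m : ℝ → ℂ) (n : ℕ) (x : ℝ) :
    ∫ u in (-Real.pi)..Real.pi, ‖trigKernel m n (x - u)‖ ^ 2 / n =
      2 * Real.pi * ((∑ k ∈ Finset.Icc 1 n, ‖m (k / n)‖ ^ 2) / n) := by
  rw [intervalIntegral.integral_div,
    intervalIntegral.integral_comp_sub_left (fun θ => ‖trigKernel m n θ‖ ^ 2) x]
  have hp : Function.Periodic (fun θ => ‖trigKernel m n θ‖ ^ 2) (2 * Real.pi) := fun θ => by
    simp only [periodic_trigKernel m n θ]
  have h1 := hp.intervalIntegral_add_eq (x - Real.pi) 0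
  have h2 : x - -Real.pi = x - Real.pi + 2 * Real.pi := by ring
  rw [h2, h1, zero_add, ← mul_div_assoc]
  congr 1
  exact integral_normSq_trig (Finset.Icc 1 n) fun k => m (k / n)

/-- **Fejér–Lebesgue theorem**: convergence of the weighted Fejér means of a measure towards the
density of its absolutely continuous part. -/
theorem IsBoundedLipschitz.ae_tendsto_integral {m : ℝ → ℂ} {K : ℝ} (hm : IsBoundedLipschitz m K)
    {σ : ℝ} (hσ : Tendsto (fun n : ℕ => (∑ k ∈ Finset.Icc 1 n, ‖m (k / n)‖ ^ 2) / n) atTop (𝓝 σ))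
    (μ : Measure ℝ) [IsFiniteMeasure μ] (hμ : μ (Set.Icc (-Real.pi) Real.pi)ᶜ = 0) :
    ∀ᵐ x : ℝ, |x| < Real.pi →
      Tendsto (fun n : ℕ => ∫ u, ‖trigKernel m n (x - u)‖ ^ 2 / n ∂μ) atTop
        (𝓝 (2 * Real.pi * σ * (μ.rnDeriv volume x).toReal)) := by
  set I := Set.Icc (-Real.pi) Real.pi with hI
  set f : ℝ → ℝ := fun x => (μ.rnDeriv volume x).toReal with hf
  have hfint : Integrable f volume := Measure.integrable_toReal_rnDeriv
  have hfmeas : Measurable f := (Measure.measurable_rnDeriv _ _).ennreal_toReal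
  set μs := μ.singularPart volume with hμs
  have hμsI : μs Iᶜ = 0 := le_antisymm ((Measure.singularPart_le μ volume Iᶜ).trans hμ.le) zero_le
  have hwdI : (volume.withDensity (μ.rnDeriv volume)) Iᶜ = 0 :=
    le_antisymm ((Measure.withDensity_rnDeriv_le μ volume Iᶜ).trans hμ.le) zero_le
  have hdec : μ = μs + volume.withDensity (μ.rnDeriv volume) :=
    Measure.haveLebesgueDecomposition_add μ volume
  have hae1 : ∀ᵐ x : ℝ, Tendsto (fun r => μs (Metric.closedBall x r) /
      volume (Metric.closedBall x r)) (𝓝[>] 0) (𝓝 0) := by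
    filter_upwards [Besicovitch.ae_tendsto_rnDeriv μs volume,
      (Measure.mutuallySingular_singularPart μ volume).rnDeriv_ae_eq_zero] with x h1 h2
    rw [h2] at h1
    exact h1
  have hae2 := (Besicovitch.vitaliFamily (volume : Measure ℝ)).ae_tendsto_lintegral_enorm_sub_div
    hfint.locallyIntegrable
  filter_upwards [hae1, hae2] with x hx1 hx2 hx
  have hx2' := hx2.comp (Besicovitch.tendsto_filterAt volume x)
  set ν := (volume.restrict I).withDensity (fun u => ‖f u - f x‖ₑ) with hν
  have hmeas : Measurable fun u => ‖f u - f x‖ₑ := (hfmeas.sub_const _).enorm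
  have hIfin : Integrable (fun u => f u - f x) (volume.restrict I) :=
    hfint.restrict.sub (integrable_const _)
  have : IsFiniteMeasure ν := isFiniteMeasure_withDensity hIfin.2.ne
  have hνI : ν Iᶜ = 0 :=
    withDensity_absolutelyContinuous _ _ (by simp [Measure.restrict_apply measurableSet_Icc.compl, hI])
  have hνball : Tendsto (fun r => ν (Metric.closedBall x r) / volume (Metric.closedBall x r))
      (𝓝[>] 0) (𝓝 0) := by
    refine tendsto_of_tendsto_of_tendsto_of_le_of_le tendsto_const_nhds hx2' (fun _ => zero_le)
      fun r => ?_
    simp only [Function.comp_apply]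
    gcongr
    rw [hν, withDensity_apply _ Metric.isClosed_closedBall.measurableSet]
    refine lintegral_mono' (Measure.restrict_mono' ?_ Measure.restrict_le_self) le_rfl
    exact (Filter.EventuallyLE.refl _ _)
  have L1 := hm.tendsto_integral_of_tendsto_ball μs hμsI hx hx1
  have L2 := hm.tendsto_integral_of_tendsto_ball ν hνI hx hνball
  have L3 : Tendsto (fun n : ℕ => f x * ∫ u in (-Real.pi)..Real.pi, ‖trigKernel m n (x - u)‖ ^ 2 / n)
      atTop (𝓝 (2 * Real.pi * σ * f x)) := by
    simp_rw [integral_trigKernel_sq]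
    have := (hσ.const_mul (2 * Real.pi)).const_mul (f x)
    convert! this using 2
    ring
  set k : ℕ → ℝ → ℝ := fun n u => ‖trigKernel m n (x - u)‖ ^ 2 / n with hk
  have hkc : ∀ n, Continuous (k n) := fun n => by
    have := (continuous_trigKernel m n).comp (continuous_const.sub continuous_id : Continuous fun u => x - u)
    exact (this.norm.pow 2).div_const _
  have hkb : ∀ n u, ‖k n u‖ ≤ (K * n) ^ 2 / n := fun n u => by
    rw [Real.norm_of_nonneg (by positivity)]
    have := hm.norm_trigKernel_le n (x - u)
    simp only [hk]
    gcongr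
  have hki : ∀ (n) (ρ : Measure ℝ) [IsFiniteMeasure ρ], Integrable (k n) ρ := fun n ρ _ =>
    Integrable.of_bound (hkc n).aestronglyMeasurable _ (Eventually.of_forall (hkb n))
  have hdiff : ∀ n, ∫ u, k n u ∂μ = ∫ u, k n u ∂μs +
      (∫ u in I, k n u * (f u - f x)) + f x * ∫ u in (-Real.pi)..Real.pi, k n u := by
    intro n
    have e1 : ∫ u, k n u ∂μ = ∫ u, k n u ∂μs + ∫ u, k n u ∂(volume.withDensity (μ.rnDeriv volume)) := by
      conv_lhs => rw [hdec]
      exact integral_add_measure (hki n _) (hki n _)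
    have e2 : ∫ u, k n u ∂(volume.withDensity (μ.rnDeriv volume)) = ∫ u in I, f u * k n u := by
      have h1 : volume.withDensity (μ.rnDeriv volume) =
          (volume.withDensity (μ.rnDeriv volume)).restrict I :=
        (Measure.restrict_eq_self_of_ae_mem hwdI).symm
      rw [h1, restrict_withDensity measurableSet_Icc,
        integral_withDensity_eq_integral_toReal_smul (Measure.measurable_rnDeriv _ _)
          (ae_restrict_of_ae (Measure.rnDeriv_lt_top μ volume))]
      rfl
    have e3 : ∫ u in (-Real.pi)..Real.pi, k n u = ∫ u in I, k n u := by
      rw [intervalIntegral.integral_of_le (by linarith [Real.pi_pos]), integral_Icc_eq_integral_Ioc]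
    rw [e1, e2, e3, ← integral_const_mul, add_assoc, ← integral_add]
    · congr 1
      refine integral_congr_ae (Eventually.of_forall fun u => ?_)
      simp only
      ring
    · exact hIfin.bdd_mul (c := (K * n) ^ 2 / n) (hkc n).aestronglyMeasurable
        (Eventually.of_forall (hkb n))
    · exact (hki n _).const_mul _
  have hmid : Tendsto (fun n => ∫ u in I, k n u * (f u - f x)) atTop (𝓝 0) := by
    refine squeeze_zero_norm (fun n => ?_) L2
    refine (norm_integral_le_integral_norm _).trans (le_of_eq ?_)
    rw [hν, integral_withDensity_eq_integral_toReal_smul hmeas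
      (Eventually.of_forall fun _ => enorm_lt_top)]
    refine integral_congr_ae (Eventually.of_forall fun u => ?_)
    simp only [norm_mul, toReal_enorm, smul_eq_mul]
    rw [Real.norm_of_nonneg (by positivity : 0 ≤ k n u)]
    ring
  have := (L1.add hmid).add L3
  simp only [zero_add] at this
  exact this.congr fun n => (hdiff n).symm

/-! ### Gaussian computations -/

section GaussianProcess

variable {Ω T : Type*} [MeasurableSpace Ω] {P : Measure Ω}

lemma ProbabilityTheory.IsGaussianProcess.integrable_mul {Y : T → Ω → ℝ} (hY : IsGaussianProcess Y P)
    (s t : T) : Integrable (fun ω => Y s ω * Y t ω) P :=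
  MemLp.integrable_mul (hY.hasGaussianLaw_eval s).memLp_two (hY.hasGaussianLaw_eval t).memLp_two

lemma ProbabilityTheory.IsGaussianProcess.hasGaussianLaw_linearCombination {Y : T → Ω → ℝ}
    (hY : IsGaussianProcess Y P) (I : Finset T) (w : T → ℝ) :
    HasGaussianLaw (fun ω => ∑ t ∈ I, w t * Y t ω) P := by
  have := (hY.smul w).hasGaussianLaw_fun_sum (I := I)
  simpa only [smul_eq_mul] using this

/-- The characteristic function of a centered Gaussian process. -/
lemma ProbabilityTheory.IsGaussianProcess.integral_exp_linearCombination {Y : T → Ω → ℝ}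
    (hY : IsGaussianProcess Y P) (h0 : ∀ t, ∫ ω, Y t ω ∂P = 0) (I : Finset T) (w : T → ℝ) :
    ∫ ω, Complex.exp ((∑ t ∈ I, w t * Y t ω : ℝ) * Complex.I) ∂P =
      Complex.exp (-(∑ s ∈ I, ∑ t ∈ I, w s * w t * ∫ ω, Y s ω * Y t ω ∂P : ℝ) / 2) := by
  have hZ := hY.hasGaussianLaw_linearCombination I w
  have hmean : ∫ ω, ∑ t ∈ I, w t * Y t ω ∂P = 0 := by
    rw [integral_finsetSum _ fun t _ => (hY.hasGaussianLaw_eval t).integrable.const_mul _]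
    exact Finset.sum_eq_zero fun t _ => by rw [integral_const_mul, h0, mul_zero]
  have hvar : Var[fun ω => ∑ t ∈ I, w t * Y t ω; P] =
      ∑ s ∈ I, ∑ t ∈ I, w s * w t * ∫ ω, Y s ω * Y t ω ∂P := by
    rw [variance_of_integral_eq_zero hZ.aemeasurable hmean]
    have : ∀ ω, (∑ t ∈ I, w t * Y t ω) ^ 2 = ∑ s ∈ I, ∑ t ∈ I, w s * w t * (Y s ω * Y t ω) := by
      intro ω
      rw [sq, Finset.sum_mul_sum]
      exact Finset.sum_congr rfl fun s _ => Finset.sum_congr rfl fun t _ => by ring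
    simp_rw [this]
    rw [integral_finsetSum _ fun s _ => integrable_finsetSum _ fun t _ =>
      (hY.integrable_mul s t).const_mul _]
    refine Finset.sum_congr rfl fun s _ => ?_
    rw [integral_finsetSum _ fun t _ => (hY.integrable_mul s t).const_mul _]
    exact Finset.sum_congr rfl fun t _ => integral_const_mul _ _
  have h := hZ.charFun_map_eq 1
  rw [charFun_apply_real, integral_map hZ.aemeasurable (by fun_prop)] at h
  simp only [Complex.ofReal_one, one_mul, RCLike.inner_apply, conj_trivial, mul_one] at h
  rw [hmean, hvar] at h
  rw [h]
  congr 1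
  push_cast
  ring

end GaussianProcess

section Stationary

variable {Ω : Type*} [MeasurableSpace Ω] {P : Measure Ω} {a : ℕ → Ω → ℝ} {ρ : ℕ → ℝ}

namespace IsStationaryGaussianSeq

lemma integral_exp (ha : IsStationaryGaussianSeq a ρ P) (I : Finset ℕ) (w : ℕ → ℝ) :
    ∫ ω, Complex.exp ((∑ k ∈ I, w k * a (k + 1) ω : ℝ) * Complex.I) ∂P =
      Complex.exp (-(∑ k ∈ I, ∑ l ∈ I, w k * w l * ρ ((k : ℤ) - l).natAbs : ℝ) / 2) := by
  rw [ha.gaussian.integral_exp_linearCombination (fun k => ha.centered (k + 1) (by omega)) I w]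
  have : ∀ k l : ℕ, ∫ ω, a (k + 1) ω * a (l + 1) ω ∂P = ρ ((k : ℤ) - l).natAbs := fun k l => by
    rw [ha.cov _ _ (by omega) (by omega)]
    congr 2
    push_cast
    ring
  simp_rw [this]

lemma shift (ha : IsStationaryGaussianSeq a ρ P) :
    IsStationaryGaussianSeq (fun k => a (k + 1)) ρ P where
  gaussian := ha.gaussian.comp_right (fun k => k + 1)
  centered k _ := ha.centered (k + 1) (by omega)
  cov k l _ _ := by
    rw [ha.cov _ _ (by omega) (by omega)]
    congr 2
    push_cast
    ring
  unit_variance := ha.unit_variance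

lemma isProbabilityMeasure (ha : IsStationaryGaussianSeq a ρ P) : IsProbabilityMeasure P :=
  ha.gaussian.isProbabilityMeasure

/-- The law of a stationary Gaussian sequence is invariant under the shift. -/
lemma map_shift_eq (ha : IsStationaryGaussianSeq a ρ P) (hm : ∀ k, Measurable (a k)) :
    P.map (fun ω (k : ℕ) => a (k + 2) ω) = P.map (fun ω (k : ℕ) => a (k + 1) ω) := by
  have := ha.isProbabilityMeasure
  have hX : Measurable fun ω (k : ℕ) => a (k + 1) ω := measurable_pi_lambda _ fun k => hm _
  have hY : Measurable fun ω (k : ℕ) => a (k + 2) ω := measurable_pi_lambda _ fun k => hm _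
  refine (map_eq_iff_forall_finset_map_restrict_eq (X := fun k => a (k + 2))
    (Y := fun k => a (k + 1)) hY.aemeasurable hX.aemeasurable).2 fun I => ?_
  have hXI : Measurable fun ω => I.restrict fun k => a (k + 1) ω :=
    measurable_pi_lambda _ fun k => hm _
  have hYI : Measurable fun ω => I.restrict fun k => a (k + 2) ω :=
    measurable_pi_lambda _ fun k => hm _
  have := Measure.isProbabilityMeasure_map (μ := P) hXI.aemeasurable
  have := Measure.isProbabilityMeasure_map (μ := P) hYI.aemeasurable
  refine Measure.ext_of_charFunDual ?_
  ext L
  classical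
  set w : ℕ → ℝ := fun k => if h : k ∈ I then L (Pi.single ⟨k, h⟩ 1) else 0 with hw
  have hL : ∀ y : ℕ → ℝ, L (I.restrict y) = ∑ k ∈ I, w k * y k := by
    intro y
    have h1 : I.restrict y = ∑ k : I, (y k) • (Pi.single k 1 : I → ℝ) := by
      ext j
      simp [Finset.sum_apply, Pi.single_apply]
    rw [h1, map_sum, ← Finset.sum_coe_sort I]
    refine Finset.sum_congr rfl fun k _ => ?_
    rw [map_smul, smul_eq_mul, mul_comm]
    simp [hw]
  rw [charFunDual_apply, charFunDual_apply, integral_map hXI.aemeasurable (by fun_prop),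
    integral_map hYI.aemeasurable (by fun_prop)]
  simp_rw [hL]
  rw [ha.integral_exp I w, ha.shift.integral_exp I w]

lemma map_eq_gaussianReal (ha : IsStationaryGaussianSeq a ρ P) {k : ℕ} (hk : 1 ≤ k) :
    P.map (a k) = gaussianReal 0 1 := by
  obtain ⟨j, rfl⟩ : ∃ j, k = j + 1 := ⟨k - 1, by omega⟩
  have h := ha.gaussian.hasGaussianLaw_eval j
  have h0 := ha.centered (j + 1) hk
  rw [h.map_eq_gaussianReal, variance_of_integral_eq_zero h.aemeasurable h0, h0]
  have := ha.cov (j + 1) (j + 1) hk hk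
  simp only [sub_self, Int.natAbs_zero, ha.unit_variance, ← sq] at this
  rw [this, Real.toNNReal_one]

lemma aemeasurable (ha : IsStationaryGaussianSeq a ρ P) {k : ℕ} (hk : 1 ≤ k) :
    AEMeasurable (a k) P := by
  obtain ⟨j, rfl⟩ : ∃ j, k = j + 1 := ⟨k - 1, by omega⟩
  exact ha.gaussian.aemeasurable j

lemma integrable_pow (ha : IsStationaryGaussianSeq a ρ P) {k : ℕ} (hk : 1 ≤ k) (p : ℕ) :
    Integrable (fun ω => a k ω ^ p) P ∧
      ∫ ω, a k ω ^ p ∂P = ∫ x, x ^ p ∂(gaussianReal 0 1) := by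
  have h := ha.aemeasurable hk
  constructor
  · have h1 : Integrable (fun x : ℝ => x ^ p) (P.map (a k)) := by
      rw [ha.map_eq_gaussianReal hk]
      have := memLp_id_gaussianReal (μ := 0) (v := 1) p
      rcases Nat.eq_zero_or_pos p with rfl | hp
      · simp
      · have h2 := this.integrable_norm_pow (by omega)
        refine h2.mono (by fun_prop) (Eventually.of_forall fun x => by simp)
    exact h1.comp_aemeasurable h
  · rw [← ha.map_eq_gaussianReal hk, integral_map h (by fun_prop)]

end IsStationaryGaussianSeq

/-! ### The maximal ergodic inequality -/

/-- Running maxima of the partial sums of `y - c`. -/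
def runningMax (c : ℝ) : ℕ → (ℕ → ℝ) → ℝ
  | 0, _ => 0
  | N + 1, y => max 0 (y 0 - c + runningMax c N fun k => y (k + 1))

lemma runningMax_nonneg (c : ℝ) (N : ℕ) (y : ℕ → ℝ) : 0 ≤ runningMax c N y := by
  cases N
  · exact le_rfl
  · exact le_max_left _ _

lemma runningMax_le_succ (c : ℝ) (N : ℕ) (y : ℕ → ℝ) :
    runningMax c N y ≤ runningMax c (N + 1) y := by
  induction N generalizing y with
  | zero => exact runningMax_nonneg _ _ _
  | succ N ih =>
    rw [runningMax, runningMax]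
    gcongr
    exact ih _

lemma sum_le_runningMax (c : ℝ) {N n : ℕ} (h : n ≤ N) (y : ℕ → ℝ) :
    ∑ k ∈ Finset.range n, (y k - c) ≤ runningMax c N y := by
  induction N generalizing n y with
  | zero =>
    obtain rfl : n = 0 := by omega
    simp [runningMax]
  | succ N ih =>
    rcases Nat.eq_zero_or_pos n with rfl | hn
    · simpa using runningMax_nonneg _ _ _
    · obtain ⟨i, rfl⟩ : ∃ i, n = i + 1 := ⟨n - 1, by omega⟩
      rw [Finset.sum_range_succ', add_comm]
      refine le_trans ?_ (le_max_right _ _)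
      gcongr
      exact ih (by omega) fun k => y (k + 1)

lemma measurable_runningMax (c : ℝ) (N : ℕ) : Measurable (runningMax c N) := by
  induction N with
  | zero => exact measurable_const
  | succ N ih =>
    have hT : Measurable fun (y : ℕ → ℝ) (k : ℕ) => y (k + 1) :=
      measurable_pi_lambda _ fun k => measurable_pi_apply _
    exact measurable_const.max (((measurable_pi_apply 0).sub_const c).add (ih.comp hT))

/-- **Maximal ergodic inequality** for a shift-invariant law on sequences. -/
lemma measure_exists_sum_gt_le (π : Measure (ℕ → ℝ)) [IsProbabilityMeasure π]
    (hπ : π.map (fun y k => y (k + 1)) = π) (hint : Integrable (fun y : ℕ → ℝ => y 0) π)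
    (hnonneg : ∀ᵐ y ∂π, 0 ≤ y 0) {c : ℝ} (hc : 0 < c) :
    π {y | ∃ n : ℕ, c * n < ∑ k ∈ Finset.range n, y k} ≤ ENNReal.ofReal ((∫ y, y 0 ∂π) / c) := by
  have hT : Measurable fun (y : ℕ → ℝ) (k : ℕ) => y (k + 1) :=
    measurable_pi_lambda _ fun k => measurable_pi_apply _
  have hMP : MeasurePreserving (fun (y : ℕ → ℝ) (k : ℕ) => y (k + 1)) π π := ⟨hT, hπ⟩
  have hI : ∀ N, Integrable (runningMax c N) π := by
    intro N
    induction N with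
    | zero => exact integrable_zero _ _ _
    | succ N ih =>
      have h1 := (hint.sub (integrable_const c)).add (hMP.integrable_comp_of_integrable ih)
      exact (integrable_zero _ _ _).sup h1
  have hN : ∀ N, π {y | 0 < runningMax c N y} ≤ ENNReal.ofReal ((∫ y, y 0 ∂π) / c) := by
    intro N
    have hms : MeasurableSet {y | 0 < runningMax c N y} :=
      measurableSet_lt measurable_const (measurable_runningMax c N)
    have h1 : ∫ y, (runningMax c N y - runningMax c N (fun k => y (k + 1))) ∂π = 0 := by
      have hsub := integral_sub (hI N) (hMP.integrable_comp_of_integrable (hI N))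
      simp only [Function.comp_apply] at hsub
      rw [hsub]
      have : ∫ y, runningMax c N (fun k => y (k + 1)) ∂π = ∫ y, runningMax c N y ∂π := by
        conv_rhs => rw [← hπ]
        rw [integral_map hT.aemeasurable (measurable_runningMax c N).aestronglyMeasurable]
      rw [this, sub_self]
    have h2 : ∀ y, (runningMax c N y - runningMax c N (fun k => y (k + 1))) ≤
        {y | 0 < runningMax c N y}.indicator (fun y => y 0 - c) y := by
      intro y
      by_cases hy : 0 < runningMax c N y
      · rw [Set.indicator_of_mem (show y ∈ {y | 0 < runningMax c N y} from hy)]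
        cases N with
        | zero => exact absurd hy (lt_irrefl _)
        | succ N =>
          have h3 := runningMax_le_succ c N fun k => y (k + 1)
          have h4 : runningMax c (N + 1) y = y 0 - c + runningMax c N fun k => y (k + 1) := by
            rw [runningMax] at hy ⊢
            rcases max_cases (0 : ℝ) (y 0 - c + runningMax c N fun k => y (k + 1)) with h | h
            · rw [h.1] at hy; exact absurd hy (lt_irrefl _)
            · exact h.1
          linarith
      · rw [Set.indicator_of_notMem (show y ∉ {y | 0 < runningMax c N y} from hy)]
        have := runningMax_nonneg c N fun k => y (k + 1)
        linarith [not_lt.1 hy]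
    have h3 := integral_mono ((hI N).sub (hMP.integrable_comp_of_integrable (hI N)))
      ((hint.sub (integrable_const c)).indicator hms) h2
    have h4 : 0 ≤ ∫ y in {y | 0 < runningMax c N y}, (y 0 - c) ∂π := by
      rw [← integral_indicator hms]
      exact h1.symm.le.trans h3
    rw [integral_sub hint.integrableOn (integrable_const c), setIntegral_const, smul_eq_mul] at h4
    have h5 : ∫ y in {y | 0 < runningMax c N y}, y 0 ∂π ≤ ∫ y, y 0 ∂π :=
      setIntegral_le_integral hint hnonneg
    rw [← ofReal_measureReal]
    refine ENNReal.ofReal_le_ofReal ?_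
    rw [le_div_iff₀ hc]
    linarith
  have hsub : {y : ℕ → ℝ | ∃ n : ℕ, c * n < ∑ k ∈ Finset.range n, y k} ⊆
      ⋃ N, {y | 0 < runningMax c N y} := by
    rintro y ⟨n, hn⟩
    refine Set.mem_iUnion.2 ⟨n, ?_⟩
    have h1 := sum_le_runningMax c le_rfl (n := n) y
    rw [Finset.sum_sub_distrib, Finset.sum_const, Finset.card_range, nsmul_eq_mul] at h1
    have : 0 < runningMax c n y := by linarith [mul_comm c (n : ℝ)]
    exact this
  refine (measure_mono hsub).trans ?_
  have hmono : Monotone fun N => {y | 0 < runningMax c N y} :=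
    monotone_nat_of_le_succ fun N y (hy : 0 < runningMax c N y) =>
      hy.trans_le (runningMax_le_succ c N y)
  rw [hmono.measure_iUnion]
  exact iSup_le hN

/-- The empirical second moments of a stationary Gaussian sequence are almost surely bounded. -/
lemma IsStationaryGaussianSeq.ae_exists_sum_sq_le (ha : IsStationaryGaussianSeq a ρ P)
    (hm : ∀ k, Measurable (a k)) :
    ∀ᵐ ω ∂P, ∃ C : ℝ, ∀ n : ℕ, ∑ k ∈ Finset.Icc 1 n, a k ω ^ 2 ≤ C * n := by
  have := ha.isProbabilityMeasure
  have hsq : Measurable fun (y : ℕ → ℝ) (k : ℕ) => y k ^ 2 :=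
    measurable_pi_lambda _ fun k => (measurable_pi_apply k).pow_const 2
  have hX : Measurable fun ω (k : ℕ) => a (k + 1) ω := measurable_pi_lambda _ fun k => hm _
  have hY : Measurable fun ω (k : ℕ) => a (k + 1) ω ^ 2 := hsq.comp hX
  have hT : Measurable fun (y : ℕ → ℝ) (k : ℕ) => y (k + 1) :=
    measurable_pi_lambda _ fun k => measurable_pi_apply _
  set π := P.map fun ω (k : ℕ) => a (k + 1) ω ^ 2 with hπdef
  have hprob : IsProbabilityMeasure π := Measure.isProbabilityMeasure_map hY.aemeasurable
  have hπ : π.map (fun y k => y (k + 1)) = π := by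
    have h1 := congrArg (Measure.map fun (y : ℕ → ℝ) (k : ℕ) => y k ^ 2) (ha.map_shift_eq hm)
    rw [Measure.map_map hsq hX, Measure.map_map hsq (measurable_pi_lambda _ fun k => hm _)] at h1
    rw [hπdef, Measure.map_map hT hY]
    exact h1
  have hi : Integrable (fun y : ℕ → ℝ => y 0) π :=
    (integrable_map_measure (measurable_pi_apply 0).aestronglyMeasurable hY.aemeasurable).2
      (ha.integrable_pow le_rfl 2).1
  have hnn : ∀ᵐ y ∂π, 0 ≤ y 0 :=
    (ae_map_iff hY.aemeasurable (measurableSet_le measurable_const (measurable_pi_apply 0))).2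
      (Eventually.of_forall fun ω => sq_nonneg _)
  have hbad : ∀ c : ℕ, P {ω | ∃ n : ℕ, ((c : ℝ) + 1) * n < ∑ k ∈ Finset.range n, a (k + 1) ω ^ 2} ≤
      ENNReal.ofReal ((∫ y, y 0 ∂π) / ((c : ℝ) + 1)) := by
    intro c
    refine le_trans ?_ (measure_exists_sum_gt_le π hπ hi hnn (by positivity : (0 : ℝ) < c + 1))
    exact Measure.le_map_apply hY.aemeasurable _
  have hlim : Tendsto (fun c : ℕ => ENNReal.ofReal ((∫ y, y 0 ∂π) / ((c : ℝ) + 1))) atTop (𝓝 0) := by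
    have h1 : Tendsto (fun c : ℕ => (∫ y, y 0 ∂π) / ((c : ℝ) + 1)) atTop (𝓝 0) :=
      tendsto_const_nhds.div_atTop (tendsto_natCast_atTop_atTop.atTop_add tendsto_const_nhds)
    simpa using ENNReal.tendsto_ofReal h1
  have hnull : P (⋂ c : ℕ, {ω | ∃ n : ℕ, ((c : ℝ) + 1) * n < ∑ k ∈ Finset.range n, a (k + 1) ω ^ 2})
      = 0 := by
    refine le_antisymm (ge_of_tendsto' hlim fun c => ?_) zero_le
    exact (measure_mono (Set.iInter_subset _ c)).trans (hbad c)
  rw [ae_iff]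
  refine measure_mono_null (fun ω hω => ?_) hnull
  simp only [Set.mem_iInter]
  intro c
  by_contra hcon
  refine hω ⟨(c : ℝ) + 1, fun n => ?_⟩
  have h1 := not_lt.1 fun h => hcon ⟨n, h⟩
  rwa [Finset.range_eq_Ico, Finset.sum_Ico_add' (fun k => a k ω ^ 2) 0 n 1, zero_add,
    Finset.Ico_add_one_right_eq_Icc] at h1

end Stationary

/-! ### Gaussian trigonometric sums -/

/-- Independent stationary Gaussian coefficients with spectral measure `μ`. -/
structure IsCoefficientModel {Ω : Type*} [MeasurableSpace Ω] (a b : ℕ → Ω → ℝ) (ρ : ℕ → ℝ)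
    (μ : Measure ℝ) (P : Measure Ω) : Prop where
  left : IsStationaryGaussianSeq a ρ P
  right : IsStationaryGaussianSeq b ρ P
  indep : IndepFun (fun ω (k : ℕ) => a (k + 1) ω) (fun ω (k : ℕ) => b (k + 1) ω) P
  spectral : IsSpectralMeasure ρ μ
  measurable_left : ∀ k, Measurable (a k)
  measurable_right : ∀ k, Measurable (b k)

/-- The trigonometric polynomial `u ↦ ∑_{k=1}^n w_k e^{-iku}`. -/
def dualSum (n : ℕ) (w : ℕ → ℂ) (u : ℝ) : ℂ :=
  ∑ k ∈ Finset.Icc 1 n, w k * Complex.exp (-Complex.I * (k * u : ℝ))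

/-- The squared norm of `dualSum` in `L²(μ)`. -/
def energy (μ : Measure ℝ) (n : ℕ) (w : ℕ → ℂ) : ℝ := ∫ u, ‖dualSum n w u‖ ^ 2 ∂μ

lemma energy_nonneg (μ : Measure ℝ) (n : ℕ) (w : ℕ → ℂ) : 0 ≤ energy μ n w :=
  integral_nonneg fun _ => by positivity

lemma continuous_dualSum (n : ℕ) (w : ℕ → ℂ) : Continuous (dualSum n w) := by
  unfold dualSum
  fun_prop

lemma norm_dualSum_le (n : ℕ) (w : ℕ → ℂ) (u : ℝ) :
    ‖dualSum n w u‖ ≤ ∑ k ∈ Finset.Icc 1 n, ‖w k‖ := by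
  refine (norm_sum_le _ _).trans (Finset.sum_le_sum fun k _ => ?_)
  rw [norm_mul, neg_mul, ← mul_neg, ← Complex.ofReal_neg, Complex.norm_exp_I_mul_ofReal, mul_one]

lemma dualSum_trigWeight (m : ℝ → ℂ) (n : ℕ) (x u : ℝ) :
    dualSum n (trigWeight m n x) u = ((Real.sqrt n)⁻¹ : ℝ) * trigKernel m n (x - u) := by
  unfold dualSum trigWeight trigKernel
  rw [Finset.mul_sum]
  refine Finset.sum_congr rfl fun k _ => ?_
  rw [mul_assoc, mul_assoc, ← Complex.exp_add]
  congr 3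
  push_cast
  ring_nf

lemma energy_trigWeight (μ : Measure ℝ) (m : ℝ → ℂ) (n : ℕ) (x : ℝ) :
    energy μ n (trigWeight m n x) = ∫ u, ‖trigKernel m n (x - u)‖ ^ 2 / n ∂μ := by
  unfold energy
  refine integral_congr_ae (Eventually.of_forall fun u => ?_)
  simp only [dualSum_trigWeight, norm_mul, mul_pow, Complex.norm_real, Real.norm_eq_abs, sq_abs,
    inv_pow, Real.sq_sqrt (Nat.cast_nonneg n)]
  ring

lemma IsSpectralMeasure.energy_eq {ρ : ℕ → ℝ} {μ : Measure ℝ} (hμ : IsSpectralMeasure ρ μ) (n : ℕ)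
    (w : ℕ → ℂ) : energy μ n w = ∑ k ∈ Finset.Icc 1 n, ∑ l ∈ Finset.Icc 1 n,
      ((w k).re * (w l).re + (w k).im * (w l).im) * ρ ((k : ℤ) - l).natAbs := by
  have := hμ.prob
  have h1 : ∀ u : ℝ, ((‖dualSum n w u‖ ^ 2 : ℝ) : ℂ) = ∑ k ∈ Finset.Icc 1 n, ∑ l ∈ Finset.Icc 1 n,
      (w k * (starRingEnd ℂ) (w l)) * Complex.exp (-Complex.I * ((k : ℤ) - l : ℤ) * u) := by
    intro u
    rw [← Complex.normSq_eq_norm_sq, Complex.normSq_eq_conj_mul_self, mul_comm]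
    unfold dualSum
    rw [map_sum, Finset.sum_mul_sum]
    refine Finset.sum_congr rfl fun k _ => Finset.sum_congr rfl fun l _ => ?_
    rw [map_mul, ← Complex.exp_conj]
    have e : Complex.exp (-Complex.I * ((k : ℤ) - l : ℤ) * u) =
        Complex.exp (-Complex.I * (k * u : ℝ)) *
          Complex.exp ((starRingEnd ℂ) (-Complex.I * (l * u : ℝ))) := by
      rw [← Complex.exp_add]
      congr 1
      simp only [map_mul, map_neg, Complex.conj_I, Complex.conj_ofReal]
      push_cast
      ring
    rw [e]
    ring
  have hint : ∀ j : ℤ, Integrable (fun u : ℝ => Complex.exp (-Complex.I * j * u)) μ := by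
    intro j
    refine Integrable.of_bound (C := 1) (by fun_prop) (Eventually.of_forall fun u => ?_)
    have e : -Complex.I * j * u = ((-(j * u) : ℝ) : ℂ) * Complex.I := by push_cast; ring
    rw [e, Complex.norm_exp_ofReal_mul_I]
  have h2 : ((energy μ n w : ℝ) : ℂ) = ∑ k ∈ Finset.Icc 1 n, ∑ l ∈ Finset.Icc 1 n,
      (w k * (starRingEnd ℂ) (w l)) * ρ ((k : ℤ) - l).natAbs := by
    unfold energy
    rw [← integral_complex_ofReal]
    simp_rw [h1]
    rw [integral_finsetSum _ fun k _ => integrable_finsetSum _ fun l _ => (hint _).const_mul _]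
    refine Finset.sum_congr rfl fun k _ => ?_
    rw [integral_finsetSum _ fun l _ => (hint _).const_mul _]
    refine Finset.sum_congr rfl fun l _ => ?_
    rw [integral_const_mul, hμ.fourier]
  have h3 := congrArg Complex.re h2
  rw [Complex.ofReal_re, Complex.re_sum] at h3
  rw [h3]
  refine Finset.sum_congr rfl fun k _ => ?_
  rw [Complex.re_sum]
  refine Finset.sum_congr rfl fun l _ => ?_
  simp

section Parallelogram

variable (μ : Measure ℝ) [IsFiniteMeasure μ]

lemma integrable_norm_dualSum_mul (n : ℕ) (w w' : ℕ → ℂ) :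
    Integrable (fun u => ‖dualSum n w u‖ * ‖dualSum n w' u‖) μ := by
  refine Integrable.of_bound (C := (∑ k ∈ Finset.Icc 1 n, ‖w k‖) * ∑ k ∈ Finset.Icc 1 n, ‖w' k‖)
    ((continuous_dualSum n w).norm.mul (continuous_dualSum n w').norm).aestronglyMeasurable
    (Eventually.of_forall fun u => ?_)
  rw [Real.norm_of_nonneg (by positivity)]
  gcongr
  · exact norm_dualSum_le n w u
  · exact norm_dualSum_le n w' u

lemma abs_energy_sub_le (n : ℕ) (w w' : ℕ → ℂ) :
    |energy μ n (fun k => w k - w' k) - (energy μ n w + energy μ n w')| ≤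
      2 * ∫ u, ‖dualSum n w u‖ * ‖dualSum n w' u‖ ∂μ := by
  have hsq : ∀ w, Integrable (fun u => ‖dualSum n w u‖ ^ 2) μ := fun w => by
    simpa only [sq] using integrable_norm_dualSum_mul μ n w w
  have hadd : Integrable (fun u => ‖dualSum n w u‖ ^ 2 + ‖dualSum n w' u‖ ^ 2) μ :=
    (hsq w).add (hsq w')
  unfold energy
  rw [← integral_add (hsq w) (hsq w'), ← integral_sub (hsq _) hadd, ← integral_const_mul]
  refine (abs_integral_le_integral_abs).trans (integral_mono ((hsq _).sub hadd).abs
    ((integrable_norm_dualSum_mul μ n w w').const_mul 2) fun u => ?_)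
  have hd : dualSum n (fun k => w k - w' k) u = dualSum n w u - dualSum n w' u := by
    unfold dualSum
    rw [← Finset.sum_sub_distrib]
    exact Finset.sum_congr rfl fun k _ => by ring
  have h1 : ‖dualSum n w u - dualSum n w' u‖ ≤ ‖dualSum n w u‖ + ‖dualSum n w' u‖ := norm_sub_le _ _
  have h2 := abs_norm_sub_norm_le (dualSum n w u) (dualSum n w' u)
  have h3 : (‖dualSum n w u‖ - ‖dualSum n w' u‖) ^ 2 ≤ ‖dualSum n w u - dualSum n w' u‖ ^ 2 := by
    rw [← sq_abs (‖dualSum n w u‖ - ‖dualSum n w' u‖)]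
    exact pow_le_pow_left₀ (abs_nonneg _) h2 2
  have h4 : ‖dualSum n w u - dualSum n w' u‖ ^ 2 ≤ (‖dualSum n w u‖ + ‖dualSum n w' u‖) ^ 2 :=
    pow_le_pow_left₀ (norm_nonneg _) h1 2
  simp only [hd]
  rw [abs_le]
  constructor <;> nlinarith

end Parallelogram

lemma trigSum_eq_range (a b : ℕ → ℝ) (n : ℕ) (w : ℕ → ℂ) :
    trigSum a b n w = (∑ k ∈ Finset.range n, (w (k + 1)).re * a (k + 1)) +
      ∑ k ∈ Finset.range n, (w (k + 1)).im * b (k + 1) := by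
  have h := Finset.sum_Ico_add' (fun k => a k * (w k).re + b k * (w k).im) 0 n 1
  rw [zero_add, Finset.Ico_add_one_right_eq_Icc, ← Finset.range_eq_Ico] at h
  unfold trigSum
  rw [← h, ← Finset.sum_add_distrib]
  exact Finset.sum_congr rfl fun k _ => by ring

lemma measurable_trigSum {Ω : Type*} [MeasurableSpace Ω] {a b : ℕ → Ω → ℝ}
    (ha : ∀ k, Measurable (a k)) (hb : ∀ k, Measurable (b k)) {w : Ω → ℕ → ℂ}
    (hw : ∀ k, Measurable fun p => w p k) (n : ℕ) :
    Measurable fun p => trigSum (fun k => a k p) (fun k => b k p) n (w p) := by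
  unfold trigSum
  refine Finset.measurable_fun_sum _ fun k _ => ?_
  exact ((ha k).mul (Complex.measurable_re.comp (hw k))).add
    ((hb k).mul (Complex.measurable_im.comp (hw k)))

namespace IsCoefficientModel

variable {Ω : Type*} [MeasurableSpace Ω] {a b : ℕ → Ω → ℝ} {ρ : ℕ → ℝ} {μ : Measure ℝ}
  {P : Measure Ω}

/-- The characteristic function of a Gaussian trigonometric sum. -/
lemma integral_exp_trigSum (h : IsCoefficientModel a b ρ μ P) (n : ℕ) (w : ℕ → ℂ) :
    ∫ ω, Complex.exp ((trigSum (fun k => a k ω) (fun k => b k ω) n w : ℝ) * Complex.I) ∂P =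
      ((Real.exp (-(energy μ n w / 2)) : ℝ) : ℂ) := by
  have hsum : ∀ F : ℕ → ℕ → ℝ, ∑ k ∈ Finset.Icc 1 n, ∑ l ∈ Finset.Icc 1 n, F k l =
      ∑ k ∈ Finset.range n, ∑ l ∈ Finset.range n, F (k + 1) (l + 1) := by
    intro F
    have e : ∀ G : ℕ → ℝ, ∑ k ∈ Finset.Icc 1 n, G k = ∑ k ∈ Finset.range n, G (k + 1) := by
      intro G
      have h := Finset.sum_Ico_add' G 0 n 1
      rw [zero_add, Finset.Ico_add_one_right_eq_Icc, ← Finset.range_eq_Ico] at h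
      exact h.symm
    rw [e]
    exact Finset.sum_congr rfl fun k _ => e _
  have hφ : ∀ v : ℕ → ℝ, Measurable fun y : ℕ → ℝ =>
      Complex.exp ((∑ k ∈ Finset.range n, v k * y k : ℝ) * Complex.I) := fun v => by fun_prop
  have hind := h.indep.comp (hφ fun k => (w (k + 1)).re) (hφ fun k => (w (k + 1)).im)
  have hmul := hind.integral_fun_mul_eq_mul_integral
    ((hφ fun k => (w (k + 1)).re).comp
      (measurable_pi_lambda _ fun k => h.measurable_left _)).aestronglyMeasurable
    ((hφ fun k => (w (k + 1)).im).comp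
      (measurable_pi_lambda _ fun k => h.measurable_right _)).aestronglyMeasurable
  simp only [Function.comp_apply] at hmul
  rw [h.left.integral_exp (Finset.range n) fun k => (w (k + 1)).re,
    h.right.integral_exp (Finset.range n) fun k => (w (k + 1)).im, ← Complex.exp_add] at hmul
  have e1 : ∀ ω, Complex.exp ((trigSum (fun k => a k ω) (fun k => b k ω) n w : ℝ) * Complex.I) =
      Complex.exp ((∑ k ∈ Finset.range n, (w (k + 1)).re * a (k + 1) ω : ℝ) * Complex.I) *
      Complex.exp ((∑ k ∈ Finset.range n, (w (k + 1)).im * b (k + 1) ω : ℝ) * Complex.I) := by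
    intro ω
    rw [trigSum_eq_range, Complex.ofReal_add, add_mul, Complex.exp_add]
  simp_rw [e1]
  rw [hmul, h.spectral.energy_eq, hsum, Complex.ofReal_exp]
  congr 1
  have e2 : ∑ k ∈ Finset.range n, ∑ l ∈ Finset.range n,
      ((w (k + 1)).re * (w (l + 1)).re + (w (k + 1)).im * (w (l + 1)).im) *
        ρ (((k + 1 : ℕ) : ℤ) - (l + 1 : ℕ)).natAbs =
      (∑ k ∈ Finset.range n, ∑ l ∈ Finset.range n,
        (w (k + 1)).re * (w (l + 1)).re * ρ ((k : ℤ) - l).natAbs) +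
      ∑ k ∈ Finset.range n, ∑ l ∈ Finset.range n,
        (w (k + 1)).im * (w (l + 1)).im * ρ ((k : ℤ) - l).natAbs := by
    rw [← Finset.sum_add_distrib]
    refine Finset.sum_congr rfl fun k _ => ?_
    rw [← Finset.sum_add_distrib]
    refine Finset.sum_congr rfl fun l _ => ?_
    have : ((k + 1 : ℕ) : ℤ) - (l + 1 : ℕ) = (k : ℤ) - l := by push_cast; ring
    rw [this, add_mul]
  rw [e2]
  push_cast
  ring

end IsCoefficientModel

/-! ### Quenched characteristic functions -/

lemma ae_tendsto_zero_of_summable_integral {Ω : Type*} [MeasurableSpace Ω] {P : Measure Ω}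
    {f : ℕ → Ω → ℝ} (h0 : ∀ j ω, 0 ≤ f j ω) (hf : ∀ j, Integrable (f j) P)
    (hs : Summable fun j => ∫ ω, f j ω ∂P) :
    ∀ᵐ ω ∂P, Tendsto (fun j => f j ω) atTop (𝓝 0) := by
  have h1 : ∫⁻ ω, ∑' j, ENNReal.ofReal (f j ω) ∂P ≠ ⊤ := by
    rw [lintegral_tsum fun j => (hf j).aestronglyMeasurable.aemeasurable.ennreal_ofReal]
    simp_rw [← ofReal_integral_eq_lintegral_ofReal (hf _) (Eventually.of_forall (h0 _))]
    exact hs.tsum_ofReal_ne_top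
  have h2 := ae_lt_top' (AEMeasurable.tsum fun j =>
    (hf j).aestronglyMeasurable.aemeasurable.ennreal_ofReal) h1
  filter_upwards [h2] with ω hω
  have h3 := ENNReal.tendsto_atTop_zero_of_tsum_ne_top hω.ne
  have h4 := (ENNReal.tendsto_toReal ENNReal.zero_ne_top).comp h3
  simpa [Function.comp_def, ENNReal.toReal_ofReal (h0 _ _)] using h4

/-- A second moment bound for random integrals with almost uncorrelated integrands. -/
lemma integral_norm_integral_sq_le {Ω X : Type*} [MeasurableSpace Ω] [MeasurableSpace X]
    {P : Measure Ω} [IsProbabilityMeasure P] {U : Measure X} [IsProbabilityMeasure U]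
    {Ψ : Ω → X → ℂ} (hΨ : Measurable (Function.uncurry Ψ)) {C : ℝ} (hC : ∀ ω x, ‖Ψ ω x‖ ≤ C)
    {B : X × X → ℝ} (hB : Integrable B (U.prod U))
    (h : ∀ x y, ‖∫ ω, Ψ ω x * (starRingEnd ℂ) (Ψ ω y) ∂P‖ ≤ B (x, y)) :
    ∫ ω, ‖∫ x, Ψ ω x ∂U‖ ^ 2 ∂P ≤ ∫ p, B p ∂(U.prod U) := by
  have e1 : ∀ ω, ((‖∫ x, Ψ ω x ∂U‖ ^ 2 : ℝ) : ℂ) =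
      ∫ p : X × X, Ψ ω p.1 * (starRingEnd ℂ) (Ψ ω p.2) ∂(U.prod U) := by
    intro ω
    rw [integral_prod_mul (fun x => Ψ ω x) fun y => (starRingEnd ℂ) (Ψ ω y), integral_conj,
      ← Complex.normSq_eq_norm_sq, Complex.normSq_eq_conj_mul_self, mul_comm]
  have hm : Measurable fun q : Ω × X × X => Ψ q.1 q.2.1 * (starRingEnd ℂ) (Ψ q.1 q.2.2) :=
    (hΨ.comp (measurable_fst.prodMk (measurable_fst.comp measurable_snd))).mul
      (Complex.continuous_conj.measurable.comp
        (hΨ.comp (measurable_fst.prodMk (measurable_snd.comp measurable_snd))))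
  have hint : Integrable (Function.uncurry fun (ω : Ω) (p : X × X) =>
      Ψ ω p.1 * (starRingEnd ℂ) (Ψ ω p.2)) (P.prod (U.prod U)) := by
    refine Integrable.of_bound (C := C * C) hm.aestronglyMeasurable (Eventually.of_forall ?_)
    rintro ⟨ω, x, y⟩
    simp only [Function.uncurry_apply_pair, norm_mul, RCLike.norm_conj]
    exact mul_le_mul (hC ω x) (hC ω y) (norm_nonneg _) ((norm_nonneg _).trans (hC ω x))
  have e2 : ((∫ ω, ‖∫ x, Ψ ω x ∂U‖ ^ 2 ∂P : ℝ) : ℂ) =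
      ∫ p : X × X, ∫ ω, Ψ ω p.1 * (starRingEnd ℂ) (Ψ ω p.2) ∂P ∂(U.prod U) := by
    rw [← integral_complex_ofReal]
    simp_rw [e1]
    exact integral_integral_swap hint
  have e3 : ∫ ω, ‖∫ x, Ψ ω x ∂U‖ ^ 2 ∂P = ‖((∫ ω, ‖∫ x, Ψ ω x ∂U‖ ^ 2 ∂P : ℝ) : ℂ)‖ := by
    rw [Complex.norm_real, Real.norm_of_nonneg (integral_nonneg fun _ => by positivity)]
  rw [e3, e2]
  exact norm_integral_le_of_norm_le hB (Eventually.of_forall fun p => h p.1 p.2)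

lemma abs_exp_neg_sub_exp_neg_le {s t : ℝ} (hs : 0 ≤ s) (ht : 0 ≤ t) :
    |Real.exp (-s) - Real.exp (-t)| ≤ |s - t| := by
  have key : ∀ {s t : ℝ}, 0 ≤ s → s ≤ t → |Real.exp (-s) - Real.exp (-t)| ≤ |s - t| := by
    intro s t hs hst
    rw [abs_of_nonneg (sub_nonneg.2 (Real.exp_le_exp.2 (by linarith))), abs_of_nonpos (by linarith)]
    have h1 : Real.exp (-t) = Real.exp (-s) * Real.exp (-(t - s)) := by
      rw [← Real.exp_add]; congr 1; ring
    have h2 := Real.one_sub_le_exp_neg (t - s)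
    have h3 : Real.exp (-s) ≤ 1 := Real.exp_le_one_iff.2 (by linarith)
    rw [h1]
    nlinarith [Real.exp_pos (-s)]
  rcases le_total s t with h | h
  · exact key hs h
  · rw [abs_sub_comm, abs_sub_comm s]; exact key ht h

/-- The characteristic function of the localized trigonometric sum at a uniform point, for given
coefficients. -/
def quenchedChar (m : ℝ → ℂ) (a b : ℕ → ℝ) (n : ℕ) : ℂ :=
  ∫ x, Complex.exp ((trigSum a b n (trigWeight m n x) : ℝ) * Complex.I) ∂uniformMeasure

/-- The characteristic function of the localized trigonometric sum, averaged over Gaussian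
coefficients. -/
def annealedChar (m : ℝ → ℂ) (μ : Measure ℝ) (n : ℕ) : ℝ :=
  ∫ x, Real.exp (-(energy μ n (trigWeight m n x) / 2)) ∂uniformMeasure

lemma continuous_trigWeight (m : ℝ → ℂ) (n k : ℕ) : Continuous fun x => trigWeight m n x k := by
  unfold trigWeight
  fun_prop

lemma continuous_trigSum_trigWeight (m : ℝ → ℂ) (a b : ℕ → ℝ) (n N : ℕ) :
    Continuous fun x => trigSum a b N (trigWeight m n x) := by
  unfold trigSum
  refine continuous_finsetSum _ fun k _ => ?_
  exact (continuous_const.mul (Complex.continuous_re.comp (continuous_trigWeight m n k))).add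
    (continuous_const.mul (Complex.continuous_im.comp (continuous_trigWeight m n k)))

lemma continuous_norm_dualSum_trigWeight (m : ℝ → ℂ) (n : ℕ) :
    Continuous fun p : ℝ × ℝ => ‖dualSum n (trigWeight m n p.1) p.2‖ := by
  simp_rw [dualSum_trigWeight]
  exact (continuous_const.mul ((continuous_trigKernel m n).comp
    (continuous_fst.sub continuous_snd))).norm

lemma norm_trigWeight_le {m : ℝ → ℂ} {K : ℝ} (hm : IsBoundedLipschitz m K) (n k : ℕ) (x : ℝ) :
    ‖trigWeight m n x k‖ ≤ (Real.sqrt n)⁻¹ * K := by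
  unfold trigWeight
  rw [norm_mul, norm_mul, Complex.norm_exp_I_mul_ofReal, mul_one, Complex.norm_real,
    Real.norm_of_nonneg (by positivity)]
  gcongr
  exact hm.bound _

lemma norm_dualSum_trigWeight_le {m : ℝ → ℂ} {K : ℝ} (hm : IsBoundedLipschitz m K) (n : ℕ)
    (x u : ℝ) : ‖dualSum n (trigWeight m n x) u‖ ≤ n * ((Real.sqrt n)⁻¹ * K) := by
  refine (norm_dualSum_le _ _ _).trans ?_
  refine (Finset.sum_le_card_nsmul _ _ _ fun k _ => norm_trigWeight_le hm n k x).trans ?_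
  simp

lemma continuous_energy_trigWeight {m : ℝ → ℂ} {K : ℝ} (hm : IsBoundedLipschitz m K)
    (μ : Measure ℝ) [IsFiniteMeasure μ] (n : ℕ) :
    Continuous fun x => energy μ n (trigWeight m n x) := by
  unfold energy
  refine continuous_of_dominated (bound := fun _ => (n * ((Real.sqrt n)⁻¹ * K)) ^ 2)
    (fun x => ((continuous_dualSum n _).norm.pow 2).aestronglyMeasurable) (fun x => ?_)
    (integrable_const _) (Eventually.of_forall fun u => ?_)
  · refine Eventually.of_forall fun u => ?_
    rw [Real.norm_of_nonneg (by positivity)]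
    exact pow_le_pow_left₀ (norm_nonneg _) (norm_dualSum_trigWeight_le hm n x u) 2
  · exact ((continuous_norm_dualSum_trigWeight m n).comp
      (continuous_id.prodMk continuous_const)).pow 2

lemma integrable_norm_dualSum_mul_norm_dualSum {m : ℝ → ℂ} {K : ℝ}
    (hm : IsBoundedLipschitz m K) (μ : Measure ℝ) [IsFiniteMeasure μ] (n : ℕ) :
    Integrable (Function.uncurry fun (p : ℝ × ℝ) (u : ℝ) =>
      ‖dualSum n (trigWeight m n p.1) u‖ * ‖dualSum n (trigWeight m n p.2) u‖)
      ((uniformMeasure.prod uniformMeasure).prod μ) := by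
  have hcont : Continuous fun q : (ℝ × ℝ) × ℝ => ‖dualSum n (trigWeight m n q.1.1) q.2‖ *
      ‖dualSum n (trigWeight m n q.1.2) q.2‖ := by
    have h1 : Continuous fun q : (ℝ × ℝ) × ℝ => (q.1.1, q.2) := by fun_prop
    have h2 : Continuous fun q : (ℝ × ℝ) × ℝ => (q.1.2, q.2) := by fun_prop
    have h3 := (continuous_norm_dualSum_trigWeight m n).comp h1
    have h4 := (continuous_norm_dualSum_trigWeight m n).comp h2
    simp only [Function.comp_def] at h3 h4
    exact h3.mul h4
  refine Integrable.of_bound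
    (C := (n * ((Real.sqrt n)⁻¹ * K)) * (n * ((Real.sqrt n)⁻¹ * K)))
    hcont.aestronglyMeasurable (Eventually.of_forall fun q => ?_)
  have h1 := norm_dualSum_trigWeight_le hm n q.1.1 q.2
  have h2 := norm_dualSum_trigWeight_le hm n q.1.2 q.2
  rw [Function.uncurry, Real.norm_of_nonneg (mul_nonneg (norm_nonneg _) (norm_nonneg _))]
  exact mul_le_mul h1 h2 (norm_nonneg _) ((norm_nonneg _).trans h1)

/-- The `L¹(uniform) ⊗ L¹(uniform)` norm of the correlation kernel. -/
lemma IsBoundedLipschitz.exists_integral_correlation_le {m : ℝ → ℂ} {K : ℝ}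
    (hm : IsBoundedLipschitz m K) : ∃ C, ∀ (μ : Measure ℝ) [IsProbabilityMeasure μ] (n : ℕ),
      ∫ p : ℝ × ℝ, (∫ u, ‖dualSum n (trigWeight m n p.1) u‖ *
        ‖dualSum n (trigWeight m n p.2) u‖ ∂μ) ∂(uniformMeasure.prod uniformMeasure) ≤
          C * (Real.sqrt n)⁻¹ := by
  obtain ⟨C, hC0, hC⟩ := exists_integral_norm_trigKernel_le hm
  refine ⟨C ^ 2, fun μ _ n => ?_⟩
  have hint := integrable_norm_dualSum_mul_norm_dualSum hm μ n
  rw [integral_integral_swap hint]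
  have hle : ∀ u, ∫ p : ℝ × ℝ, ‖dualSum n (trigWeight m n p.1) u‖ *
      ‖dualSum n (trigWeight m n p.2) u‖ ∂(uniformMeasure.prod uniformMeasure) ≤
        C ^ 2 * (Real.sqrt n)⁻¹ := by
    intro u
    rw [integral_prod_mul (fun x => ‖dualSum n (trigWeight m n x) u‖)
      fun y => ‖dualSum n (trigWeight m n y) u‖]
    have h1 : ∫ x, ‖dualSum n (trigWeight m n x) u‖ ∂uniformMeasure ≤
        (Real.sqrt n)⁻¹ * (C * (n : ℝ) ^ (1 / 4 : ℝ)) := by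
      simp_rw [dualSum_trigWeight, norm_mul, Complex.norm_real,
        Real.norm_of_nonneg (inv_nonneg.2 (Real.sqrt_nonneg (n : ℝ)))]
      rw [integral_const_mul]
      gcongr
      exact hC n u
    have h0 : 0 ≤ ∫ x, ‖dualSum n (trigWeight m n x) u‖ ∂uniformMeasure :=
      integral_nonneg fun _ => norm_nonneg _
    refine (mul_le_mul h1 h1 h0 (h0.trans h1)).trans (le_of_eq ?_)
    have h2 : (n : ℝ) ^ (1 / 4 : ℝ) * (n : ℝ) ^ (1 / 4 : ℝ) = Real.sqrt n := by
      rw [← Real.rpow_add_of_nonneg (Nat.cast_nonneg n) (by norm_num) (by norm_num),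
        Real.sqrt_eq_rpow]
      norm_num
    rcases eq_or_ne (Real.sqrt n) 0 with h | h
    · simp [h]
    · calc (Real.sqrt n)⁻¹ * (C * (n : ℝ) ^ (1 / 4 : ℝ)) *
            ((Real.sqrt n)⁻¹ * (C * (n : ℝ) ^ (1 / 4 : ℝ)))
          = (Real.sqrt n)⁻¹ * (Real.sqrt n)⁻¹ * C ^ 2 *
            ((n : ℝ) ^ (1 / 4 : ℝ) * (n : ℝ) ^ (1 / 4 : ℝ)) := by ring
        _ = C ^ 2 * (Real.sqrt n)⁻¹ := by rw [h2]; field_simp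
  calc _ ≤ ∫ _, C ^ 2 * (Real.sqrt n)⁻¹ ∂μ :=
        integral_mono hint.integral_prod_right (integrable_const _) hle
    _ = _ := by simp

namespace IsCoefficientModel

variable {Ω : Type*} [MeasurableSpace Ω] {a b : ℕ → Ω → ℝ} {ρ : ℕ → ℝ} {μ : Measure ℝ}
  {P : Measure Ω} {m : ℝ → ℂ} {K : ℝ}

lemma measurable_exp_trigSum (h : IsCoefficientModel a b ρ μ P) (m : ℝ → ℂ) (n : ℕ) :
    Measurable fun p : Ω × ℝ => Complex.exp ((trigSum (fun k => a k p.1) (fun k => b k p.1) n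
      (trigWeight m n p.2) : ℝ) * Complex.I) := by
  have := measurable_trigSum (Ω := Ω × ℝ) (a := fun k p => a k p.1) (b := fun k p => b k p.1)
    (fun k => (h.measurable_left k).comp measurable_fst)
    (fun k => (h.measurable_right k).comp measurable_fst) (w := fun p => trigWeight m n p.2)
    (fun k => (continuous_trigWeight m n k).measurable.comp measurable_snd) n
  exact Complex.continuous_exp.measurable.comp
    ((Complex.continuous_ofReal.measurable.comp this).mul_const _)

lemma measurable_quenchedChar (h : IsCoefficientModel a b ρ μ P) (m : ℝ → ℂ) (n : ℕ) :
    Measurable fun ω => quenchedChar m (fun k => a k ω) (fun k => b k ω) n := by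
  unfold quenchedChar
  exact ((h.measurable_exp_trigSum m n).stronglyMeasurable.integral_prod_right').measurable

lemma norm_quenchedChar_le (m : ℝ → ℂ) (a b : ℕ → ℝ) (n : ℕ) : ‖quenchedChar m a b n‖ ≤ 1 := by
  have := norm_integral_le_of_norm_le_const (μ := uniformMeasure) (C := 1)
    (f := fun x => Complex.exp ((trigSum a b n (trigWeight m n x) : ℝ) * Complex.I))
    (Eventually.of_forall fun x => by rw [Complex.norm_exp_ofReal_mul_I])
  simpa [quenchedChar] using this

lemma abs_annealedChar_le (m : ℝ → ℂ) (μ : Measure ℝ) (n : ℕ) : |annealedChar m μ n| ≤ 1 := by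
  have := norm_integral_le_of_norm_le_const (μ := uniformMeasure) (C := 1)
    (f := fun x => Real.exp (-(energy μ n (trigWeight m n x) / 2)))
    (Eventually.of_forall fun x => by
      rw [Real.norm_of_nonneg (Real.exp_nonneg _), Real.exp_le_one_iff]
      have := energy_nonneg μ n (trigWeight m n x)
      linarith)
  simpa [annealedChar] using this

lemma exists_integral_sq_quenchedChar_sub_le (h : IsCoefficientModel a b ρ μ P)
    (hm : IsBoundedLipschitz m K) : ∃ C : ℝ, ∀ n : ℕ,
      ∫ ω, ‖quenchedChar m (fun k => a k ω) (fun k => b k ω) n - annealedChar m μ n‖ ^ 2 ∂P ≤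
        C * (Real.sqrt n)⁻¹ := by
  have := h.left.isProbabilityMeasure
  have := h.spectral.prob
  obtain ⟨C, hC⟩ := hm.exists_integral_correlation_le
  refine ⟨C, fun n => ?_⟩
  set W : ℝ → ℕ → ℂ := trigWeight m n with hW
  set e : ℝ → ℝ := fun x => Real.exp (-(energy μ n (W x) / 2)) with he
  set Φ : Ω → ℝ → ℂ := fun ω x =>
    Complex.exp ((trigSum (fun k => a k ω) (fun k => b k ω) n (W x) : ℝ) * Complex.I) with hΦ
  have hΦn : ∀ ω x, ‖Φ ω x‖ = 1 := fun ω x => Complex.norm_exp_ofReal_mul_I _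
  have hE0 : ∀ x, 0 ≤ energy μ n (W x) / 2 := fun x => by
    have := energy_nonneg μ n (W x); positivity
  have he1 : ∀ x, |e x| ≤ 1 := fun x => by
    rw [abs_of_nonneg (Real.exp_nonneg _)]
    exact Real.exp_le_one_iff.2 (by linarith [hE0 x])
  have hec : Continuous e := by
    exact Real.continuous_exp.comp ((continuous_energy_trigWeight hm μ n).div_const 2).neg
  have hΦm : Measurable (Function.uncurry Φ) := by
    rw [Function.uncurry_def]
    exact h.measurable_exp_trigSum m n
  have hΦx : ∀ x, Measurable fun ω => Φ ω x := fun x => hΦm.of_uncurry_right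
  have hΦi : ∀ x, Integrable (fun ω => Φ ω x) P := fun x =>
    Integrable.of_bound (C := 1) (hΦx x).aestronglyMeasurable
      (Eventually.of_forall fun ω => (hΦn ω x).le)
  have hmean : ∀ x, ∫ ω, Φ ω x ∂P = (e x : ℂ) := fun x => h.integral_exp_trigSum n (W x)
  have hconj : ∀ x, ∫ ω, (starRingEnd ℂ) (Φ ω x) ∂P = (e x : ℂ) := fun x => by
    rw [integral_conj, hmean, Complex.conj_ofReal]
  have hprod : ∀ x y ω, Φ ω x * (starRingEnd ℂ) (Φ ω y) =
      Complex.exp ((trigSum (fun k => a k ω) (fun k => b k ω) n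
        (fun k => W x k - W y k) : ℝ) * Complex.I) := by
    intro x y ω
    rw [← trigSum_sub]
    simp only [hΦ, ← Complex.exp_conj, ← Complex.exp_add]
    congr 1
    simp only [map_mul, Complex.conj_ofReal, Complex.conj_I]
    push_cast
    ring
  have hcorr : ∀ x y, ∫ ω, Φ ω x * (starRingEnd ℂ) (Φ ω y) ∂P =
      ((Real.exp (-(energy μ n (fun k => W x k - W y k) / 2)) : ℝ) : ℂ) := by
    intro x y
    simp_rw [hprod]
    exact h.integral_exp_trigSum n _
  have hpi : ∀ x y, Integrable (fun ω => Φ ω x * (starRingEnd ℂ) (Φ ω y)) P := fun x y =>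
    Integrable.of_bound (C := 1)
      ((hΦx x).mul (Complex.continuous_conj.measurable.comp (hΦx y))).aestronglyMeasurable
      (Eventually.of_forall fun ω => by simp [hΦn])
  have hBi : Integrable (fun p : ℝ × ℝ => ∫ u, ‖dualSum n (trigWeight m n p.1) u‖ *
      ‖dualSum n (trigWeight m n p.2) u‖ ∂μ) (uniformMeasure.prod uniformMeasure) := by
    simpa only [Function.uncurry_apply_pair] using
      (integrable_norm_dualSum_mul_norm_dualSum hm μ n).integral_prod_left
  have hem : Measurable fun p : Ω × ℝ => (e p.2 : ℂ) :=
    Complex.measurable_ofReal.comp (hec.measurable.comp measurable_snd)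
  have hΨm : Measurable (Function.uncurry fun (ω : Ω) (x : ℝ) => Φ ω x - (e x : ℂ)) := by
    rw [Function.uncurry_def] at hΦm ⊢
    exact hΦm.sub hem
  have key := integral_norm_integral_sq_le (P := P) (U := uniformMeasure)
    (Ψ := fun ω x => Φ ω x - e x) (C := 2)
    hΨm
    (fun ω x => (norm_sub_le _ _).trans (by
      rw [hΦn, Complex.norm_real, Real.norm_eq_abs]; linarith [he1 x]))
    hBi (fun x y => ?_)
  · refine le_trans (le_of_eq ?_) (key.trans (hC μ n))
    refine integral_congr_ae (Eventually.of_forall fun ω => ?_)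
    simp only
    congr 2
    rw [integral_sub, integral_complex_ofReal]
    · rfl
    · exact Integrable.of_bound (C := 1) hΦm.of_uncurry_left.aestronglyMeasurable (Eventually.of_forall fun x => (hΦn ω x).le)
    · exact Integrable.of_bound (C := 1) (Complex.continuous_ofReal.comp hec).aestronglyMeasurable
        (Eventually.of_forall fun x => by
          rw [Complex.norm_real, Real.norm_eq_abs]; exact he1 x)
  · have h1 : ∫ ω, (Φ ω x - e x) * (starRingEnd ℂ) (Φ ω y - e y) ∂P =
        ((Real.exp (-(energy μ n (fun k => W x k - W y k) / 2)) -
          Real.exp (-(energy μ n (W x) / 2 + energy μ n (W y) / 2)) : ℝ) : ℂ) := by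
      have e1 : ∀ ω, (Φ ω x - e x) * (starRingEnd ℂ) (Φ ω y - e y) =
          Φ ω x * (starRingEnd ℂ) (Φ ω y) - (Φ ω x * e y + e x * (starRingEnd ℂ) (Φ ω y) -
            e x * e y) := by
        intro ω
        rw [map_sub, Complex.conj_ofReal]
        ring
      have hci : Integrable (fun ω => (starRingEnd ℂ) (Φ ω y)) P :=
        Integrable.of_bound (C := 1)
          (Complex.continuous_conj.measurable.comp (hΦx y)).aestronglyMeasurable
          (Eventually.of_forall fun ω => by simp [hΦn])
      have i1 : Integrable (fun ω => Φ ω x * (e y : ℂ)) P := (hΦi x).mul_const _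
      have i2 : Integrable (fun ω => (e x : ℂ) * (starRingEnd ℂ) (Φ ω y)) P := hci.const_mul _
      have i3 : Integrable (fun ω => Φ ω x * (e y : ℂ) + e x * (starRingEnd ℂ) (Φ ω y)) P :=
        i1.add i2
      have i4 : Integrable (fun ω => Φ ω x * (e y : ℂ) + e x * (starRingEnd ℂ) (Φ ω y) -
        (e x : ℂ) * e y) P := i3.sub (integrable_const _)
      simp_rw [e1]
      rw [integral_sub (hpi x y) i4, integral_sub i3 (integrable_const _), integral_add i1 i2,
        integral_mul_const, integral_const_mul, hmean, hconj, hcorr, neg_add, Real.exp_add]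
      simp [he]
    rw [h1, Complex.norm_real, Real.norm_eq_abs]
    refine (abs_exp_neg_sub_exp_neg_le ?_ (add_nonneg (hE0 x) (hE0 y))).trans ?_
    · have := energy_nonneg μ n (fun k => W x k - W y k); positivity
    · have h2 := abs_energy_sub_le μ n (W x) (W y)
      have h3 : energy μ n (fun k => W x k - W y k) / 2 -
          (energy μ n (W x) / 2 + energy μ n (W y) / 2) =
          (energy μ n (fun k => W x k - W y k) - (energy μ n (W x) + energy μ n (W y))) / 2 := by
        ring
      rw [h3, abs_div, abs_two]
      linarith

lemma ae_tendsto_quenchedChar_sub (h : IsCoefficientModel a b ρ μ P)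
    (hm : IsBoundedLipschitz m K) : ∀ᵐ ω ∂P, Tendsto (fun j : ℕ =>
      quenchedChar m (fun k => a k ω) (fun k => b k ω) (j ^ 4) - annealedChar m μ (j ^ 4))
      atTop (𝓝 0) := by
  have := h.left.isProbabilityMeasure
  obtain ⟨C, hC⟩ := h.exists_integral_sq_quenchedChar_sub_le hm
  have key := ae_tendsto_zero_of_summable_integral (P := P) (f := fun (j : ℕ) ω =>
    ‖quenchedChar m (fun k => a k ω) (fun k => b k ω) (j ^ 4) - annealedChar m μ (j ^ 4)‖ ^ 2)
    (fun _ _ => by positivity) (fun j => ?_) ?_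
  · filter_upwards [key] with ω hω
    rw [tendsto_zero_iff_norm_tendsto_zero]
    have := hω.sqrt
    simpa [Real.sqrt_sq (norm_nonneg _)] using this
  · refine Integrable.of_bound (C := 2 ^ 2) (((h.measurable_quenchedChar m _).sub_const _).norm.pow_const
      2).aestronglyMeasurable (Eventually.of_forall fun ω => ?_)
    rw [Real.norm_of_nonneg (by positivity)]
    refine pow_le_pow_left₀ (norm_nonneg _) ((norm_sub_le _ _).trans ?_) 2
    rw [Complex.norm_real, Real.norm_eq_abs]
    linarith [norm_quenchedChar_le m (fun k => a k ω) (fun k => b k ω) (j ^ 4),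
      abs_annealedChar_le m μ (j ^ 4)]
  · refine Summable.of_nonneg_of_le (fun j => integral_nonneg fun _ => by positivity)
      (fun j => hC (j ^ 4)) ?_
    have e : ∀ j : ℕ, (Real.sqrt ((j ^ 4 : ℕ) : ℝ))⁻¹ = 1 / (j : ℝ) ^ 2 := by
      intro j
      have : ((j ^ 4 : ℕ) : ℝ) = ((j : ℝ) ^ 2) ^ 2 := by push_cast; ring
      rw [this, Real.sqrt_sq (by positivity), one_div]
    simp_rw [e]
    exact (Real.summable_one_div_nat_pow.2 one_lt_two).mul_left C

end IsCoefficientModel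

/-! ### Almost sure convergence of the quenched characteristic functions -/

lemma norm_exp_mul_I_sub_le (s t : ℝ) :
    ‖Complex.exp (s * Complex.I) - Complex.exp (t * Complex.I)‖ ≤ |s - t| := by
  have h : Complex.exp (s * Complex.I) - Complex.exp (t * Complex.I) =
      Complex.exp (t * Complex.I) * (Complex.exp (Complex.I * (s - t : ℝ)) - 1) := by
    rw [mul_sub, mul_one, ← Complex.exp_add]
    congr 2
    push_cast
    ring
  rw [h, norm_mul, Complex.norm_exp_ofReal_mul_I, one_mul]
  exact Real.norm_exp_I_mul_ofReal_sub_one_le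

lemma sq_integral_abs_le {X : Type*} [MeasurableSpace X] {U : Measure X} [IsProbabilityMeasure U]
    {H : X → ℝ} (h1 : Integrable H U) (h2 : Integrable (fun x => H x ^ 2) U) :
    (∫ x, |H x| ∂U) ^ 2 ≤ ∫ x, H x ^ 2 ∂U := by
  set c := ∫ x, |H x| ∂U with hc
  have i1 : Integrable (fun x => 2 * c * |H x|) U := h1.abs.const_mul _
  have i2 : Integrable (fun x => 2 * c * |H x| - c ^ 2) U := i1.sub (integrable_const _)
  have h : 0 ≤ ∫ x, (H x ^ 2 - (2 * c * |H x| - c ^ 2)) ∂U :=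
    integral_nonneg fun x => by
      have : 0 ≤ (|H x| - c) ^ 2 := sq_nonneg _
      simp only [Pi.zero_apply]
      nlinarith [sq_abs (H x)]
  rw [integral_sub h2 i2, integral_sub i1 (integrable_const _), integral_const_mul, ← hc] at h
  simp only [integral_const, probReal_univ, smul_eq_mul, one_mul] at h
  linarith

lemma integrable_uniformMeasure_of_continuous {E : Type*} [NormedAddCommGroup E] {f : ℝ → E}
    (hf : Continuous f) : Integrable f uniformMeasure := by
  have := (hf.continuousOn (s := Set.Icc 0 (2 * Real.pi))).integrableOn_compact (μ := volume)
    isCompact_Icc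
  exact this.integrable.smul_measure (by simp [Real.pi_pos])

lemma norm_quenchedChar_sub_sq_le {m : ℝ → ℂ} {K : ℝ} (hm : IsBoundedLipschitz m K) (a b : ℕ → ℝ)
    {N n : ℕ} (hN : 0 < N) (hNn : N ≤ n) :
    ‖quenchedChar m a b n - quenchedChar m a b N‖ ^ 2 ≤
      4 * K ^ 2 * ((n - N) / N) ^ 2 * ((∑ k ∈ Finset.Icc 1 N, (a k ^ 2 + b k ^ 2)) / N) +
        K ^ 2 * ((∑ k ∈ Finset.Ioc N n, (a k ^ 2 + b k ^ 2)) / N) := by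
  have hK := hm.nonneg
  have hN' : (0 : ℝ) < N := by exact_mod_cast hN
  have hn' : (0 : ℝ) < n := by exact_mod_cast hN.trans_le hNn
  have hNn' : (N : ℝ) ≤ n := by exact_mod_cast hNn
  have hsN : 0 < Real.sqrt N := Real.sqrt_pos.2 hN'
  have hsn : Real.sqrt N ≤ Real.sqrt n := Real.sqrt_le_sqrt hNn'
  have hsinv : (Real.sqrt n)⁻¹ ≤ (Real.sqrt N)⁻¹ := inv_anti₀ hsN hsn
  set c : ℕ → ℂ := fun k => ((Real.sqrt n)⁻¹ : ℝ) * m (k / n) -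
    if k ≤ N then ((Real.sqrt N)⁻¹ : ℝ) * m (k / N) else 0 with hc
  have hdiff : ∀ x, trigSum a b n (trigWeight m n x) - trigSum a b N (trigWeight m N x) =
      trigSum a b n fun k => c k * Complex.exp (Complex.I * (k * x : ℝ)) := by
    intro x
    have e : trigSum a b N (trigWeight m N x) =
        trigSum a b n fun k => if k ≤ N then trigWeight m N x k else 0 := by
      unfold trigSum
      refine (Finset.sum_congr rfl fun k hk => ?_).trans (Finset.sum_subset
        (Finset.Icc_subset_Icc_right hNn) fun k hk hk' => ?_)
      · simp only [if_pos (Finset.mem_Icc.1 hk).2]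
      · simp only [if_neg (fun h => hk' (Finset.mem_Icc.2 ⟨(Finset.mem_Icc.1 hk).1, h⟩)),
          Complex.zero_re, Complex.zero_im, mul_zero, add_zero]
    rw [e, trigSum_sub]
    congr 1
    ext k
    simp only [hc, trigWeight]
    split_ifs <;> ring
  have hcont1 := continuous_trigSum_trigWeight m a b n n
  have hcont2 := continuous_trigSum_trigWeight m a b N N
  have hexp : ∀ {f : ℝ → ℝ}, Continuous f → Continuous fun x => Complex.exp (f x * Complex.I) :=
    fun hf => Complex.continuous_exp.comp ((Complex.continuous_ofReal.comp hf).mul continuous_const)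
  have h1 : ‖quenchedChar m a b n - quenchedChar m a b N‖ ≤
      ∫ x, |trigSum a b n (trigWeight m n x) - trigSum a b N (trigWeight m N x)| ∂uniformMeasure := by
    unfold quenchedChar
    rw [← integral_sub (integrable_uniformMeasure_of_continuous (hexp hcont1))
      (integrable_uniformMeasure_of_continuous (hexp hcont2))]
    exact norm_integral_le_of_norm_le
      (integrable_uniformMeasure_of_continuous (hcont1.sub hcont2).abs)
      (Eventually.of_forall fun x => norm_exp_mul_I_sub_le _ _)
  have h2 := sq_integral_abs_le (integrable_uniformMeasure_of_continuous (hcont1.sub hcont2))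
    (integrable_uniformMeasure_of_continuous ((hcont1.sub hcont2).pow 2))
  have h3 := integral_sq_trigSum_le a b n c
  simp_rw [← hdiff] at h3
  refine (pow_le_pow_left₀ (norm_nonneg _) h1 2).trans (h2.trans (h3.trans ?_))
  have hsplit : Finset.Icc 1 n = Finset.Icc 1 N ∪ Finset.Ioc N n := by
    ext k
    simp only [Finset.mem_union, Finset.mem_Icc, Finset.mem_Ioc]
    omega
  have hdisj : Disjoint (Finset.Icc 1 N) (Finset.Ioc N n) := by
    refine Finset.disjoint_left.2 fun k h1 h2 => ?_
    simp only [Finset.mem_Icc, Finset.mem_Ioc] at h1 h2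
    omega
  have hsqN : ((Real.sqrt N)⁻¹) ^ 2 = (N : ℝ)⁻¹ := by rw [inv_pow, Real.sq_sqrt hN'.le]
  have hd0 : (0 : ℝ) ≤ (n - N) / N := div_nonneg (sub_nonneg.2 hNn') hN'.le
  have hc1 : ∀ k ∈ Finset.Icc 1 N, ‖c k‖ ≤ 2 * K * ((n - N) / N) * (Real.sqrt N)⁻¹ := by
    intro k hk
    have hkN : (k : ℝ) ≤ N := by exact_mod_cast (Finset.mem_Icc.1 hk).2
    have hk0 : (0 : ℝ) ≤ k := Nat.cast_nonneg k
    simp only [hc, if_pos (Finset.mem_Icc.1 hk).2]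
    have e : ((Real.sqrt n)⁻¹ : ℝ) * m (k / n) - ((Real.sqrt N)⁻¹ : ℝ) * m (k / N) =
        (((Real.sqrt n)⁻¹ - (Real.sqrt N)⁻¹ : ℝ) : ℂ) * m (k / n) +
          ((Real.sqrt N)⁻¹ : ℝ) * (m (k / n) - m (k / N)) := by
      push_cast
      ring
    have hs1 : (Real.sqrt N)⁻¹ - (Real.sqrt n)⁻¹ ≤ ((n - N) / N) * (Real.sqrt N)⁻¹ := by
      have h4 : (N : ℝ) / n * (Real.sqrt N)⁻¹ ≤ (Real.sqrt n)⁻¹ := by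
        rw [div_mul_eq_mul_div, div_le_iff₀ hn', inv_mul_eq_div, ← div_eq_mul_inv]
        rw [Real.div_sqrt, Real.div_sqrt]
        exact hsn
      have h5 : 1 - (N : ℝ) / n ≤ (n - N) / N := by
        rw [one_sub_div hn'.ne']
        exact div_le_div_of_nonneg_left (sub_nonneg.2 hNn') hN' hNn'
      have h6 := mul_le_mul_of_nonneg_right h5 (inv_pos.2 hsN).le
      linarith [sub_mul 1 ((N : ℝ) / n) (Real.sqrt N)⁻¹]
    have hs2 : |(k : ℝ) / n - k / N| ≤ (n - N) / N := by
      rw [abs_sub_comm, abs_of_nonneg (sub_nonneg.2 (div_le_div_of_nonneg_left hk0 hN' hNn')),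
        div_sub_div _ _ hN'.ne' hn'.ne', div_le_div_iff₀ (by positivity) hN']
      have : (k : ℝ) * (n - N) * N ≤ n * (n - N) * N := by
        have := sub_nonneg.2 hNn'
        gcongr
        exact_mod_cast hkN.trans hNn'
      nlinarith
    rw [e]
    refine (norm_add_le _ _).trans ?_
    rw [norm_mul, norm_mul, Complex.norm_real, Complex.norm_real, Real.norm_eq_abs, abs_sub_comm,
      abs_of_nonneg (sub_nonneg.2 hsinv), Real.norm_of_nonneg (inv_pos.2 hsN).le]
    have h7 : ((Real.sqrt N)⁻¹ - (Real.sqrt n)⁻¹) * ‖m (k / n)‖ ≤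
        ((n - N) / N) * (Real.sqrt N)⁻¹ * K :=
      mul_le_mul hs1 (hm.bound _) (norm_nonneg _) (mul_nonneg hd0 (inv_pos.2 hsN).le)
    have h8 : (Real.sqrt N)⁻¹ * ‖m (k / n) - m (k / N)‖ ≤
        (Real.sqrt N)⁻¹ * (K * ((n - N) / N)) := by
      gcongr
      exact (hm.lipschitz _ _).trans (mul_le_mul_of_nonneg_left hs2 hK)
    linarith
  have hc2 : ∀ k ∈ Finset.Ioc N n, ‖c k‖ ≤ K * (Real.sqrt N)⁻¹ := by
    intro k hk
    simp only [hc, if_neg (not_le.2 (Finset.mem_Ioc.1 hk).1), sub_zero]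
    rw [norm_mul, Complex.norm_real, Real.norm_of_nonneg (by positivity), mul_comm K]
    exact mul_le_mul hsinv (hm.bound _) (norm_nonneg _) (inv_pos.2 hsN).le
  rw [hsplit, Finset.sum_union hdisj]
  refine add_le_add ?_ ?_
  · have e : 4 * K ^ 2 * ((n - N) / N) ^ 2 * ((∑ k ∈ Finset.Icc 1 N, (a k ^ 2 + b k ^ 2)) / N) =
        ∑ k ∈ Finset.Icc 1 N, (a k ^ 2 + b k ^ 2) *
          (2 * K * ((n - N) / N) * (Real.sqrt N)⁻¹) ^ 2 := by
      rw [← Finset.sum_mul, mul_pow _ (Real.sqrt N)⁻¹, hsqN]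
      ring
    rw [e]
    refine Finset.sum_le_sum fun k hk => ?_
    gcongr
    exact hc1 k hk
  · have e : K ^ 2 * ((∑ k ∈ Finset.Ioc N n, (a k ^ 2 + b k ^ 2)) / N) =
        ∑ k ∈ Finset.Ioc N n, (a k ^ 2 + b k ^ 2) * (K * (Real.sqrt N)⁻¹) ^ 2 := by
      rw [← Finset.sum_mul, mul_pow _ (Real.sqrt N)⁻¹, hsqN]
      ring
    rw [e]
    refine Finset.sum_le_sum fun k hk => ?_
    gcongr
    exact hc2 k hk

/-- The integer part of the fourth root. -/
def fourthRoot (n : ℕ) : ℕ := Nat.sqrt (Nat.sqrt n)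

lemma fourthRoot_pow_le (n : ℕ) : fourthRoot n ^ 4 ≤ n := by
  calc fourthRoot n ^ 4 = (fourthRoot n ^ 2) ^ 2 := by ring
    _ ≤ Nat.sqrt n ^ 2 := Nat.pow_le_pow_left (Nat.sqrt_le' _) 2
    _ ≤ n := Nat.sqrt_le' n

lemma lt_fourthRoot_succ_pow (n : ℕ) : n < (fourthRoot n + 1) ^ 4 := by
  have h1 : n < (Nat.sqrt n + 1) ^ 2 := Nat.lt_succ_sqrt' n
  have h2 : Nat.sqrt n < (fourthRoot n + 1) ^ 2 := Nat.lt_succ_sqrt' _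
  calc n < (Nat.sqrt n + 1) ^ 2 := h1
    _ ≤ ((fourthRoot n + 1) ^ 2) ^ 2 := Nat.pow_le_pow_left h2 2
    _ = _ := by ring

lemma tendsto_fourthRoot : Tendsto fourthRoot atTop atTop := by
  refine tendsto_atTop.2 fun k => ?_
  filter_upwards [eventually_ge_atTop (k ^ 4)] with n hn
  unfold fourthRoot
  rw [Nat.le_sqrt', Nat.le_sqrt', ← pow_mul]
  exact hn

lemma succ_pow_four_sub_le {j : ℕ} (hj : 1 ≤ j) : (j + 1) ^ 4 ≤ j ^ 4 + 15 * j ^ 3 := by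
  obtain ⟨i, rfl⟩ := Nat.exists_eq_add_of_le' hj
  ring_nf
  nlinarith [Nat.zero_le i, sq_nonneg i]

lemma tendsto_quenchedChar_of_tendsto_pow_four {m : ℝ → ℂ} {K : ℝ} (hm : IsBoundedLipschitz m K)
    {a b : ℕ → ℝ} {C : ℝ} (hS : ∀ n : ℕ, ∑ k ∈ Finset.Icc 1 n, (a k ^ 2 + b k ^ 2) ≤ C * n)
    (hT : Tendsto (fun j : ℕ => (∑ k ∈ Finset.Ioc (j ^ 4) ((j + 1) ^ 4), (a k ^ 2 + b k ^ 2)) /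
      (j : ℝ) ^ 4) atTop (𝓝 0)) {L : ℂ}
    (hL : Tendsto (fun j : ℕ => quenchedChar m a b (j ^ 4)) atTop (𝓝 L)) :
    Tendsto (fun n => quenchedChar m a b n) atTop (𝓝 L) := by
  have hbound : Tendsto (fun j : ℕ => 4 * K ^ 2 * (15 / (j : ℝ)) ^ 2 * C + K ^ 2 *
      ((∑ k ∈ Finset.Ioc (j ^ 4) ((j + 1) ^ 4), (a k ^ 2 + b k ^ 2)) / (j : ℝ) ^ 4)) atTop (𝓝 0) := by
    have h1 : Tendsto (fun j : ℕ => 15 / (j : ℝ)) atTop (𝓝 0) :=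
      tendsto_const_div_atTop_nhds_zero_nat 15
    have := (((h1.pow 2).const_mul (4 * K ^ 2)).mul_const C).add (hT.const_mul (K ^ 2))
    simpa using this
  have hC0 : 0 ≤ C := by
    have := hS 1
    have h0 : 0 ≤ ∑ k ∈ Finset.Icc 1 1, (a k ^ 2 + b k ^ 2) :=
      Finset.sum_nonneg fun _ _ => by positivity
    simp only [Nat.cast_one, mul_one] at this
    linarith
  have hsq : Tendsto (fun n => ‖quenchedChar m a b n - quenchedChar m a b (fourthRoot n ^ 4)‖ ^ 2)
      atTop (𝓝 0) := by
    refine squeeze_zero' (Eventually.of_forall fun _ => by positivity) ?_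
      (hbound.comp tendsto_fourthRoot)
    filter_upwards [tendsto_fourthRoot.eventually_ge_atTop 1] with n hn
    simp only [Function.comp_apply]
    set j := fourthRoot n with hj
    have hj0 : (0 : ℝ) < j := by exact_mod_cast hn
    have hle : j ^ 4 ≤ n := fourthRoot_pow_le n
    have hlt : n < (j + 1) ^ 4 := lt_fourthRoot_succ_pow n
    refine (norm_quenchedChar_sub_sq_le hm a b (pow_pos hn 4) hle).trans ?_
    have hle' : ((j ^ 4 : ℕ) : ℝ) ≤ n := by exact_mod_cast hle
    have hdiff : ((n : ℝ) - (j ^ 4 : ℕ)) / (j ^ 4 : ℕ) ≤ 15 / j := by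
      have h3 : (n : ℝ) ≤ j ^ 4 + 15 * j ^ 3 := by
        exact_mod_cast hlt.le.trans (succ_pow_four_sub_le hn)
      push_cast
      rw [div_le_div_iff₀ (by positivity) hj0]
      nlinarith
    refine add_le_add ?_ ?_
    · have h4 : (∑ k ∈ Finset.Icc 1 (j ^ 4), (a k ^ 2 + b k ^ 2)) / ((j ^ 4 : ℕ) : ℝ) ≤ C := by
        rw [div_le_iff₀ (by positivity)]
        exact hS _
      have h5 : 0 ≤ ((n : ℝ) - (j ^ 4 : ℕ)) / (j ^ 4 : ℕ) :=
        div_nonneg (sub_nonneg.2 hle') (by positivity)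
      gcongr
    · push_cast
      gcongr
  have h0 : Tendsto (fun n => quenchedChar m a b n - quenchedChar m a b (fourthRoot n ^ 4))
      atTop (𝓝 0) := by
    rw [tendsto_zero_iff_norm_tendsto_zero]
    simpa [Real.sqrt_sq (norm_nonneg _)] using hsq.sqrt
  simpa using h0.add (hL.comp tendsto_fourthRoot)

lemma IsStationaryGaussianSeq.ae_tendsto_blockSum {Ω : Type*} [MeasurableSpace Ω]
    {a : ℕ → Ω → ℝ} {ρ : ℕ → ℝ} {P : Measure Ω} (ha : IsStationaryGaussianSeq a ρ P) :
    ∀ᵐ ω ∂P, Tendsto (fun j : ℕ => (∑ k ∈ Finset.Ioc (j ^ 4) ((j + 1) ^ 4), a k ω ^ 2) /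
      (j : ℝ) ^ 4) atTop (𝓝 0) := by
  set M := ∫ x, x ^ 4 ∂(gaussianReal 0 1) with hM
  set L : ℕ → ℝ := fun j => ((Finset.Ioc (j ^ 4) ((j + 1) ^ 4)).card : ℝ) with hL
  have hM0 : 0 ≤ M := integral_nonneg fun x => by positivity
  have hk : ∀ {j k : ℕ}, k ∈ Finset.Ioc (j ^ 4) ((j + 1) ^ 4) → 1 ≤ k := fun h =>
    (Nat.zero_le _).trans_lt (Finset.mem_Ioc.1 h).1
  have hdom : ∀ j, Integrable (fun ω => L j / ((j : ℝ) ^ 4) ^ 2 *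
      ∑ k ∈ Finset.Ioc (j ^ 4) ((j + 1) ^ 4), a k ω ^ 4) P := fun j =>
    (integrable_finsetSum _ fun k h => (ha.integrable_pow (hk h) 4).1).const_mul _
  have hle : ∀ (j : ℕ) ω, ((∑ k ∈ Finset.Ioc (j ^ 4) ((j + 1) ^ 4), a k ω ^ 2) / (j : ℝ) ^ 4) ^ 2 ≤
      L j / ((j : ℝ) ^ 4) ^ 2 * ∑ k ∈ Finset.Ioc (j ^ 4) ((j + 1) ^ 4), a k ω ^ 4 := by
    intro j ω
    have h := sq_sum_le_card_mul_sum_sq (s := Finset.Ioc (j ^ 4) ((j + 1) ^ 4))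
      (f := fun k => a k ω ^ 2)
    simp only [← pow_mul] at h
    norm_num at h
    rw [div_pow, div_mul_eq_mul_div]
    gcongr
    simpa [hL] using h
  have hint : ∀ j : ℕ, Integrable (fun ω =>
      ((∑ k ∈ Finset.Ioc (j ^ 4) ((j + 1) ^ 4), a k ω ^ 2) / (j : ℝ) ^ 4) ^ 2) P := by
    intro j
    refine (hdom j).mono' ?_ (Eventually.of_forall fun ω => ?_)
    · refine (((Finset.aemeasurable_fun_sum _ fun k h => ?_).div_const _).pow_const 2).aestronglyMeasurable
      exact (ha.aemeasurable (hk h)).pow_const 2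
    · rw [Real.norm_of_nonneg (by positivity)]
      exact hle j ω
  have key := ae_tendsto_zero_of_summable_integral (P := P) (fun _ _ => by positivity) hint ?_
  · filter_upwards [key] with ω hω
    have := hω.sqrt
    rw [Real.sqrt_zero] at this
    refine this.congr fun j => Real.sqrt_sq ?_
    positivity
  · refine Summable.of_nonneg_of_le (fun j => integral_nonneg fun _ => by positivity)
      (f := fun j : ℕ => 225 * M * (1 / (j : ℝ) ^ 2)) (fun j => ?_)
      ((Real.summable_one_div_nat_pow.2 one_lt_two).mul_left _)
    refine (integral_mono (hint j) (hdom j) (hle j)).trans ?_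
    rw [integral_const_mul, integral_finsetSum _ fun k h => (ha.integrable_pow (hk h) 4).1,
      Finset.sum_congr rfl fun k h => (ha.integrable_pow (hk h) 4).2, Finset.sum_const, ← hM,
      nsmul_eq_mul]
    rcases Nat.eq_zero_or_pos j with rfl | hj
    · simp
    · have hj0 : (0 : ℝ) < j := by exact_mod_cast hj
      have hLj : L j ≤ 15 * (j : ℝ) ^ 3 := by
        simp only [hL, Nat.card_Ioc]
        have := succ_pow_four_sub_le hj
        exact_mod_cast (by omega : (j + 1) ^ 4 - j ^ 4 ≤ 15 * j ^ 3)
      have hL0 : 0 ≤ L j := Nat.cast_nonneg _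
      calc L j / ((j : ℝ) ^ 4) ^ 2 * (L j * M) = L j ^ 2 * M / ((j : ℝ) ^ 4) ^ 2 := by ring
        _ ≤ (15 * (j : ℝ) ^ 3) ^ 2 * M / ((j : ℝ) ^ 4) ^ 2 := by gcongr
        _ = 225 * M * (1 / (j : ℝ) ^ 2) := by field_simp; ring

lemma IsBoundedLipschitz.ae_tendsto_energy {m : ℝ → ℂ} {K σ : ℝ} (hm : IsBoundedLipschitz m K)
    (hσ : Tendsto (fun n : ℕ => (∑ k ∈ Finset.Icc 1 n, ‖m (k / n)‖ ^ 2) / n) atTop (𝓝 σ))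
    (μ : Measure ℝ) [IsFiniteMeasure μ] (hμ : μ (Set.Icc (-Real.pi) Real.pi)ᶜ = 0) :
    ∀ᵐ x, Tendsto (fun n : ℕ => energy μ n (trigWeight m n x)) atTop
      (𝓝 (2 * Real.pi * σ * spectralDensity μ x)) := by
  have h := hm.ae_tendsto_integral hσ μ hμ
  have h1 : ∀ k : ℤ, ∀ᵐ x : ℝ, |x - k • (2 * Real.pi)| < Real.pi →
      Tendsto (fun n : ℕ => ∫ u, ‖trigKernel m n (x - k • (2 * Real.pi) - u)‖ ^ 2 / n ∂μ) atTop
        (𝓝 (2 * Real.pi * σ * (μ.rnDeriv volume (x - k • (2 * Real.pi))).toReal)) := fun k =>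
    (measurePreserving_sub_right volume (k • (2 * Real.pi))).quasiMeasurePreserving.ae h
  have h2 : ∀ k : ℤ, ∀ᵐ x : ℝ, x ≠ Real.pi + k • (2 * Real.pi) := fun k => by
    rw [ae_iff]
    simp
  filter_upwards [ae_all_iff.2 h1, ae_all_iff.2 h2] with x hx1 hx2
  set k := toIocDiv Real.two_pi_pos (-Real.pi) x with hk
  have hmod : toIocMod Real.two_pi_pos (-Real.pi) x = x - k • (2 * Real.pi) := rfl
  have hmem := toIocMod_mem_Ioc Real.two_pi_pos (-Real.pi) x
  rw [hmod] at hmem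
  have hne : x - k • (2 * Real.pi) ≠ Real.pi := fun hh => hx2 k (by linarith)
  have hlt : x - k • (2 * Real.pi) < Real.pi := lt_of_le_of_ne (by linarith [hmem.2]) hne
  have h3 := hx1 k (abs_lt.2 ⟨hmem.1, hlt⟩)
  rw [← hmod] at h3
  refine h3.congr fun n => ?_
  rw [energy_trigWeight]
  refine integral_congr_ae (Eventually.of_forall fun u => ?_)
  have : trigKernel m n (x - k • (2 * Real.pi) - u) = trigKernel m n (x - u) := by
    rw [sub_right_comm]
    exact (periodic_trigKernel m n).sub_zsmul_eq k
  simp only [hmod, this]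

lemma IsBoundedLipschitz.tendsto_annealedChar {m : ℝ → ℂ} {K σ : ℝ} (hm : IsBoundedLipschitz m K)
    (hσ : Tendsto (fun n : ℕ => (∑ k ∈ Finset.Icc 1 n, ‖m (k / n)‖ ^ 2) / n) atTop (𝓝 σ))
    (μ : Measure ℝ) [IsFiniteMeasure μ] (hμ : μ (Set.Icc (-Real.pi) Real.pi)ᶜ = 0) :
    Tendsto (annealedChar m μ) atTop
      (𝓝 (∫ x, Real.exp (-(Real.pi * σ * spectralDensity μ x)) ∂uniformMeasure)) := by
  refine tendsto_integral_of_dominated_convergence (fun _ => 1) (fun n => ?_) (integrable_const _)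
    (fun n => Eventually.of_forall fun x => ?_) ?_
  · exact (Real.continuous_exp.comp
      ((continuous_energy_trigWeight hm μ n).div_const 2).neg).aestronglyMeasurable
  · rw [Real.norm_of_nonneg (Real.exp_nonneg _), Real.exp_le_one_iff]
    have := energy_nonneg μ n (trigWeight m n x)
    linarith
  · filter_upwards [uniformMeasure_absolutelyContinuous.ae_le (hm.ae_tendsto_energy hσ μ hμ)] with x hx
    have e : Real.pi * σ * spectralDensity μ x = 2 * Real.pi * σ * spectralDensity μ x / 2 := by ring
    rw [e]
    exact (Real.continuous_exp.tendsto _).comp (hx.div_const 2).neg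

/-- Quenched convergence of the characteristic functions. -/
lemma IsCoefficientModel.ae_tendsto_quenchedChar {Ω : Type*} [MeasurableSpace Ω]
    {a b : ℕ → Ω → ℝ} {ρ : ℕ → ℝ} {μ : Measure ℝ} {P : Measure Ω}
    (h : IsCoefficientModel a b ρ μ P) {m : ℝ → ℂ} {K σ : ℝ} (hm : IsBoundedLipschitz m K)
    (hσ : Tendsto (fun n : ℕ => (∑ k ∈ Finset.Icc 1 n, ‖m (k / n)‖ ^ 2) / n) atTop (𝓝 σ)) :
    ∀ᵐ ω ∂P, Tendsto (fun n => quenchedChar m (fun k => a k ω) (fun k => b k ω) n) atTop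
      (𝓝 ((∫ x, Real.exp (-(Real.pi * σ * spectralDensity μ x)) ∂uniformMeasure : ℝ) : ℂ)) := by
  have := h.spectral.prob
  filter_upwards [h.ae_tendsto_quenchedChar_sub hm, h.left.ae_exists_sum_sq_le h.measurable_left,
    h.right.ae_exists_sum_sq_le h.measurable_right, h.left.ae_tendsto_blockSum,
    h.right.ae_tendsto_blockSum] with ω h1 ⟨C, hC⟩ ⟨C', hC'⟩ h4 h5
  refine tendsto_quenchedChar_of_tendsto_pow_four hm (C := C + C') (fun n => ?_) ?_ ?_
  · rw [Finset.sum_add_distrib, add_mul]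
    exact add_le_add (hC n) (hC' n)
  · have := h4.add h5
    simp only [add_zero, ← add_div, ← Finset.sum_add_distrib] at this
    exact this
  · have h6 : Tendsto (fun j : ℕ => j ^ 4) atTop atTop := tendsto_pow_atTop (by norm_num)
    have h7 := ((Complex.continuous_ofReal.tendsto _).comp
      (hm.tendsto_annealedChar hσ μ h.spectral.carried)).comp h6
    simpa using h1.add h7

/-! ### Symbols of finite combinations of time evaluations -/

/-- The symbol `v ↦ ∑ c_i e^{ivt_i}` of the functional `g ↦ ∑ c_i g(t_i)`. -/
def timeSymbol {ι : Type*} (s : Finset ι) (c t : ι → ℝ) (v : ℝ) : ℂ :=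
  ∑ i ∈ s, c i * Complex.exp (Complex.I * (v * t i : ℝ))

/-- The variance of `∑ c_i N_{t_i}` for a process with covariance `sinc (s - t)`. -/
def sincForm {ι : Type*} (s : Finset ι) (c t : ι → ℝ) : ℝ :=
  ∑ i ∈ s, ∑ j ∈ s, c i * c j * Real.sinc (t i - t j)

section TimeSymbol

variable {ι : Type*} (s : Finset ι) (c t : ι → ℝ)

lemma isBoundedLipschitz_timeSymbol :
    IsBoundedLipschitz (timeSymbol s c t) (∑ i ∈ s, |c i| * (1 + |t i|)) where
  bound v := by
    refine (norm_sum_le _ _).trans (Finset.sum_le_sum fun i _ => ?_)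
    rw [norm_mul, Complex.norm_exp_I_mul_ofReal, Complex.norm_real, Real.norm_eq_abs]
    gcongr
    linarith [abs_nonneg (t i)]
  lipschitz u v := by
    unfold timeSymbol
    rw [← Finset.sum_sub_distrib, Finset.sum_mul]
    refine (norm_sum_le _ _).trans (Finset.sum_le_sum fun i _ => ?_)
    rw [← mul_sub, norm_mul, Complex.norm_real, Real.norm_eq_abs, mul_assoc]
    gcongr
    rw [mul_comm Complex.I, mul_comm Complex.I]
    refine (norm_exp_mul_I_sub_le _ _).trans ?_
    rw [← sub_mul, abs_mul, mul_comm]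
    gcongr
    linarith [abs_nonneg (t i)]

lemma trigSum_trigWeight_timeSymbol (a b : ℕ → ℝ) (n : ℕ) (x : ℝ) :
    trigSum a b n (trigWeight (timeSymbol s c t) n x) =
      ∑ i ∈ s, c i * trigPoly a b n (x + t i / n) := by
  have h : ∀ i, c i * trigPoly a b n (x + t i / n) = ∑ k ∈ Finset.Icc 1 n, c i *
      (a k * (trigWeight (fun v => Complex.exp (Complex.I * (v * t i : ℝ))) n x k).re +
        b k * (trigWeight (fun v => Complex.exp (Complex.I * (v * t i : ℝ))) n x k).im) := by
    intro i
    rw [← localDeriv_zero, localDeriv, trigSum, Finset.mul_sum]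
    simp only [pow_zero, one_mul]
  simp_rw [h]
  rw [Finset.sum_comm]
  unfold trigSum
  refine Finset.sum_congr rfl fun k _ => ?_
  have e : trigWeight (timeSymbol s c t) n x k = ∑ i ∈ s,
      (c i : ℂ) * trigWeight (fun v => Complex.exp (Complex.I * (v * t i : ℝ))) n x k := by
    unfold trigWeight timeSymbol
    rw [Finset.mul_sum, Finset.sum_mul]
    exact Finset.sum_congr rfl fun i _ => by ring
  rw [e, Complex.re_sum, Complex.im_sum, Finset.mul_sum, Finset.mul_sum, ← Finset.sum_add_distrib]
  refine Finset.sum_congr rfl fun i _ => ?_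
  rw [Complex.re_ofReal_mul, Complex.im_ofReal_mul]
  ring

lemma norm_timeSymbol_sq (v : ℝ) :
    ‖timeSymbol s c t v‖ ^ 2 = ∑ i ∈ s, ∑ j ∈ s, c i * c j * Real.cos (v * (t i - t j)) := by
  have h : ((‖timeSymbol s c t v‖ ^ 2 : ℝ) : ℂ) = ∑ i ∈ s, ∑ j ∈ s, (c i * c j : ℝ) *
      Complex.exp ((v * (t i - t j) : ℝ) * Complex.I) := by
    rw [← Complex.normSq_eq_norm_sq, Complex.normSq_eq_conj_mul_self, mul_comm]
    unfold timeSymbol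
    rw [map_sum, Finset.sum_mul_sum]
    refine Finset.sum_congr rfl fun i _ => Finset.sum_congr rfl fun j _ => ?_
    rw [map_mul, ← Complex.exp_conj, map_mul, Complex.conj_I, Complex.conj_ofReal,
      Complex.conj_ofReal, mul_mul_mul_comm, ← Complex.exp_add, ← Complex.ofReal_mul]
    congr 2
    push_cast
    ring
  have h2 := congrArg Complex.re h
  rw [Complex.ofReal_re, Complex.re_sum] at h2
  rw [h2]
  refine Finset.sum_congr rfl fun i _ => ?_
  rw [Complex.re_sum]
  refine Finset.sum_congr rfl fun j _ => ?_
  rw [Complex.re_ofReal_mul, Complex.exp_ofReal_mul_I_re]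

end TimeSymbol

lemma two_mul_sin_mul_sum_cos (n : ℕ) (θ : ℝ) :
    2 * Real.sin (θ / 2) * ∑ k ∈ Finset.Icc 1 n, Real.cos (k * θ) =
      Real.sin (n * θ + θ / 2) - Real.sin (θ / 2) := by
  induction n with
  | zero => simp
  | succ n ih =>
    rw [Finset.sum_Icc_succ_top (by omega), mul_add, ih]
    have h1 : Real.sin (((n + 1 : ℕ) : ℝ) * θ + θ / 2) - Real.sin (n * θ + θ / 2) =
        2 * Real.sin (θ / 2) * Real.cos (((n + 1 : ℕ) : ℝ) * θ) := by
      have e : (n : ℝ) * θ + θ / 2 = ((n + 1 : ℕ) : ℝ) * θ - θ / 2 := by push_cast; ring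
      rw [e, Real.sin_add, Real.sin_sub]
      ring
    linarith

lemma tendsto_mean_cos (τ : ℝ) :
    Tendsto (fun n : ℕ => (∑ k ∈ Finset.Icc 1 n, Real.cos (k / n * τ)) / n) atTop
      (𝓝 (Real.sinc τ)) := by
  rcases eq_or_ne τ 0 with rfl | hτ
  · rw [Real.sinc_zero]
    refine tendsto_const_nhds.congr' ?_
    filter_upwards [eventually_gt_atTop 0] with n hn
    have : (n : ℝ) ≠ 0 := by exact_mod_cast hn.ne'
    simp [this]
  · have h0 : Tendsto (fun n : ℕ => τ / n / 2) atTop (𝓝 0) := by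
      simpa using (tendsto_const_div_atTop_nhds_zero_nat τ).div_const 2
    have hs : Tendsto (fun n : ℕ => τ * Real.sinc (τ / n / 2)) atTop (𝓝 τ) := by
      have := (Real.continuous_sinc.tendsto 0).comp h0
      simpa [Function.comp_def] using this.const_mul τ
    have hnum : Tendsto (fun n : ℕ => Real.sin (τ + τ / n / 2) - Real.sin (τ / n / 2)) atTop
        (𝓝 (Real.sin τ)) := by
      have h1 := (Real.continuous_sin.tendsto (τ + 0)).comp (h0.const_add τ)
      have h2 := (Real.continuous_sin.tendsto 0).comp h0
      simpa [Function.comp_def] using h1.sub h2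
    have h := hnum.div hs hτ
    rw [← Real.sinc_of_ne_zero hτ] at h
    refine h.congr' ?_
    filter_upwards [eventually_gt_atTop 0, hs.eventually_ne hτ] with n hn hne
    have hn' : (n : ℝ) ≠ 0 := by exact_mod_cast hn.ne'
    have hx : τ / n / 2 ≠ 0 := div_ne_zero (div_ne_zero hτ hn') two_ne_zero
    have key := two_mul_sin_mul_sum_cos n (τ / n)
    have e1 : ∀ k : ℕ, (k : ℝ) / n * τ = k * (τ / n) := fun k => by ring
    have e2 : (n : ℝ) * (τ / n) = τ := by field_simp
    have e3 : τ * Real.sinc (τ / n / 2) = 2 * Real.sin (τ / n / 2) * n := by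
      rw [Real.sinc_of_ne_zero hx]
      field_simp
    simp only [Pi.div_apply]
    simp_rw [e1]
    rw [e2] at key
    rw [← key, e3]
    rw [e3] at hne
    rw [mul_div_mul_left _ _ (left_ne_zero_of_mul hne)]

lemma tendsto_mean_norm_timeSymbol_sq {ι : Type*} (s : Finset ι) (c t : ι → ℝ) :
    Tendsto (fun n : ℕ => (∑ k ∈ Finset.Icc 1 n, ‖timeSymbol s c t (k / n)‖ ^ 2) / n) atTop
      (𝓝 (sincForm s c t)) := by
  have h : Tendsto (fun n : ℕ => ∑ i ∈ s, ∑ j ∈ s, c i * c j *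
      ((∑ k ∈ Finset.Icc 1 n, Real.cos (k / n * (t i - t j))) / n)) atTop (𝓝 (sincForm s c t)) :=
    tendsto_finsetSum _ fun i _ => tendsto_finsetSum _ fun j _ =>
      (tendsto_mean_cos (t i - t j)).const_mul _
  refine h.congr fun n => ?_
  simp_rw [norm_timeSymbol_sq, ← mul_div_assoc, ← Finset.sum_div, Finset.mul_sum]
  congr 1
  rw [Finset.sum_comm (s := Finset.Icc 1 n)]
  exact Finset.sum_congr rfl fun i _ => Finset.sum_comm

/-! ### Tightness for given coefficients -/

lemma localDeriv_eq (a b : ℕ → ℝ) (n j : ℕ) (x t : ℝ) : localDeriv a b n j x t =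
    trigSum a b n fun k => (((Real.sqrt n)⁻¹ : ℝ) * ((Complex.I * (k / n : ℝ)) ^ j *
      Complex.exp (Complex.I * (k / n * t : ℝ)))) * Complex.exp (Complex.I * (k * x : ℝ)) := by
  unfold localDeriv
  congr 1

lemma norm_localDeriv_weight_sq_le {n k : ℕ} (hk : k ≤ n) (j : ℕ) (t : ℝ) :
    ‖(((Real.sqrt n)⁻¹ : ℝ) * ((Complex.I * (k / n : ℝ)) ^ j *
      Complex.exp (Complex.I * (k / n * t : ℝ))) : ℂ)‖ ^ 2 ≤ (n : ℝ)⁻¹ := by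
  have hkn : (k : ℝ) / n ≤ 1 := div_le_one_of_le₀ (by exact_mod_cast hk) (Nat.cast_nonneg n)
  have hkn0 : (0 : ℝ) ≤ k / n := by positivity
  rw [norm_mul, norm_mul, norm_pow, norm_mul, Complex.norm_I, one_mul,
    Complex.norm_exp_I_mul_ofReal, mul_one, Complex.norm_real, Complex.norm_real,
    Real.norm_of_nonneg hkn0, Real.norm_of_nonneg (by positivity), mul_pow, inv_pow,
    Real.sq_sqrt (Nat.cast_nonneg n)]
  refine mul_le_of_le_one_right (by positivity) ?_
  exact pow_le_one₀ (by positivity) (pow_le_one₀ hkn0 hkn)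

lemma isTightMeasureSet_uniformMeasure_map {a b : ℕ → ℝ} {C : ℝ}
    (hS : ∀ n : ℕ, ∑ k ∈ Finset.Icc 1 n, (a k ^ 2 + b k ^ 2) ≤ C * n) :
    IsTightMeasureSet {ν | ∃ n : ℕ, uniformMeasure.map (fun x => localizedPath a b n x) = ν} := by
  have hC0 : 0 ≤ C := by
    have := hS 1
    have h0 : 0 ≤ ∑ k ∈ Finset.Icc 1 1, (a k ^ 2 + b k ^ 2) :=
      Finset.sum_nonneg fun _ _ => by positivity
    simp only [Nat.cast_one, mul_one] at this
    linarith
  refine isTightMeasureSet_localizedPath (fun _ : ℕ => uniformMeasure) (fun _ _ => a)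
    (fun _ _ => b) (fun _ x => x) (fun n => n) (fun _ _ => continuous_const)
    (fun _ _ => continuous_const) (fun _ => continuous_id) (1 + C) (by positivity) fun n j t => ?_
  have hcont : Continuous fun x => localDeriv a b n j x t := by
    unfold localDeriv
    exact continuous_trigSum_trigWeight _ a b n n
  rw [← ofReal_integral_eq_lintegral_ofReal
    (integrable_uniformMeasure_of_continuous hcont.abs) (Eventually.of_forall fun _ => abs_nonneg _)]
  refine ENNReal.ofReal_le_ofReal ?_
  have h1 : ∫ x, |localDeriv a b n j x t| ∂uniformMeasure ≤
      ∫ x, (1 + localDeriv a b n j x t ^ 2) ∂uniformMeasure := by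
    refine integral_mono (integrable_uniformMeasure_of_continuous hcont.abs)
      (integrable_uniformMeasure_of_continuous (continuous_const.add (hcont.pow 2))) fun x => ?_
    have := sq_nonneg (|localDeriv a b n j x t| - 1)
    simp only
    nlinarith [sq_abs (localDeriv a b n j x t), abs_nonneg (localDeriv a b n j x t)]
  refine h1.trans ?_
  have hi2 : Integrable (fun x => localDeriv a b n j x t ^ 2) uniformMeasure :=
    integrable_uniformMeasure_of_continuous (hcont.pow 2)
  rw [integral_add (integrable_const _) hi2]
  simp only [integral_const, probReal_univ, smul_eq_mul, mul_one]
  gcongr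
  simp_rw [localDeriv_eq]
  refine (integral_sq_trigSum_le a b n _).trans ?_
  calc _ ≤ ∑ k ∈ Finset.Icc 1 n, (a k ^ 2 + b k ^ 2) * (n : ℝ)⁻¹ :=
        Finset.sum_le_sum fun k hk => mul_le_mul_of_nonneg_left
          (norm_localDeriv_weight_sq_le (Finset.mem_Icc.1 hk).2 j t) (by positivity)
    _ ≤ C := by
      rw [← Finset.sum_mul]
      rcases Nat.eq_zero_or_pos n with rfl | hn
      · simpa using hC0
      · have hn' : (0 : ℝ) < n := by exact_mod_cast hn
        rw [← div_eq_mul_inv, div_le_iff₀ hn']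
        exact hS n

/-! ### The limit law -/

lemma measurable_spectralDensity (μ : Measure ℝ) : Measurable (spectralDensity μ) := by
  have h : Measurable fun x : ℝ => toIocMod Real.two_pi_pos (-Real.pi) x := by
    have e : ∀ x : ℝ, toIocMod Real.two_pi_pos (-Real.pi) x =
        -Real.pi + 2 * Real.pi - Int.fract ((-Real.pi + 2 * Real.pi - x) / (2 * Real.pi)) *
          (2 * Real.pi) := fun x => toIocMod_eq_sub_fract_mul Real.two_pi_pos (-Real.pi) x
    simp_rw [e]
    fun_prop
  exact ((Measure.measurable_rnDeriv μ volume).comp h).ennreal_toReal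

lemma IsSincGaussian.integral_exp {Ω ι : Type*} [MeasurableSpace Ω] {N : Ω → C1Path}
    {Q : Measure Ω} (hN : IsSincGaussian N Q) (s : Finset ι) (c : ι → ℝ) (t : ι → timeInterval) :
    ∫ ω, Complex.exp ((∑ i ∈ s, c i * N ω (t i) : ℝ) * Complex.I) ∂Q =
      ((Real.exp (-(sincForm s c (fun i => t i) / 2)) : ℝ) : ℂ) := by
  have h := (hN.gaussian.comp_right t).integral_exp_linearCombination
    (fun i => hN.centered (t i)) s c
  simp only [Function.comp_apply, hN.cov] at h
  rw [h, Complex.ofReal_exp]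
  congr 1
  unfold sincForm
  push_cast
  ring

lemma aemeasurable_sqrt_spectralDensity_smul {Ω : Type*} [MeasurableSpace Ω] {Q : Measure Ω}
    {X : Ω → ℝ} {N : Ω → C1Path} (μ : Measure ℝ) (hX : AEMeasurable X Q) (hN : AEMeasurable N Q) :
    AEMeasurable (fun ω => Real.sqrt (2 * Real.pi * spectralDensity μ (X ω)) • N ω) Q :=
  AEMeasurable.smul ((((measurable_spectralDensity μ).comp_aemeasurable hX).const_mul _).sqrt) hN

section Limit

open C1Path

variable {Ω : Type*} [MeasurableSpace Ω] {Q : Measure Ω} [IsProbabilityMeasure Q] {X : Ω → ℝ}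
  {N : Ω → C1Path}

lemma integral_exp_testFunctional_limit (μ : Measure ℝ) (hX : AEMeasurable X Q)
    (hlaw : Q.map X = uniformMeasure) (hN : IsSincGaussian N Q) (hind : IndepFun X N Q)
    (w : ℕ →₀ ℚ) :
    ∫ ω, Complex.exp (testFunctional w
        (Real.sqrt (2 * Real.pi * spectralDensity μ (X ω)) • N ω) * Complex.I) ∂Q =
      ((∫ x, Real.exp (-(Real.pi * sincForm w.support (fun j => (w j : ℝ)) (fun j => denseTime j) *
        spectralDensity μ x)) ∂uniformMeasure : ℝ) : ℂ) := by
  set r : ℝ → ℝ := fun x => Real.sqrt (2 * Real.pi * spectralDensity μ x) with hr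
  have hrm : Measurable r := ((measurable_spectralDensity μ).const_mul _).sqrt
  have hsmul : ∀ (x : ℝ) (g : C1Path), testFunctional w (r x • g) = r x * testFunctional w g := by
    intro x g
    simp only [testFunctional, Finsupp.sum, Finset.mul_sum]
    refine Finset.sum_congr rfl fun j _ => ?_
    have : (r x • g) (denseTime j) = r x * g (denseTime j) := rfl
    rw [this]
    ring
  have hFm : Measurable fun p : ℝ × C1Path =>
      Complex.exp ((r p.1 * testFunctional w p.2 : ℝ) * Complex.I) :=
    Complex.continuous_exp.measurable.comp ((Complex.measurable_ofReal.comp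
      ((hrm.comp measurable_fst).mul
        ((continuous_testFunctional w).measurable.comp measurable_snd))).mul_const _)
  have := Measure.isProbabilityMeasure_map hN.aemeasurable (μ := Q)
  have hFi : Integrable (fun p : ℝ × C1Path =>
      Complex.exp ((r p.1 * testFunctional w p.2 : ℝ) * Complex.I))
      (uniformMeasure.prod (Q.map N)) :=
    Integrable.of_bound (C := 1) hFm.aestronglyMeasurable
      (Eventually.of_forall fun p => (Complex.norm_exp_ofReal_mul_I _).le)
  have hprod := (indepFun_iff_map_prod_eq_prod_map_map hX hN.aemeasurable).1 hind
  rw [hlaw] at hprod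
  have h1 : ∫ ω, Complex.exp (testFunctional w (r (X ω) • N ω) * Complex.I) ∂Q =
      ∫ p : ℝ × C1Path, Complex.exp ((r p.1 * testFunctional w p.2 : ℝ) * Complex.I)
        ∂(uniformMeasure.prod (Q.map N)) := by
    rw [← hprod, integral_map (hX.prodMk hN.aemeasurable) hFm.aestronglyMeasurable]
    simp_rw [hsmul]
  rw [h1, integral_prod _ hFi, ← integral_complex_ofReal]
  refine integral_congr_ae (Eventually.of_forall fun x => ?_)
  simp only
  have hxm : Measurable fun g : C1Path =>
      Complex.exp ((r x * testFunctional w g : ℝ) * Complex.I) :=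
    Complex.continuous_exp.measurable.comp ((Complex.measurable_ofReal.comp
      ((continuous_testFunctional w).measurable.const_mul _)).mul_const _)
  rw [integral_map hN.aemeasurable hxm.aestronglyMeasurable]
  have h2 := hN.integral_exp w.support (fun j => r x * (w j : ℝ)) denseTime
  have h3 : ∀ ω, r x * testFunctional w (N ω) =
      ∑ j ∈ w.support, r x * (w j : ℝ) * N ω (denseTime j) := by
    intro ω
    simp only [testFunctional, Finsupp.sum, Finset.mul_sum, mul_assoc]
  simp_rw [h3]
  rw [h2]
  congr 3
  have hψ : 0 ≤ 2 * Real.pi * spectralDensity μ x :=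
    mul_nonneg (by positivity) ENNReal.toReal_nonneg
  have hr2 : r x * r x = 2 * Real.pi * spectralDensity μ x := Real.mul_self_sqrt hψ
  have h4 : sincForm w.support (fun j => r x * (w j : ℝ)) (fun j => denseTime j) =
      r x * r x * sincForm w.support (fun j => (w j : ℝ)) (fun j => denseTime j) := by
    unfold sincForm
    rw [Finset.mul_sum]
    refine Finset.sum_congr rfl fun i _ => ?_
    rw [Finset.mul_sum]
    exact Finset.sum_congr rfl fun j _ => by ring
  rw [h4, hr2]
  ring

lemma tendstoInDistribution_localizedPath (μ : Measure ℝ) (hX : AEMeasurable X Q)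
    (hlaw : Q.map X = uniformMeasure) (hN : IsSincGaussian N Q) (hind : IndepFun X N Q)
    {a b : ℕ → ℝ} {C : ℝ} (hS : ∀ n : ℕ, ∑ k ∈ Finset.Icc 1 n, (a k ^ 2 + b k ^ 2) ≤ C * n)
    (hchar : ∀ w : ℕ →₀ ℚ, Tendsto (fun n => quenchedChar
      (timeSymbol w.support (fun j => (w j : ℝ)) (fun j => denseTime j)) a b n) atTop
      (𝓝 ((∫ x, Real.exp (-(Real.pi * sincForm w.support (fun j => (w j : ℝ))
        (fun j => denseTime j) * spectralDensity μ x)) ∂uniformMeasure : ℝ) : ℂ))) :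
    TendstoInDistribution (fun (n : ℕ) ω => localizedPath a b n (X ω)) atTop
      (fun ω => Real.sqrt (2 * Real.pi * spectralDensity μ (X ω)) • N ω) (fun _ => Q) Q := by
  have hcont : ∀ n, Continuous fun x => localizedPath a b n x := fun n =>
    continuous_localizedPath (a := fun _ => a) (b := fun _ => b) (x := fun x => x)
      (fun _ => continuous_const) (fun _ => continuous_const) continuous_id n
  have hlim := aemeasurable_sqrt_spectralDensity_smul μ hX hN.aemeasurable
  have hmeas : ∀ n, AEMeasurable (fun ω => localizedPath a b n (X ω)) Q := fun n =>
    (hcont n).measurable.comp_aemeasurable hX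
  have hmap : ∀ n, Q.map (fun ω => localizedPath a b n (X ω)) =
      uniformMeasure.map fun x => localizedPath a b n x := fun n => by
    rw [← hlaw, AEMeasurable.map_map_of_aemeasurable (hcont n).measurable.aemeasurable hX]
    rfl
  refine ⟨hmeas, hlim, tendsto_of_tight_of_testChar ?_ fun w => ?_⟩
  · refine (isTightMeasureSet_uniformMeasure_map hS).subset ?_
    rintro _ ⟨n, rfl⟩
    exact ⟨n, (hmap n).symm⟩
  · have hc : Continuous fun g : C1Path => Complex.exp (testFunctional w g * Complex.I) :=
      (testChar w).continuous
    simp only [ProbabilityMeasure.coe_mk]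
    rw [integral_map hlim hc.aestronglyMeasurable, integral_exp_testFunctional_limit μ hX hlaw hN hind]
    refine (hchar w).congr fun n => ?_
    rw [hmap, integral_map (hcont n).measurable.aemeasurable hc.aestronglyMeasurable]
    unfold quenchedChar
    simp_rw [trigSum_trigWeight_timeSymbol]
    rfl

end Limit

/-! ### Existence of the process with covariance `sinc` -/

/-- The space of `2n` real coefficients. -/
abbrev CoeffSpace (n : ℕ) : Type := EuclideanSpace ℝ (Finset.Icc 1 n × Bool)

/-- The coefficients as sequences. -/
def coeffSeq (n : ℕ) (β : Bool) (p : CoeffSpace n) (k : ℕ) : ℝ :=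
  if h : k ∈ Finset.Icc 1 n then p (⟨k, h⟩, β) else 0

/-- The vector of real and imaginary parts of `w`. -/
def weightVector (n : ℕ) (w : ℕ → ℂ) : CoeffSpace n :=
  WithLp.toLp 2 fun q => if q.2 then (w q.1).re else (w q.1).im

lemma continuous_coeffSeq (n : ℕ) (β : Bool) (k : ℕ) : Continuous fun p => coeffSeq n β p k := by
  unfold coeffSeq
  split_ifs
  · fun_prop
  · exact continuous_const

lemma trigSum_coeffSeq (n : ℕ) (w : ℕ → ℂ) (p : CoeffSpace n) :
    trigSum (coeffSeq n true p) (coeffSeq n false p) n w = inner ℝ p (weightVector n w) := by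
  rw [PiLp.inner_apply, Fintype.sum_prod_type, trigSum, ← Finset.sum_coe_sort]
  refine Finset.sum_congr rfl fun k _ => ?_
  rw [Fintype.sum_bool]
  simp only [coeffSeq, weightVector, Finset.coe_mem, dif_pos]
  simp
  ring

lemma norm_weightVector_sq (n : ℕ) (w : ℕ → ℂ) :
    ‖weightVector n w‖ ^ 2 = ∑ k ∈ Finset.Icc 1 n, ‖w k‖ ^ 2 := by
  rw [EuclideanSpace.norm_sq_eq, Fintype.sum_prod_type,
    ← Finset.sum_coe_sort (Finset.Icc 1 n) fun k => ‖w k‖ ^ 2]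
  refine Finset.sum_congr rfl fun k _ => ?_
  rw [Fintype.sum_bool, ← Complex.normSq_eq_norm_sq, Complex.normSq_apply]
  simp [weightVector, sq]

lemma integral_exp_trigSum_coeffSeq (n : ℕ) (w : ℕ → ℂ) :
    ∫ p, Complex.exp ((trigSum (coeffSeq n true p) (coeffSeq n false p) n w : ℝ) * Complex.I)
      ∂(stdGaussian (CoeffSpace n)) =
      ((Real.exp (-((∑ k ∈ Finset.Icc 1 n, ‖w k‖ ^ 2) / 2)) : ℝ) : ℂ) := by
  have h := charFun_stdGaussian (weightVector n w)
  rw [charFun_apply] at h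
  simp_rw [trigSum_coeffSeq]
  rw [h, ← norm_weightVector_sq]
  push_cast
  ring_nf

lemma integral_sq_trigSum_coeffSeq (n : ℕ) (w : ℕ → ℂ) :
    Integrable (fun p => trigSum (coeffSeq n true p) (coeffSeq n false p) n w ^ 2)
      (stdGaussian (CoeffSpace n)) ∧
    ∫ p, trigSum (coeffSeq n true p) (coeffSeq n false p) n w ^ 2 ∂(stdGaussian (CoeffSpace n)) =
      ∑ k ∈ Finset.Icc 1 n, ‖w k‖ ^ 2 := by
  set L : StrongDual ℝ (CoeffSpace n) := innerSL ℝ (weightVector n w) with hL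
  have e : ∀ p, trigSum (coeffSeq n true p) (coeffSeq n false p) n w = L p := fun p => by
    rw [trigSum_coeffSeq, hL, innerSL_apply_apply, real_inner_comm]
  simp_rw [e]
  refine ⟨(IsGaussian.memLp_dual (stdGaussian (CoeffSpace n)) L 2 (by simp)).integrable_sq, ?_⟩
  rw [← norm_weightVector_sq, ← innerSL_apply_norm ℝ (weightVector n w),
    ← variance_dual_stdGaussian, variance_of_integral_eq_zero L.continuous.aemeasurable
      (integral_strongDual_stdGaussian L)]

/-- The law of the localized path at `0` with independent standard Gaussian coefficients. -/
def whiteNoiseLaw (n : ℕ) : ProbabilityMeasure C1Path :=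
  ⟨(stdGaussian (CoeffSpace n)).map fun p =>
    localizedPath (coeffSeq n true p) (coeffSeq n false p) n 0,
    Measure.isProbabilityMeasure_map (continuous_localizedPath (continuous_coeffSeq n true)
      (continuous_coeffSeq n false) continuous_const n).measurable.aemeasurable⟩

lemma isTightMeasureSet_whiteNoiseLaw :
    IsTightMeasureSet {ν | ∃ n, (whiteNoiseLaw n : Measure C1Path) = ν} := by
  refine isTightMeasureSet_localizedPath (fun n => stdGaussian (CoeffSpace n))
    (fun n => coeffSeq n true) (fun n => coeffSeq n false) (fun _ _ => 0) (fun n => n)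
    (fun n => continuous_coeffSeq n true) (fun n => continuous_coeffSeq n false)
    (fun _ => continuous_const) 2 (by norm_num) fun n j t => ?_
  set w : ℕ → ℂ := trigWeight (fun v => (Complex.I * v) ^ j * Complex.exp (Complex.I * (v * t : ℝ)))
    n 0 with hw
  obtain ⟨hi, hsq⟩ := integral_sq_trigSum_coeffSeq n w
  have hm : AEStronglyMeasurable (fun p => trigSum (coeffSeq n true p) (coeffSeq n false p) n w)
      (stdGaussian (CoeffSpace n)) := by
    simp_rw [trigSum_coeffSeq]
    exact Continuous.aestronglyMeasurable (by fun_prop)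
  have hle : ∀ y : ℝ, |y| ≤ 1 + y ^ 2 := fun y => by
    nlinarith [sq_nonneg (|y| - 1), sq_abs y, abs_nonneg y]
  have hi1 : Integrable (fun p => |trigSum (coeffSeq n true p) (coeffSeq n false p) n w|)
      (stdGaussian (CoeffSpace n)) :=
    ((integrable_const (1 : ℝ)).add hi).mono' hm.norm
      (Eventually.of_forall fun p => by
        rw [Real.norm_eq_abs, abs_abs]; exact hle _)
  change ∫⁻ p, ENNReal.ofReal |trigSum (coeffSeq n true p) (coeffSeq n false p) n w|
    ∂(stdGaussian (CoeffSpace n)) ≤ _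
  rw [← ofReal_integral_eq_lintegral_ofReal hi1 (Eventually.of_forall fun _ => abs_nonneg _)]
  refine ENNReal.ofReal_le_ofReal ((integral_mono hi1 ((integrable_const (1 : ℝ)).add hi)
    fun p => hle _).trans ?_)
  simp only [Pi.add_apply]
  rw [integral_add (integrable_const _) hi, hsq]
  have hsum : ∑ k ∈ Finset.Icc 1 n, ‖w k‖ ^ 2 ≤ 1 := by
    refine (Finset.sum_le_card_nsmul _ _ ((n : ℝ)⁻¹) fun k hk => ?_).trans ?_
    · have := norm_localDeriv_weight_sq_le (Finset.mem_Icc.1 hk).2 j t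
      refine le_trans (le_of_eq ?_) this
      simp [hw, trigWeight]
    · rw [nsmul_eq_mul, Nat.card_Icc, Nat.add_sub_cancel]
      exact mul_inv_le_one
  simp only [integral_const, probReal_univ, smul_eq_mul, mul_one]
  linarith

lemma sincForm_nonneg {ι : Type*} (s : Finset ι) (c t : ι → ℝ) : 0 ≤ sincForm s c t :=
  ge_of_tendsto' (tendsto_mean_norm_timeSymbol_sq s c t) fun n => by positivity

lemma tendsto_integral_exp_whiteNoiseLaw {ι : Type*} (s : Finset ι) (c : ι → ℝ)
    (t : ι → timeInterval) :
    Tendsto (fun n => ∫ g, Complex.exp ((∑ i ∈ s, c i * g (t i) : ℝ) * Complex.I)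
      ∂(whiteNoiseLaw n : Measure C1Path)) atTop
      (𝓝 ((Real.exp (-(sincForm s c (fun i => t i) / 2)) : ℝ) : ℂ)) := by
  have hc : Continuous fun g : C1Path => Complex.exp ((∑ i ∈ s, c i * g (t i) : ℝ) * Complex.I) := by
    have : Continuous fun g : C1Path => ∑ i ∈ s, c i * g (t i) :=
      continuous_finsetSum _ fun i _ => continuous_const.mul (C1Path.continuous_eval (t i))
    fun_prop
  have hlim := tendsto_mean_norm_timeSymbol_sq s c fun i => (t i : ℝ)
  refine ((Complex.continuous_ofReal.tendsto _).comp
    ((Real.continuous_exp.tendsto _).comp (hlim.div_const 2).neg)).congr fun n => ?_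
  have hcont := continuous_localizedPath (continuous_coeffSeq n true)
    (continuous_coeffSeq n false) (x := fun _ => 0) continuous_const n
  rw [whiteNoiseLaw, ProbabilityMeasure.coe_mk,
    integral_map hcont.measurable.aemeasurable hc.aestronglyMeasurable]
  have h := integral_exp_trigSum_coeffSeq n (trigWeight (timeSymbol s c fun i => t i) n 0)
  simp_rw [trigSum_trigWeight_timeSymbol] at h
  refine Eq.trans ?_ h.symm
  simp only [Function.comp_apply]
  congr 4
  rw [Finset.sum_div]
  refine Finset.sum_congr rfl fun k _ => ?_
  rw [trigWeight, norm_mul, norm_mul, Complex.norm_exp_I_mul_ofReal, mul_one, Complex.norm_real,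
    mul_pow, Real.norm_eq_abs, sq_abs, inv_pow, Real.sq_sqrt (Nat.cast_nonneg n), inv_mul_eq_div]

/-- There is a law on `C¹([0, 2π])` with the characteristic functionals of the Gaussian process
with covariance `sinc`. -/
lemma exists_probabilityMeasure_integral_exp : ∃ γ : ProbabilityMeasure C1Path,
    ∀ {ι : Type} (s : Finset ι) (c : ι → ℝ) (t : ι → timeInterval),
      ∫ g, Complex.exp ((∑ i ∈ s, c i * g (t i) : ℝ) * Complex.I) ∂(γ : Measure C1Path) =
        ((Real.exp (-(sincForm s c (fun i => t i) / 2)) : ℝ) : ℂ) := by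
  have hcomp : IsCompact (closure (Set.range whiteNoiseLaw)) := by
    refine isCompact_closure_of_isTightMeasureSet (isTightMeasureSet_whiteNoiseLaw.subset ?_)
    rintro _ ⟨_, ⟨n, rfl⟩, rfl⟩
    exact ⟨n, rfl⟩
  obtain ⟨γ, -, hγ⟩ := hcomp.ultrafilter_le_nhds ((Filter.hyperfilter ℕ).map whiteNoiseLaw)
    (le_trans (by simp) (monotone_principal subset_closure))
  have hγ' : Tendsto whiteNoiseLaw (Filter.hyperfilter ℕ) (𝓝 γ) := hγ
  refine ⟨γ, fun s c t => ?_⟩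
  have hc : Continuous fun g : C1Path => ∑ i ∈ s, c i * g (t i) :=
    continuous_finsetSum _ fun i _ => continuous_const.mul (C1Path.continuous_eval (t i))
  rw [ProbabilityMeasure.tendsto_iff_forall_integral_rclike_tendsto ℂ] at hγ'
  have h1 := hγ' (BoundedContinuousFunction.ofNormedAddCommGroup
    (fun g => Complex.exp ((∑ i ∈ s, c i * g (t i) : ℝ) * Complex.I)) (by fun_prop) 1
    (fun g => (Complex.norm_exp_ofReal_mul_I _).le))
  refine tendsto_nhds_unique h1 ((tendsto_integral_exp_whiteNoiseLaw s c t).mono_left ?_)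
  exact Nat.hyperfilter_le_atTop

section Law

variable {γ : Measure C1Path} [IsProbabilityMeasure γ]

lemma map_sum_eval_eq_gaussianReal (hγ : ∀ {ι : Type} (s : Finset ι) (c : ι → ℝ)
      (t : ι → timeInterval),
      ∫ g, Complex.exp ((∑ i ∈ s, c i * g (t i) : ℝ) * Complex.I) ∂γ =
        ((Real.exp (-(sincForm s c (fun i => t i) / 2)) : ℝ) : ℂ))
    {ι : Type} (s : Finset ι) (c : ι → ℝ) (t : ι → timeInterval) :
    γ.map (fun g => ∑ i ∈ s, c i * g (t i)) =
      gaussianReal 0 (sincForm s c fun i => t i).toNNReal := by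
  have hc : Continuous fun g : C1Path => ∑ i ∈ s, c i * g (t i) :=
    continuous_finsetSum _ fun i _ => continuous_const.mul (C1Path.continuous_eval (t i))
  have := Measure.isProbabilityMeasure_map (μ := γ) hc.measurable.aemeasurable
  refine Measure.ext_of_charFun ?_
  ext u
  rw [charFun_gaussianReal, charFun_apply_real, integral_map hc.measurable.aemeasurable
    (Continuous.aestronglyMeasurable (by fun_prop))]
  have h := hγ s (fun i => u * c i) t
  have e : sincForm s (fun i => u * c i) (fun i => (t i : ℝ)) =
      u ^ 2 * sincForm s c fun i => t i := by
    unfold sincForm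
    rw [Finset.mul_sum]
    refine Finset.sum_congr rfl fun i _ => ?_
    rw [Finset.mul_sum]
    exact Finset.sum_congr rfl fun j _ => by ring
  rw [e] at h
  simp only [mul_assoc, ← Finset.mul_sum, Complex.ofReal_mul] at h
  simp only [mul_assoc]
  rw [h, Complex.ofReal_exp]
  congr 1
  rw [show ((Real.toNNReal (sincForm s c fun i => t i) : ℝ) : ℂ) = (sincForm s c fun i => t i : ℝ) by
    rw [Real.coe_toNNReal _ (sincForm_nonneg _ _ _)]]
  push_cast
  ring

lemma isSincGaussian_of_integral_exp (hγ : ∀ {ι : Type} (s : Finset ι) (c : ι → ℝ)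
      (t : ι → timeInterval),
      ∫ g, Complex.exp ((∑ i ∈ s, c i * g (t i) : ℝ) * Complex.I) ∂γ =
        ((Real.exp (-(sincForm s c (fun i => t i) / 2)) : ℝ) : ℂ)) :
    IsSincGaussian (fun g : C1Path => g) γ := by
  have hlaw : ∀ {ι : Type} (s : Finset ι) (c : ι → ℝ) (t : ι → timeInterval),
      γ.map (fun g => ∑ i ∈ s, c i * g (t i)) =
        gaussianReal 0 (sincForm s c fun i => t i).toNNReal := fun s c t =>
    map_sum_eval_eq_gaussianReal hγ s c t
  have hmeas : ∀ {ι : Type} (s : Finset ι) (c : ι → ℝ) (t : ι → timeInterval),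
      Measurable fun g : C1Path => ∑ i ∈ s, c i * g (t i) := fun s c t =>
    Finset.measurable_fun_sum _ fun i _ => (C1Path.continuous_eval (t i)).measurable.const_mul _
  have hsq : ∀ {ι : Type} (s : Finset ι) (c : ι → ℝ) (t : ι → timeInterval),
      Integrable (fun g : C1Path => (∑ i ∈ s, c i * g (t i)) ^ 2) γ ∧
        ∫ g, (∑ i ∈ s, c i * g (t i)) ^ 2 ∂γ = sincForm s c fun i => t i := by
    intro ι s c t
    have hm : AEStronglyMeasurable (fun x : ℝ => x ^ 2) (γ.map fun g => ∑ i ∈ s, c i * g (t i)) :=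
      Continuous.aestronglyMeasurable (by fun_prop)
    have h2 := memLp_id_gaussianReal (μ := 0) (v := (sincForm s c fun i => t i).toNNReal) 2
    constructor
    · have h3 : Integrable (fun x : ℝ => x ^ 2) (γ.map fun g => ∑ i ∈ s, c i * g (t i)) := by
        rw [hlaw]
        exact h2.integrable_sq
      exact h3.comp_measurable (hmeas s c t)
    · rw [← integral_map (φ := fun g : C1Path => ∑ i ∈ s, c i * g (t i))
        (hmeas s c t).aemeasurable hm, hlaw]
      have h4 := variance_id_gaussianReal (μ := 0) (v := (sincForm s c fun i => t i).toNNReal)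
      rw [variance_of_integral_eq_zero aemeasurable_id (by simp [integral_id_gaussianReal]),
        Real.coe_toNNReal _ (sincForm_nonneg _ _ _)] at h4
      exact h4
  refine ⟨aemeasurable_id, ⟨fun I => ⟨isGaussian_of_map_eq_gaussianReal fun L => ?_⟩⟩,
    fun t => ?_, fun s t => ?_⟩
  · have hr : Measurable fun g : C1Path => I.restrict fun t => g t :=
      measurable_pi_lambda _ fun t => (C1Path.continuous_eval _).measurable
    refine ⟨0, (sincForm Finset.univ (fun i : I => L (Pi.single i 1))
      fun i => ((i.1 : timeInterval) : ℝ)).toNNReal, ?_⟩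
    · rw [Measure.map_map L.continuous.measurable hr]
      have e : (L ∘ fun g : C1Path => I.restrict fun t => g t) =
          fun g => ∑ i : I, L (Pi.single i 1) * g i.1 := by
        ext g
        simp only [Function.comp_apply]
        conv_lhs => rw [← Finset.univ_sum_single (I.restrict fun t => g t)]
        rw [map_sum]
        refine Finset.sum_congr rfl fun i _ => ?_
        have : Pi.single i (I.restrict (fun t => g t) i) =
            (g i.1) • (Pi.single i (1 : ℝ) : I → ℝ) := by
          rw [← Pi.single_smul, smul_eq_mul, mul_one]
          rfl
        rw [this, map_smul, smul_eq_mul, mul_comm]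
      rw [e]
      exact hlaw Finset.univ (fun i : I => L (Pi.single i 1)) fun i => i.1
  · have h := hlaw (Finset.univ : Finset Unit) (fun _ => 1) fun _ => t
    simp only [Finset.univ_unique, Finset.sum_singleton, one_mul] at h
    have h2 := integral_map (μ := γ) (φ := fun g : C1Path => g t) (f := fun x : ℝ => x)
      (C1Path.continuous_eval t).measurable.aemeasurable
      (Continuous.aestronglyMeasurable (by fun_prop))
    rw [← h2, h, integral_id_gaussianReal]
  · obtain ⟨i1, e1⟩ := hsq (Finset.univ : Finset Bool) (fun _ => 1) fun β => if β then s else t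
    obtain ⟨i2, e2⟩ := hsq (Finset.univ : Finset Bool) (fun β => if β then 1 else -1)
      fun β => if β then s else t
    have e3 : ∀ g : C1Path, g s * g t =
        ((∑ β : Bool, 1 * g (if β then s else t)) ^ 2 -
          (∑ β : Bool, (if β then 1 else -1) * g (if β then s else t)) ^ 2) / 4 := by
      intro g
      simp
      ring
    simp_rw [e3]
    rw [integral_div, integral_sub i1 i2, e1, e2]
    have hsymm : Real.sinc ((t : ℝ) - s) = Real.sinc ((s : ℝ) - t) := by
      rw [← neg_sub, Real.sinc_neg]
    simp [sincForm, hsymm]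
    ring

end Law

theorem exists_isSincGaussian : ∃ γ : Measure C1Path, IsProbabilityMeasure γ ∧
    IsSincGaussian (fun g : C1Path => g) γ := by
  obtain ⟨γ, hγ⟩ := exists_probabilityMeasure_integral_exp
  exact ⟨γ, inferInstance, isSincGaussian_of_integral_exp hγ⟩

/-! ### Measurable versions of the coefficients and conclusion -/

lemma IsStationaryGaussianSeq.congr {Ω : Type*} [MeasurableSpace Ω] {P : Measure Ω}
    {a a' : ℕ → Ω → ℝ} {ρ : ℕ → ℝ} (ha : IsStationaryGaussianSeq a ρ P)
    (h : ∀ k, 1 ≤ k → a k =ᵐ[P] a' k) : IsStationaryGaussianSeq a' ρ P where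
  gaussian := ha.gaussian.congr fun k => h (k + 1) (by omega)
  centered k hk := by rw [← integral_congr_ae (h k hk), ha.centered k hk]
  cov k l hk hl := by
    rw [← ha.cov k l hk hl]
    exact integral_congr_ae ((h k hk).mul (h l hl)).symm
  unit_variance := ha.unit_variance

lemma IsStationaryGaussianSeq.exists_measurable {Ω : Type*} [MeasurableSpace Ω] {P : Measure Ω}
    {a : ℕ → Ω → ℝ} {ρ : ℕ → ℝ} (ha : IsStationaryGaussianSeq a ρ P) :
    ∃ a' : ℕ → Ω → ℝ, (∀ k, Measurable (a' k)) ∧ ∀ k, 1 ≤ k → a k =ᵐ[P] a' k := by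
  have h : ∀ k, ∃ f : Ω → ℝ, Measurable f ∧ (1 ≤ k → a k =ᵐ[P] f) := by
    intro k
    by_cases hk : 1 ≤ k
    · exact ⟨_, (ha.aemeasurable hk).measurable_mk, fun _ => (ha.aemeasurable hk).ae_eq_mk⟩
    · exact ⟨0, measurable_zero, fun h => absurd h hk⟩
  choose f hf using h
  exact ⟨f, fun k => (hf k).1, fun k => (hf k).2⟩

lemma localizedPath_congr {a a' b b' : ℕ → ℝ} (ha : ∀ k, 1 ≤ k → a k = a' k)
    (hb : ∀ k, 1 ≤ k → b k = b' k) (n : ℕ) (x : ℝ) :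
    localizedPath a b n x = localizedPath a' b' n x := by
  have h : trigPoly a b n = trigPoly a' b' n := by
    ext y
    unfold trigPoly
    congr 1
    refine Finset.sum_congr rfl fun k hk => ?_
    rw [ha k (Finset.mem_Icc.1 hk).1, hb k (Finset.mem_Icc.1 hk).1]
  simp only [localizedPath, h]

lemma IsCoefficientModel.ae_tendstoInDistribution {Ω : Type*} [MeasurableSpace Ω]
    {a b : ℕ → Ω → ℝ} {ρ : ℕ → ℝ} {μ : Measure ℝ} {P : Measure Ω}
    (h : IsCoefficientModel a b ρ μ P) {Ω' : Type*} [MeasurableSpace Ω'] {Q : Measure Ω'}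
    [IsProbabilityMeasure Q] {X : Ω' → ℝ} {N : Ω' → C1Path} (hX : AEMeasurable X Q)
    (hlaw : Q.map X = uniformMeasure) (hN : IsSincGaussian N Q) (hind : IndepFun X N Q) :
    ∀ᵐ ω ∂P, TendstoInDistribution
      (fun (n : ℕ) ω' => localizedPath (fun k => a k ω) (fun k => b k ω) n (X ω')) atTop
      (fun ω' => Real.sqrt (2 * Real.pi * spectralDensity μ (X ω')) • N ω') (fun _ => Q) Q := by
  have hchar : ∀ᵐ ω ∂P, ∀ w : ℕ →₀ ℚ, _ := ae_all_iff.2 fun w : ℕ →₀ ℚ =>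
    h.ae_tendsto_quenchedChar
      (isBoundedLipschitz_timeSymbol w.support (fun j => (w j : ℝ)) fun j => C1Path.denseTime j)
      (tendsto_mean_norm_timeSymbol_sq _ _ _)
  filter_upwards [hchar, h.left.ae_exists_sum_sq_le h.measurable_left,
    h.right.ae_exists_sum_sq_le h.measurable_right] with ω hω ⟨C, hC⟩ ⟨C', hC'⟩
  refine tendstoInDistribution_localizedPath μ hX hlaw hN hind (C := C + C') (fun n => ?_) hω
  rw [Finset.sum_add_distrib, add_mul]
  exact add_le_add (hC n) (hC' n)

end

theorem theorem6 {Ω : Type*} [MeasurableSpace Ω] (P : Measure Ω) [IsProbabilityMeasure P]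
    (a b : ℕ → Ω → ℝ) (ρ : ℕ → ℝ)
    (ha : IsStationaryGaussianSeq a ρ P) (hb : IsStationaryGaussianSeq b ρ P)
    (hab : IndepFun (fun ω (k : ℕ) => a (k + 1) ω) (fun ω (k : ℕ) => b (k + 1) ω) P)
    (μ : Measure ℝ) (hμ : IsSpectralMeasure ρ μ) :
    (∃ γ : Measure C1Path, IsProbabilityMeasure γ ∧ IsSincGaussian (fun g : C1Path => g) γ) ∧
    ∀ (Ω' : Type*) [MeasurableSpace Ω'] (Q : Measure Ω') [IsProbabilityMeasure Q]
      (X : Ω' → ℝ) (N : Ω' → C1Path),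
      pdf.IsUniform X (Set.Icc 0 (2 * Real.pi)) Q volume →
      IsSincGaussian N Q →
      IndepFun X N Q →
      ∀ᵐ ω ∂P, TendstoInDistribution
        (fun (n : ℕ) ω' => localizedPath (fun k => a k ω) (fun k => b k ω) n (X ω'))
        atTop
        (fun ω' => Real.sqrt (2 * Real.pi * spectralDensity μ (X ω')) • N ω')
        (fun _ => Q) Q := by
  refine ⟨exists_isSincGaussian, fun Ω' _ Q _ X N hunif hN hind => ?_⟩
  have hX : AEMeasurable X Q := hunif.aemeasurable
    (by simp [Real.volume_Icc, Real.pi_pos])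
    (by rw [Real.volume_Icc]; exact ENNReal.ofReal_ne_top)
  obtain ⟨a', ham, haa⟩ := ha.exists_measurable
  obtain ⟨b', hbm, hbb⟩ := hb.exists_measurable
  have haa' : ∀ᵐ ω ∂P, ∀ k, 1 ≤ k → a k ω = a' k ω :=
    ae_all_iff.2 fun k => eventually_all.2 fun hk => haa k hk
  have hbb' : ∀ᵐ ω ∂P, ∀ k, 1 ≤ k → b k ω = b' k ω :=
    ae_all_iff.2 fun k => eventually_all.2 fun hk => hbb k hk
  have hmodel : IsCoefficientModel a' b' ρ μ P :=
    { left := ha.congr haa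
      right := hb.congr hbb
      indep := hab.congr
        (haa'.mono fun ω h => funext fun k => h (k + 1) (Nat.le_add_left 1 k))
        (hbb'.mono fun ω h => funext fun k => h (k + 1) (Nat.le_add_left 1 k))
      spectral := hμ
      measurable_left := ham
      measurable_right := hbm }
  filter_upwards [hmodel.ae_tendstoInDistribution hX hunif hN hind, haa', hbb'] with ω h h1 h2
  have e : (fun (n : ℕ) ω' => localizedPath (fun k => a k ω) (fun k => b k ω) n (X ω')) =
      fun (n : ℕ) ω' => localizedPath (fun k => a' k ω) (fun k => b' k ω) n (X ω') := by
    ext1 n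
    ext1 ω'
    exact localizedPath_congr h1 h2 n (X ω')
  rw [e]
  exact h
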